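/- Let $V=\mathbb R^{6}$ with coordinates $x_1,x_2,x_3,y_1,y_2,y_3$ and symplectic form $\omega=\sum_i dx_i\wedge dy_i$. Let $P=(\Lambda^3_{\mathrm{pr}}V^\vee)\otimes\mathbb C$ be the real vector space of complex-valued alternating $3$-forms $\Omega$ on $V$ with $\Omega\wedge\omega=0$. Let $\mathcal U(V)\subset P$ be the set of those $\Omega$ whose pullback to every Lagrangian subspace $L\subset V$ is non-zero. Each $\Omega\in\mathcal U(V)$ defines a phase map $L\mapsto\mathrm{Arg}(\Omega|_L)\in\mathbb R/\pi\mathbb Z$ on the Lagrangian Grassmannian; let $\mathcal U^+(V)\subset\mathcal U(V)$ be the set of those $\Omega$ whose phase map sends the canonical generator of the fundamental group of the Lagrangian Grassmannian, represented by the loop $\theta\mapsto e^{i\theta}\mathbb R\times\mathbb R^{2}\subset\mathbb C^3=V$ $(\theta\in\mathbb R/\pi\mathbb Z$, $z=x+iy)$, to a positive loop. Put $$\mathcal U_1^+(V)=\Big\{\Omega\in\mathcal U^+(V)\ :\ \tfrac{\omega^3}{3!}=(-1)^{3}\big(\tfrac i2\big)^3\,\Omega\wedge\overline\Omega\Big\},\qquad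 \mathcal M_1(3)=\mathcal U_1^+(\mathbb R^6)/\mathrm{Sp}(6,\mathbb Z),$$ where $\mathrm{Sp}(6,\mathbb Z)$ acts by pullback. The group $\mathrm{SL}(2,\mathbb R)$ acts on $\mathcal U_1^+(V)$ and on $\mathcal M_1(3)$ through its linear action on the values $\mathbb C=\mathbb R^2$ of the forms. The space $P$ carries the symplectic form $\sigma(\Omega_1,\Omega_2)=\mathrm{Im}(\Omega_1\wedge\Omega_2)\,(\omega^3/3!)^{-1}$. Contracting the volume form of $\sigma$ with the Euler vector field of $P$ and restricting to the hypersurface $\mathcal U_1^+(V)$ gives a volume form on $\mathcal U_1^+(V)$, hence a measure $\mathrm{Vol}$ on the quotient $\mathcal M_1(3)$ (the mass of a set is the mass of the part of a fundamental domain that lies over it). Theorem. The measure $\mathrm{Vol}$ on $\mathcal M_1(3)$ is $\mathrm{SL}(2,\mathbb R)$-invariant, and $$\mathrm{Vol}(\mathcal M_1(3))=\infty .$$ More generally, every non-zero Borel measure on $\mathcal M_1(3)$ which is invariant under the subgroup $\{\mathrm{diag}(e^t,e^{-t}) : t\in\mathbb R\}\subset\mathrm{SL}(2,\mathbb R)$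 has infinite total mass. -/

import Mathlib

open MeasureTheory Set
open scoped Pointwise

noncomputable section

namespace LagForms

/-! ### The standard symplectic vector space `ℝ²ⁿ` -/

/-- `ℝ²ⁿ` with coordinates `x i = v (inl i)` and `y i = v (inr i)`. -/
abbrev V (n : ℕ) : Type := Fin n ⊕ Fin n → ℝ

/-- The coordinate vector `∂/∂x i`. -/
def ex {n : ℕ} (i : Fin n) : V n := Pi.single (Sum.inl i) 1

/-- The coordinate vector `∂/∂y i`. -/
def ey {n : ℕ} (i : Fin n) : V n := Pi.single (Sum.inr i) 1

/-- The standard symplectic form `ω = ∑ dx i ∧ dy i`, as a function of two vectors. -/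
def omegaFun {n : ℕ} (v w : V n) : ℝ :=
  ∑ i : Fin n, (v (Sum.inl i) * w (Sum.inr i) - v (Sum.inr i) * w (Sum.inl i))

/-- Complex valued alternating `k`-forms on `ℝ²ⁿ`. -/
abbrev Form (n k : ℕ) : Type := V n [⋀^Fin k]→ₗ[ℝ] ℂ

/-- The standard symplectic form as a (complex valued) alternating 2-form. -/
def omega (n : ℕ) : Form n 2 where
  toFun v := (omegaFun (v 0) (v 1) : ℂ)
  map_update_add' v i x y := by
    rw [← Complex.ofReal_add]
    congr 1
    fin_cases i <;>
    · simp only [omegaFun, ← Finset.sum_add_distrib]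
      refine Finset.sum_congr rfl fun j _ => ?_
      simp
      ring
  map_update_smul' v i c x := by
    rw [Complex.real_smul, ← Complex.ofReal_mul]
    congr 1
    fin_cases i <;>
    · simp only [omegaFun, Finset.mul_sum]
      refine Finset.sum_congr rfl fun j _ => ?_
      simp
      ring
  map_eq_zero_of_eq' v i j h hij := by
    have h01 : v 0 = v 1 := by
      fin_cases i <;> fin_cases j <;> simp_all
    simp only [h01, omegaFun, Complex.ofReal_eq_zero]
    refine Finset.sum_eq_zero fun j _ => ?_
    ring

/-- The wedge product of complex valued forms, normalized as the sum over shuffles. -/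
def wedge {n p q : ℕ} (α : Form n p) (β : Form n q) : Form n (p + q) :=
  ((LinearMap.mul' ℝ ℂ).compAlternatingMap (α.domCoprod β)).domDomCongr finSumFinEquiv

theorem wedge_add_left {n p q : ℕ} (α α' : Form n p) (β : Form n q) :
    wedge (α + α') β = wedge α β + wedge α' β := by
  ext v
  simp only [wedge, ← AlternatingMap.domCoprod'_apply, TensorProduct.add_tmul, map_add]
  simp

theorem wedge_smul_left {n p q : ℕ} (c : ℝ) (α : Form n p) (β : Form n q) :
    wedge (c • α) β = c • wedge α β := by
  ext v
  simp only [wedge, ← AlternatingMap.domCoprod'_apply, ← TensorProduct.smul_tmul', map_smul]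
  simp

theorem wedge_zero_left {n p q : ℕ} (β : Form n q) : wedge (0 : Form n p) β = 0 := by
  simpa using wedge_smul_left (0 : ℝ) (0 : Form n p) β

/-- The `k`-fold wedge power `ω ^ k`. -/
def omegaPow (n : ℕ) : (k : ℕ) → Form n (2 * k)
  | 0 => AlternatingMap.constOfIsEmpty ℝ (V n) (Fin 0) 1
  | k + 1 => wedge (omegaPow n k) (omega n)

/-- The volume form `ω ^ n / n!`. -/
def volForm (n : ℕ) : Form n (n + n) :=
  ((n.factorial : ℂ)⁻¹ • omegaPow n n).domDomCongr (finCongr (two_mul n))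

/-! ### The spaces of primitive forms, of forms that do not vanish on Lagrangian subspaces, etc. -/

/-- The real vector space of complex valued primitive `n`-forms on `ℝ²ⁿ`: those with `Ω ∧ ω = 0`. -/
def Prim (n : ℕ) : Submodule ℝ (V n [⋀^Fin n]→L[ℝ] ℂ) where
  carrier := {Ω | wedge Ω.toAlternatingMap (omega n) = 0}
  add_mem' {a b} ha hb := by
    have : (a + b).toAlternatingMap = a.toAlternatingMap + b.toAlternatingMap := rfl
    simp only [mem_ofPred_eq] at ha hb ⊢
    rw [this, wedge_add_left, ha, hb, add_zero]
  zero_mem' := wedge_zero_left _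
  smul_mem' c a ha := by
    have : (c • a).toAlternatingMap = c • a.toAlternatingMap := rfl
    simp only [mem_ofPred_eq] at ha ⊢
    rw [this, wedge_smul_left, ha, smul_zero]

/-- The alternating form underlying a primitive form. -/
def toForm {n : ℕ} (Ω : Prim n) : Form n n := Ω.1.toAlternatingMap

/-- A subspace of `ℝ²ⁿ` is Lagrangian if it has dimension `n` and `ω` vanishes on it. -/
def IsLagrangian {n : ℕ} (L : Submodule ℝ (V n)) : Prop :=
  Module.finrank ℝ L = n ∧ ∀ v ∈ L, ∀ w ∈ L, omegaFun v w = 0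

/-- Primitive forms whose pullback to every Lagrangian subspace is non-zero. -/
def U (n : ℕ) : Set (Prim n) :=
  {Ω | ∀ L : Submodule ℝ (V n), IsLagrangian L → (toForm Ω).compLinearMap L.subtype ≠ 0}

/-- A basis of the Lagrangian subspace `e ^ (iθ) ℝ × ℝ ^ (n - 1)` of `ℂ ^ n = ℝ²ⁿ`,
`z = x + i y`. As `θ` runs through `ℝ / πℤ` these subspaces form a loop which represents the
canonical generator of the fundamental group of the Lagrangian Grassmannian. -/
def stdLoop {n : ℕ} [NeZero n] (θ : ℝ) : Fin n → V n :=
  Function.update ex 0 (Real.cos θ • ex 0 + Real.sin θ • ey 0)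

/-- The phase map `L ↦ Arg (Ω|_L) ∈ ℝ / πℤ` sends the canonical generator of the fundamental
group of the Lagrangian Grassmannian to a positive loop: a continuous lift of the phase along
`stdLoop` to `ℝ` increases. -/
def IsPositive {n : ℕ} [NeZero n] (Ω : Form n n) : Prop :=
  ∃ φ : ℝ → ℝ, ContinuousOn φ (Icc 0 Real.pi) ∧
    (∀ θ ∈ Icc 0 Real.pi,
      ((Complex.arg (Ω (stdLoop θ)) : ℝ) : AddCircle Real.pi) = ((φ θ : ℝ) : AddCircle Real.pi)) ∧
    φ 0 < φ Real.pi

/-- The component `𝒰⁺` of forms in `𝒰` of positive orientation. -/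
def UPlus (n : ℕ) [NeZero n] : Set (Prim n) := {Ω | Ω ∈ U n ∧ IsPositive (toForm Ω)}

/-- The complex conjugate of a form. -/
def conjForm {n k : ℕ} (α : Form n k) : Form n k :=
  Complex.conjAe.toLinearMap.compAlternatingMap α

/-- The hypersurface `𝒰₁⁺` of `Ω ∈ 𝒰⁺` normalized by
`ωⁿ / n! = (-1) ^ (n (n - 1) / 2) (i / 2) ^ n Ω ∧ conj Ω`. -/
def UOne (n : ℕ) [NeZero n] : Set (Prim n) :=
  {Ω | Ω ∈ UPlus n ∧ volForm n =
    ((-1 : ℂ) ^ (n * (n - 1) / 2) * (Complex.I / 2) ^ n) • wedge (toForm Ω) (conjForm (toForm Ω))}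

/-! ### Topology and measures -/

instance (n k : ℕ) : MeasurableSpace (V n [⋀^Fin k]→L[ℝ] ℂ) := borel _

instance (n k : ℕ) : BorelSpace (V n [⋀^Fin k]→L[ℝ] ℂ) := ⟨rfl⟩

instance (n k : ℕ) : Module.Finite ℝ (V n [⋀^Fin k]→L[ℝ] ℂ) :=
  Module.Finite.of_injective
    ({ toFun := fun f => f.toAlternatingMap.toMultilinearMap
       map_add' := fun _ _ => rfl
       map_smul' := fun _ _ => rfl } :
      (V n [⋀^Fin k]→L[ℝ] ℂ) →ₗ[ℝ] MultilinearMap ℝ (fun _ : Fin k => V n) ℂ)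
    (fun a b h => by
      ext v
      exact congrArg (fun f : MultilinearMap ℝ (fun _ : Fin k => V n) ℂ => f v) h)

/-- The measure of the volume form `σ ^ m / m!` of a bilinear form `σ` (alternating and
non-degenerate) on a real vector space of dimension `2 m`: it gives the parallelepiped
spanned by a basis `b` the mass `|Pf (σ (b i) (b j))| = √|det (σ (b i) (b j))|`. -/
def liouvilleMeasure {E : Type*} [NormedAddCommGroup E] [NormedSpace ℝ E] [Module.Finite ℝ E]
    [MeasurableSpace E] [BorelSpace E] (σ : E → E → ℝ) : Measure E :=
  ENNReal.ofReal (√|(Matrix.of fun i j =>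
      σ (Module.finBasis ℝ E i) (Module.finBasis ℝ E j)).det|) •
    (Module.finBasis ℝ E).addHaar

/-- The measure that a volume form `ν` on a vector space `E`, here given through its measure `μ`,
induces on a hypersurface `X` transverse to the Euler vector field `e`, i.e. the measure of
the volume form `(ι_e ν)|_X`. As `ν = r ^ (dim E - 1) dr ∧ ι_e ν` in the coordinates `(r, x) ↦ r x`,
the mass of `A ⊆ X` is `dim E` times the `μ`-mass of the cone `{r x | 0 < r < 1, x ∈ A}`. -/
def coneMeasure {E : Type*} [NormedAddCommGroup E] [NormedSpace ℝ E]
    [MeasurableSpace E] (μ : Measure E) (X : Set E) : Measure X :=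
  (Module.finrank ℝ E : ENNReal) •
    ((μ.comap fun p : Ioo (0 : ℝ) 1 × X => (p.1 : ℝ) • (p.2 : E)).map Prod.snd)

/-- For `π : X → Y` and a measure `m` on `X`: the least `m`-mass of a measurable
set of representatives of the points of `B`. -/
def quotientOuterMeasure {X Y : Type*} [MeasurableSpace X] (π : X → Y) (m : Measure X) :
    OuterMeasure Y where
  measureOf B := ⨅ (F : Set X) (_ : MeasurableSet F) (_ : B ⊆ π '' F), m F
  empty := by
    refine le_antisymm ?_ bot_le
    exact (iInf₂_le ∅ MeasurableSet.empty).trans ((iInf_le _ (by simp)).trans (by simp))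
  mono {A B} h :=
    le_iInf₂ fun F hF => le_iInf fun hB => (iInf₂_le F hF).trans (iInf_le _ (h.trans hB))
  iUnion_nat s _ := by
    refine ENNReal.le_of_forall_pos_le_add fun ε hε hfin => ?_
    obtain ⟨δ, hδ, hsum⟩ := ENNReal.exists_pos_sum_of_countable
      (ENNReal.coe_pos.2 hε).ne' ℕ
    have key : ∀ i, ∃ F : Set X, MeasurableSet F ∧ s i ⊆ π '' F ∧
        m F ≤ (⨅ (F : Set X) (_ : MeasurableSet F) (_ : s i ⊆ π '' F), m F) + δ i := by
      intro i
      have hlt : (⨅ (F : Set X) (_ : MeasurableSet F) (_ : s i ⊆ π '' F), m F) <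
          (⨅ (F : Set X) (_ : MeasurableSet F) (_ : s i ⊆ π '' F), m F) + δ i :=
        ENNReal.lt_add_right ((ENNReal.le_tsum i).trans_lt hfin).ne
          (ENNReal.coe_pos.2 (hδ i)).ne'
      obtain ⟨F, hF⟩ := iInf_lt_iff.1 hlt
      obtain ⟨hF₁, hF⟩ := iInf_lt_iff.1 hF
      obtain ⟨hF₂, hF⟩ := iInf_lt_iff.1 hF
      exact ⟨F, hF₁, hF₂, hF.le⟩
    choose F hF₁ hF₂ hF₃ using key
    calc
      _ ≤ m (⋃ i, F i) :=
        (iInf₂_le (⋃ i, F i) (MeasurableSet.iUnion hF₁)).trans (iInf_le _ (by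
          rw [image_iUnion]
          exact iUnion_mono hF₂))
      _ ≤ ∑' i, m (F i) := measure_iUnion_le _
      _ ≤ ∑' i, ((⨅ (F : Set X) (_ : MeasurableSet F) (_ : s i ⊆ π '' F), m F) + δ i) :=
        ENNReal.tsum_le_tsum hF₃
      _ ≤ _ := by
        rw [ENNReal.tsum_add]
        gcongr

theorem le_caratheodory_quotientOuterMeasure {X Y : Type*} [MeasurableSpace X]
    [MeasurableSpace Y] {π : X → Y} (hπ : Measurable π) (m : Measure X) :
    ‹MeasurableSpace Y› ≤ (quotientOuterMeasure π m).caratheodory := by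
  intro B hB
  rw [OuterMeasure.isCaratheodory_iff_le]
  intro T
  refine le_iInf₂ fun F hF => le_iInf fun hT => ?_
  rw [← measure_inter_add_sdiff F (hπ hB)]
  refine add_le_add
    ((iInf₂_le (F ∩ π ⁻¹' B) (hF.inter (hπ hB))).trans (iInf_le _ ?_))
    ((iInf₂_le (F \ π ⁻¹' B) (hF.diff (hπ hB))).trans (iInf_le _ ?_))
  · rintro y ⟨hy, hyB⟩
    obtain ⟨x, hx, rfl⟩ := hT hy
    exact ⟨x, ⟨hx, hyB⟩, rfl⟩
  · rintro y ⟨hy, hyB⟩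
    obtain ⟨x, hx, rfl⟩ := hT hy
    exact ⟨x, ⟨hx, hyB⟩, rfl⟩

/-- The measure induced by `m` on the quotient `Y` of `X` by a countable group of measure
preserving transformations (`π` is the quotient map): the mass of `B` is the least `m`-mass of a
measurable set of representatives of the points of `B`, which is the `m`-mass of the part of a
fundamental domain that lies over `B`, see `quotientMeasure_apply_of_isFundamentalDomain`. -/
def quotientMeasure {X Y : Type*} [MeasurableSpace X] [MeasurableSpace Y] (π : X → Y)
    (hπ : Measurable π) (m : Measure X) : Measure Y :=
  (quotientOuterMeasure π m).toMeasure (le_caratheodory_quotientOuterMeasure hπ m)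

theorem quotientMeasure_apply_of_isFundamentalDomain {G X Y : Type*} [Group G] [Countable G]
    [MulAction G X] [MeasurableSpace X] [MeasurableConstSMul G X] [MeasurableSpace Y]
    {π : X → Y} (hπ : Measurable π) (hsurj : Function.Surjective π)
    (horb : ∀ x x', π x = π x' ↔ ∃ g : G, g • x = x') {m : Measure X} [SMulInvariantMeasure G X m]
    {s : Set X} (hs : IsFundamentalDomain G s m) (hs' : MeasurableSet s)
    {B : Set Y} (hB : MeasurableSet B) :
    quotientMeasure π hπ m B = m (s ∩ π ⁻¹' B) := by
  rw [quotientMeasure, toMeasure_apply _ _ hB]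
  apply le_antisymm
  · have hU : MeasurableSet (⋃ g : G, g • s) :=
      MeasurableSet.iUnion fun g => hs'.const_smul g
    have h0 : m (⋃ g : G, g • s)ᶜ = 0 := by
      have := hs.ae_covers
      rw [ae_iff] at this
      refine measure_mono_null ?_ this
      intro x hx hx'
      obtain ⟨g, hg⟩ := hx'
      exact hx (mem_iUnion.2 ⟨g⁻¹, by simpa [mem_smul_set_iff_inv_smul_mem] using hg⟩)
    refine (iInf₂_le ((s ∩ π ⁻¹' B) ∪ (⋃ g : G, g • s)ᶜ)
      ((hs'.inter (hπ hB)).union hU.compl)).trans ((iInf_le _ ?_).trans ?_)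
    · intro y hy
      obtain ⟨x, rfl⟩ := hsurj y
      by_cases hx : x ∈ ⋃ g : G, g • s
      · obtain ⟨g, z, hz, rfl⟩ := mem_iUnion.1 hx
        have hzx : π z = π (g • z) := (horb _ _).2 ⟨g, rfl⟩
        exact ⟨z, Or.inl ⟨hz, by simpa [hzx] using hy⟩, hzx⟩
      · exact ⟨x, Or.inr hx, rfl⟩
    · exact (measure_union_le _ _).trans (by rw [h0, add_zero])
  · refine le_iInf₂ fun F hF => le_iInf fun hBF => ?_
    rw [hs.measure_eq_tsum F]
    refine (measure_mono ?_).trans (measure_iUnion_le fun g : G => g • F ∩ s)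
    rintro x ⟨hx, hxB⟩
    obtain ⟨z, hz, hzx⟩ := hBF hxB
    obtain ⟨g, rfl⟩ := (horb _ _).1 hzx
    exact mem_iUnion.2 ⟨g, smul_mem_smul_set hz, hx⟩

/-! ### The invariant measure on `𝒰₁⁺` and the moduli space -/

/-- The frame `∂/∂x 1, …, ∂/∂x n, ∂/∂y 1, …, ∂/∂y n`. -/
def stdFrame (n : ℕ) : Fin (n + n) → V n := fun i => Pi.single (finSumFinEquiv.symm i) 1

/-- The (for odd `n` symplectic) form `Im (Ω₁ ∧ Ω₂) (ωⁿ / n!)⁻¹` on the space of primitive forms;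
the ratio of two forms of top degree is the ratio of their values on a frame. -/
def symp (n : ℕ) (Ω₁ Ω₂ : Prim n) : ℝ :=
  (wedge (toForm Ω₁) (toForm Ω₂) (stdFrame n) / volForm n (stdFrame n)).im

/-- The measure on `𝒰₁⁺` induced by the volume form of the symplectic form on primitive forms. -/
def muOne (n : ℕ) [NeZero n] : Measure (UOne n) :=
  coneMeasure (liouvilleMeasure (symp n)) (UOne n)

/-- The linear map of `ℝ²ⁿ` given by an integral symplectic matrix. -/
def spLin {n : ℕ} (g : Matrix.symplecticGroup (Fin n) ℤ) : V n →ₗ[ℝ] V n :=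
  Matrix.toLin' (g.1.map (Int.cast : ℤ → ℝ))

theorem spLin_one {n : ℕ} : spLin (1 : Matrix.symplecticGroup (Fin n) ℤ) = LinearMap.id := by
  simp [spLin]

theorem spLin_mul {n : ℕ} (g h : Matrix.symplecticGroup (Fin n) ℤ) :
    spLin (g * h) = spLin g ∘ₗ spLin h := by
  have : (g.1 * h.1).map (Int.cast : ℤ → ℝ) =
      g.1.map (Int.cast : ℤ → ℝ) * h.1.map (Int.cast : ℤ → ℝ) :=
    Matrix.map_mul (f := Int.castRingHom ℝ)
  rw [spLin, spLin, spLin, ← Matrix.toLin'_mul, ← this]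
  rfl

/-- Two forms in `𝒰₁⁺` are equivalent if they lie in the same orbit of `Sp(2n, ℤ)`, which acts by
pullback. -/
def orbitSetoid (n : ℕ) [NeZero n] : Setoid (UOne n) where
  r Ω Ω' := ∃ g : Matrix.symplecticGroup (Fin n) ℤ,
    (toForm Ω'.1) = (toForm Ω.1).compLinearMap (spLin g)
  iseqv :=
    { refl := fun Ω => ⟨1, by rw [spLin_one, AlternatingMap.compLinearMap_id]⟩
      symm := by
        rintro Ω Ω' ⟨g, h⟩
        refine ⟨g⁻¹, ?_⟩
        rw [h, AlternatingMap.compLinearMap_assoc, ← spLin_mul, mul_inv_cancel, spLin_one,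
          AlternatingMap.compLinearMap_id]
      trans := by
        rintro Ω Ω' Ω'' ⟨g, h⟩ ⟨g', h'⟩
        exact ⟨g * g', by rw [h', h, AlternatingMap.compLinearMap_assoc, spLin_mul]⟩ }

/-- The moduli space `ℳ₁(n) = 𝒰₁⁺(ℝ²ⁿ) / Sp(2n, ℤ)`. -/
def Moduli (n : ℕ) [NeZero n] : Type := Quotient (orbitSetoid n)

instance (n : ℕ) [NeZero n] : TopologicalSpace (Moduli n) :=
  inferInstanceAs (TopologicalSpace (Quotient (orbitSetoid n)))

instance (n : ℕ) [NeZero n] : MeasurableSpace (Moduli n) := borel _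

instance (n : ℕ) [NeZero n] : BorelSpace (Moduli n) := ⟨rfl⟩

/-- The quotient map `𝒰₁⁺ → ℳ₁`. -/
def Moduli.mk {n : ℕ} [NeZero n] (Ω : UOne n) : Moduli n := Quotient.mk (orbitSetoid n) Ω

theorem Moduli.continuous_mk {n : ℕ} [NeZero n] : Continuous (Moduli.mk (n := n)) :=
  continuous_quotient_mk'

/-- The natural volume measure on the moduli space. -/
def Moduli.vol (n : ℕ) [NeZero n] : Measure (Moduli n) :=
  quotientMeasure Moduli.mk Moduli.continuous_mk.measurable (muOne n)

/-! ### The action of `SL(2, ℝ)` -/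

/-- The action of a real `2 × 2` matrix on `ℂ = ℝ²`. -/
def cLin (g : Matrix (Fin 2) (Fin 2) ℝ) : ℂ →ₗ[ℝ] ℂ :=
  Matrix.toLin Complex.basisOneI Complex.basisOneI g

theorem cLin_apply (g : Matrix (Fin 2) (Fin 2) ℝ) (z : ℂ) :
    cLin g z = ⟨g 0 0 * z.re + g 0 1 * z.im, g 1 0 * z.re + g 1 1 * z.im⟩ := by
  apply Complex.ext <;>
    simp [cLin, Matrix.toLin_apply, Matrix.mulVec, dotProduct, Fin.sum_univ_two]

theorem wedge_apply {n p q : ℕ} (α : Form n p) (β : Form n q) (v : Fin (p + q) → V n) :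
    ((p.factorial * q.factorial : ℕ) : ℂ) * wedge α β v =
      ∑ σ : Equiv.Perm (Fin p ⊕ Fin q), ((Equiv.Perm.sign σ : ℤ) : ℂ) *
        (α (fun i => v (finSumFinEquiv (σ (Sum.inl i)))) *
          β (fun i => v (finSumFinEquiv (σ (Sum.inr i))))) := by
  have h := MultilinearMap.domCoprod_alternization_eq α β
  have h2 := congrArg (fun f => LinearMap.mul' ℝ ℂ (f (fun i => v (finSumFinEquiv i)))) h
  simp only [MultilinearMap.alternatization_apply, map_sum, AlternatingMap.smul_apply,
    map_nsmul, Fintype.card_fin] at h2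
  simp only [wedge, AlternatingMap.domDomCongr_apply, LinearMap.compAlternatingMap_apply]
  rw [← nsmul_eq_mul]
  refine Eq.trans h2.symm (Finset.sum_congr rfl fun σ _ => ?_)
  rcases Int.units_eq_one_or (Equiv.Perm.sign σ) with hσ | hσ <;> simp [hσ]


theorem wedge_comp_omega {n p : ℕ} (A : ℂ →ₗ[ℝ] ℂ) (α : Form n p) :
    wedge (A.compAlternatingMap α) (omega n) = A.compAlternatingMap (wedge α (omega n)) := by
  ext v
  have hc : ((p.factorial * (2 : ℕ).factorial : ℕ) : ℂ) ≠ 0 := by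
    exact_mod_cast (Nat.mul_pos (Nat.factorial_pos _) (Nat.factorial_pos _)).ne'
  apply mul_left_cancel₀ hc
  have hA : ∀ (r : ℝ) (z : ℂ), A ((r : ℂ) * z) = (r : ℂ) * A z := fun r z => by
    rw [← Complex.real_smul, map_smul, Complex.real_smul]
  rw [wedge_apply, LinearMap.compAlternatingMap_apply, ← Complex.ofReal_natCast, ← hA,
    Complex.ofReal_natCast, wedge_apply, map_sum]
  refine Finset.sum_congr rfl fun σ _ => ?_
  rw [← Complex.ofReal_intCast, hA]
  congr 1
  change _ * ((omegaFun _ _ : ℝ) : ℂ) = A (_ * ((omegaFun _ _ : ℝ) : ℂ))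
  rw [mul_comm, mul_comm (α _), hA]
  rfl

theorem sign_sumComm (n : ℕ) :
    Equiv.Perm.sign (Equiv.sumComm (Fin n) (Fin n) : Equiv.Perm (Fin n ⊕ Fin n)) = (-1) ^ n := by
  have h := Equiv.Perm.sign_prodCongrRight (fun _ : Fin n => Equiv.swap (0 : Fin 2) 1)
  rw [Finset.prod_congr rfl (fun _ _ => Equiv.Perm.sign_swap (by decide : (0 : Fin 2) ≠ 1)),
    Finset.prod_const, Finset.card_univ, Fintype.card_fin] at h
  rw [← h]
  refine Equiv.Perm.sign_eq_sign_of_equiv _ _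
    ⟨Sum.elim (fun i => (i, 0)) (fun i => (i, 1)),
      fun p => if p.2 = 0 then Sum.inl p.1 else Sum.inr p.1, ?_, ?_⟩ ?_
  · rintro (i | i) <;> simp
  · rintro ⟨i, j⟩
    fin_cases j <;> simp
  · rintro (i | i) <;> simp [Equiv.prodCongrRight]

theorem wedge_conj {n : ℕ} (hn : Odd n) (α : Form n n) (v : Fin (n + n) → V n) :
    (2 * (n.factorial * n.factorial : ℕ) : ℂ) * wedge α (conjForm α) v =
      ∑ σ : Equiv.Perm (Fin n ⊕ Fin n), ((Equiv.Perm.sign σ : ℤ) : ℂ) *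
        ((2 * (α (fun i => v (finSumFinEquiv (σ (Sum.inl i)))) *
          (starRingEnd ℂ) (α (fun i => v (finSumFinEquiv (σ (Sum.inr i)))))).im : ℝ) *
            Complex.I) := by
  have h1 := wedge_apply α (conjForm α) v
  have h2 := h1
  rw [← Equiv.sum_comp (Equiv.mulRight
    (Equiv.sumComm (Fin n) (Fin n) : Equiv.Perm (Fin n ⊕ Fin n)))] at h2
  rw [mul_assoc, two_mul]
  nth_rewrite 1 [h1]
  rw [h2, ← Finset.sum_add_distrib]
  refine Finset.sum_congr rfl fun σ _ => ?_
  simp only [Equiv.coe_mulRight, Equiv.Perm.sign_mul, sign_sumComm, hn.neg_one_pow,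
    Equiv.Perm.mul_apply, Equiv.sumComm_apply, Sum.swap_inl, Sum.swap_inr, conjForm,
    LinearMap.compAlternatingMap_apply, AlgEquiv.toLinearMap_apply, Complex.conjAe_coe]
  generalize α (fun i => v (finSumFinEquiv (σ (Sum.inl i)))) = z
  generalize α (fun i => v (finSumFinEquiv (σ (Sum.inr i)))) = w
  push_cast
  simp only [mul_neg, mul_one, neg_mul]
  rw [← sub_eq_add_neg, ← mul_sub]
  congr 1
  apply Complex.ext <;> simp <;> ring

/-- The action of a real matrix on forms through its action on the coefficients `ℂ = ℝ²`. -/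
def actPrim {n : ℕ} (g : Matrix (Fin 2) (Fin 2) ℝ) (Ω : Prim n) : Prim n :=
  ⟨(cLin g).toContinuousLinearMap.compContinuousAlternatingMap Ω.1, by
    have := wedge_comp_omega (cLin g) (toForm Ω)
    rw [show wedge (toForm Ω) (omega n) = 0 from Ω.2] at this
    refine Eq.trans this ?_
    ext v
    simp⟩

theorem toForm_actPrim {n : ℕ} (g : Matrix (Fin 2) (Fin 2) ℝ) (Ω : Prim n) :
    toForm (actPrim g Ω) = (cLin g).compAlternatingMap (toForm Ω) := rfl

theorem wedge_conj_act {n : ℕ} (hn : Odd n) (g : Matrix (Fin 2) (Fin 2) ℝ) (hg : g.det = 1)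
    (α : Form n n) :
    wedge ((cLin g).compAlternatingMap α) (conjForm ((cLin g).compAlternatingMap α)) =
      wedge α (conjForm α) := by
  ext v
  have hc : (2 * (n.factorial * n.factorial : ℕ) : ℂ) ≠ 0 := by
    exact_mod_cast (Nat.mul_pos two_pos
      (Nat.mul_pos (Nat.factorial_pos n) (Nat.factorial_pos n))).ne'
  apply mul_left_cancel₀ hc
  rw [wedge_conj hn, wedge_conj hn]
  refine Finset.sum_congr rfl fun σ _ => ?_
  congr 4
  simp only [LinearMap.compAlternatingMap_apply, cLin_apply]
  generalize α (fun i => v (finSumFinEquiv (σ (Sum.inl i)))) = z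
  generalize α (fun i => v (finSumFinEquiv (σ (Sum.inr i)))) = w
  rw [Matrix.det_fin_two] at hg
  simp
  linear_combination (z.im * w.re - z.re * w.im) * hg

theorem cLin_injective {g : Matrix (Fin 2) (Fin 2) ℝ} (hg : g.det = 1) :
    Function.Injective (cLin g) := by
  rw [injective_iff_map_eq_zero]
  intro z hz
  rw [cLin_apply] at hz
  rw [Matrix.det_fin_two] at hg
  have h1 := congrArg Complex.re hz
  have h2 := congrArg Complex.im hz
  simp only [Complex.zero_re, Complex.zero_im] at h1 h2
  apply Complex.ext
  · simp only [Complex.zero_re]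
    linear_combination g 1 1 * h1 - g 0 1 * h2 - z.re * hg
  · simp only [Complex.zero_im]
    linear_combination g 0 0 * h2 - g 1 0 * h1 - z.im * hg

theorem actPrim_mem_U {n : ℕ} {g : Matrix (Fin 2) (Fin 2) ℝ} (hg : g.det = 1) {Ω : Prim n}
    (h : Ω ∈ U n) : actPrim g Ω ∈ U n := by
  intro L hL h0
  refine h L hL ?_
  ext v
  have := congrArg (fun f => f v) h0
  simp only [toForm_actPrim, AlternatingMap.compLinearMap_apply,
    LinearMap.compAlternatingMap_apply, AlternatingMap.zero_apply] at this ⊢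
  exact cLin_injective hg (this.trans (map_zero _).symm)

theorem apply_stdLoop {n : ℕ} [NeZero n] (α : Form n n) (θ : ℝ) :
    α (stdLoop θ) = Real.cos θ * α ex + Real.sin θ * α (Function.update ex 0 (ey 0)) := by
  rw [stdLoop, AlternatingMap.map_update_add, AlternatingMap.map_update_smul,
    AlternatingMap.map_update_smul, Function.update_eq_self, Complex.real_smul, Complex.real_smul]

theorem apply_ne_zero_of_mem_U {n : ℕ} {Ω : Prim n} (h : Ω ∈ U n) (v : Fin n → V n)
    (hv : LinearIndependent ℝ v) (hω : ∀ i j, omegaFun (v i) (v j) = 0) : toForm Ω v ≠ 0 := by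
  intro h0
  refine h (Submodule.span ℝ (range v)) ⟨by simpa using finrank_span_eq_card hv, ?_⟩ ?_
  · let B : LinearMap.BilinForm ℝ (V n) := LinearMap.mk₂ ℝ omegaFun
      (fun a b c => by
        simp only [omegaFun, ← Finset.sum_add_distrib]
        refine Finset.sum_congr rfl fun j _ => ?_
        simp
        ring)
      (fun r a b => by
        simp only [omegaFun, smul_eq_mul, Finset.mul_sum]
        refine Finset.sum_congr rfl fun j _ => ?_
        simp
        ring)
      (fun a b c => by
        simp only [omegaFun, ← Finset.sum_add_distrib]
        refine Finset.sum_congr rfl fun j _ => ?_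
        simp
        ring)
      (fun r a b => by
        simp only [omegaFun, smul_eq_mul, Finset.mul_sum]
        refine Finset.sum_congr rfl fun j _ => ?_
        simp
        ring)
    intro a ha b hb
    change B a b = 0
    induction ha using Submodule.span_induction with
    | mem a ha =>
      obtain ⟨i, rfl⟩ := ha
      induction hb using Submodule.span_induction with
      | mem b hb =>
        obtain ⟨j, rfl⟩ := hb
        exact hω i j
      | zero => simp
      | add x y _ _ hx hy => rw [map_add, hx, hy, add_zero]
      | smul r x _ hx => rw [map_smul, hx, smul_zero]
    | zero => simp
    | add x y _ _ hx hy => rw [map_add, LinearMap.add_apply, hx, hy, add_zero]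
    | smul r x _ hx => rw [map_smul, LinearMap.smul_apply, hx, smul_zero]
  · refine Module.Basis.ext_alternating (Module.Basis.span hv) fun w hw => ?_
    let σ : Equiv.Perm (Fin n) := Equiv.ofBijective w (Finite.injective_iff_bijective.1 hw)
    have h1 : (toForm Ω) (fun i => v (σ i)) = Equiv.Perm.sign σ • (toForm Ω) v :=
      (toForm Ω).map_perm v σ
    rw [h0, smul_zero] at h1
    rw [AlternatingMap.zero_apply, ← h1, AlternatingMap.compLinearMap_apply]
    congr 1
    ext i : 1
    simp [Module.Basis.span_apply, σ]

theorem stdLoop_ne_zero {n : ℕ} [NeZero n] {Ω : Prim n} (h : Ω ∈ U n) (θ : ℝ) :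
    toForm Ω (stdLoop θ) ≠ 0 := by
  have hl : ∀ i j : Fin n, (stdLoop θ i : V n) (Sum.inl j) =
      if i = j then (if i = 0 then Real.cos θ else 1) else 0 := by
    intro i j
    by_cases hi : i = 0
    · subst hi
      by_cases hj : (0 : Fin n) = j
      · subst hj
        simp [stdLoop, ex, ey]
      · simp [stdLoop, ex, ey, hj, Ne.symm hj]
    · by_cases hj : i = j
      · subst hj
        simp [stdLoop, ex, hi]
      · simp [stdLoop, ex, hi, hj, Ne.symm hj]
  have hr : ∀ i j : Fin n, (stdLoop θ i : V n) (Sum.inr j) =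
      if i = j then (if i = 0 then Real.sin θ else 0) else 0 := by
    intro i j
    by_cases hi : i = 0
    · subst hi
      by_cases hj : (0 : Fin n) = j
      · subst hj
        simp [stdLoop, ex, ey]
      · simp [stdLoop, ex, ey, hj, Ne.symm hj]
    · simp [stdLoop, ex, hi]
  refine apply_ne_zero_of_mem_U h _ ?_ ?_
  · rw [Fintype.linearIndependent_iff]
    intro a ha i
    have h1 := congrFun ha (Sum.inl i)
    have h2 := congrFun ha (Sum.inr i)
    simp only [Finset.sum_apply, Pi.smul_apply, hl, hr, smul_eq_mul, mul_ite, mul_one, mul_zero,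
      Finset.sum_ite_eq', Finset.mem_univ, if_true, Pi.zero_apply] at h1 h2
    by_cases hi : i = 0
    · rw [if_pos hi] at h1 h2
      linear_combination Real.cos θ * h1 + Real.sin θ * h2 - a i * Real.sin_sq_add_cos_sq θ
    · rwa [if_neg hi] at h1
  · intro i j
    refine Finset.sum_eq_zero fun k _ => ?_
    simp only [hl, hr]
    by_cases hik : i = k
    · by_cases hjk : j = k
      · subst hik hjk
        ring
      · simp [hjk]
    · simp [hik]


/-- The signed area of the parallelogram spanned by the values of a form at the two frames
`(∂/∂x 1, ∂/∂x 2, …)` and `(∂/∂y 1, ∂/∂x 2, …)`. -/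
def loopArea {n : ℕ} [NeZero n] (α : Form n n) : ℝ :=
  ((starRingEnd ℂ) (α ex) * α (Function.update ex 0 (ey 0))).im

theorem exists_eq_real_mul_exp {z : ℂ} (hz : z ≠ 0) {t : ℝ}
    (h : ((Complex.arg z : ℝ) : AddCircle Real.pi) = ((t : ℝ) : AddCircle Real.pi)) :
    ∃ r : ℝ, r ≠ 0 ∧ z = r * Complex.exp (t * Complex.I) := by
  rw [← sub_eq_zero, ← AddCircle.coe_sub, AddCircle.coe_eq_zero_iff] at h
  obtain ⟨k, hk⟩ := h
  have hs : Real.sin (k * Real.pi) = 0 := Real.sin_int_mul_pi k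
  have harg : Complex.arg z = t + k * Real.pi := by
    rw [zsmul_eq_mul] at hk
    linarith
  refine ⟨‖z‖ * Real.cos (k * Real.pi), mul_ne_zero (norm_ne_zero_iff.2 hz) fun h0 => ?_, ?_⟩
  · have := Real.sin_sq_add_cos_sq (k * Real.pi)
    rw [hs, h0] at this
    norm_num at this
  · have h1 := Complex.norm_mul_exp_arg_mul_I z
    have h2 : Complex.exp (((k * Real.pi : ℝ) : ℂ) * Complex.I) =
        ((Real.cos (k * Real.pi) : ℝ) : ℂ) := by
      rw [Complex.exp_mul_I, ← Complex.ofReal_cos, ← Complex.ofReal_sin, hs]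
      simp
    rw [harg, Complex.ofReal_add, add_mul, Complex.exp_add, h2] at h1
    nth_rewrite 1 [← h1]
    rw [Complex.ofReal_mul]
    ring

theorem loopArea_pos_of_isPositive {n : ℕ} [NeZero n] {Ω : Prim n} (h : Ω ∈ U n)
    (hp : IsPositive (toForm Ω)) : 0 < loopArea (toForm Ω) := by
  obtain ⟨φ, hφ, hφ1, hφ2⟩ := hp
  set α := toForm Ω with hα
  set c : ℝ → ℂ := fun θ => α (stdLoop θ) with hc
  have hc' : ∀ θ, c θ = Real.cos θ * α ex + Real.sin θ * α (Function.update ex 0 (ey 0)) :=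
    fun θ => apply_stdLoop α θ
  have hcc : Continuous c := by
    have : c = fun θ : ℝ => ((Real.cos θ : ℝ) : ℂ) * α ex +
      ((Real.sin θ : ℝ) : ℂ) * α (Function.update ex 0 (ey 0)) := funext hc'
    rw [this]
    fun_prop
  set r : ℝ → ℝ := fun θ => (c θ * Complex.exp (-(φ θ * Complex.I))).re with hr
  have hpi := Real.pi_pos
  have hcr : ∀ θ ∈ Icc 0 Real.pi, r θ ≠ 0 ∧ c θ = r θ * Complex.exp (φ θ * Complex.I) := by
    intro θ hθ
    obtain ⟨s, hs, hs'⟩ := exists_eq_real_mul_exp (stdLoop_ne_zero h θ) (hφ1 θ hθ)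
    have : r θ = s := by
      simp only [hr, hc]
      rw [hs', mul_assoc, ← Complex.exp_add]
      simp
    rw [this]
    exact ⟨hs, hs'⟩
  have hrc : ContinuousOn r (Icc 0 Real.pi) := by
    have : ContinuousOn (fun θ => ((φ θ : ℝ) : ℂ)) (Icc 0 Real.pi) :=
      Complex.continuous_ofReal.comp_continuousOn hφ
    apply Complex.continuous_re.comp_continuousOn
    apply hcc.continuousOn.mul
    apply Complex.continuous_exp.comp_continuousOn
    fun_prop
  have h0 : (0 : ℝ) ∈ Icc 0 Real.pi := ⟨le_rfl, hpi.le⟩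
  have hpi' : Real.pi ∈ Icc 0 Real.pi := ⟨hpi.le, le_rfl⟩
  have hrr : ∀ θ ∈ Icc 0 Real.pi, 0 < r 0 * r θ := by
    intro θ hθ
    by_contra hneg
    have hcon : IsPreconnected ((fun t => r 0 * r t) '' Icc 0 Real.pi) :=
      isPreconnected_Icc.image _ (continuousOn_const.mul hrc)
    have := hcon.Icc_subset (mem_image_of_mem _ hθ) (mem_image_of_mem _ h0)
      ⟨not_lt.1 hneg, mul_self_nonneg _⟩
    obtain ⟨t, ht, ht'⟩ := this
    exact mul_ne_zero (hcr 0 h0).1 (hcr t ht).1 ht'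
  obtain ⟨θ, hθ, hθ'⟩ := intermediate_value_Icc hpi.le hφ
    (show φ 0 + min ((φ Real.pi - φ 0) / 2) (Real.pi / 2) ∈ Icc (φ 0) (φ Real.pi) from
      ⟨by
        have : 0 ≤ min ((φ Real.pi - φ 0) / 2) (Real.pi / 2) := le_min (by linarith) (by linarith)
        linarith,
       by
        have := min_le_left ((φ Real.pi - φ 0) / 2) (Real.pi / 2)
        linarith⟩)
  have hs : 0 < Real.sin (φ θ - φ 0) := by
    rw [hθ']
    have h1 : 0 < min ((φ Real.pi - φ 0) / 2) (Real.pi / 2) := lt_min (by linarith) (by linarith)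
    have h2 := min_le_right ((φ Real.pi - φ 0) / 2) (Real.pi / 2)
    apply Real.sin_pos_of_pos_of_lt_pi <;> linarith
  have key : r 0 * r θ * Real.sin (φ θ - φ 0) = Real.sin θ * loopArea α := by
    have e1 : ((starRingEnd ℂ) (c 0) * c θ).im = Real.sin θ * loopArea α := by
      rw [hc' 0, hc' θ, loopArea]
      generalize α ex = z
      generalize α (Function.update ex 0 (ey 0)) = w
      simp [-Complex.ofReal_cos, -Complex.ofReal_sin]
      ring
    rw [← e1, (hcr 0 h0).2, (hcr θ hθ).2, Complex.exp_mul_I, Complex.exp_mul_I, Real.sin_sub,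
      ← Complex.ofReal_cos, ← Complex.ofReal_cos, ← Complex.ofReal_sin, ← Complex.ofReal_sin]
    simp [-Complex.ofReal_cos, -Complex.ofReal_sin]
    ring
  have hsin : 0 ≤ Real.sin θ := Real.sin_nonneg_of_nonneg_of_le_pi hθ.1 hθ.2
  have hlt : 0 < Real.sin θ * loopArea α := key ▸ mul_pos (hrr θ hθ) hs
  by_contra hneg
  exact absurd hlt (not_lt.2 (mul_nonpos_of_nonneg_of_nonpos hsin (not_lt.1 hneg)))

theorem isPositive_of_loopArea_pos {n : ℕ} [NeZero n] {α : Form n n} (h : 0 < loopArea α) :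
    IsPositive α := by
  set z := α ex with hz
  set w := α (Function.update ex 0 (ey 0)) with hw
  have hz0 : z ≠ 0 := by
    intro h0
    rw [loopArea, ← hz, h0] at h
    simp at h
  have hpi := Real.pi_pos
  have him : 0 < (w / z).im := by
    have : w / z = ((starRingEnd ℂ) z * w) / ((Complex.normSq z : ℝ) : ℂ) := by
      rw [Complex.normSq_eq_conj_mul_self]
      field_simp [(map_ne_zero (starRingEnd ℂ)).2 hz0]
    rw [this, Complex.div_ofReal_im]
    exact div_pos h (Complex.normSq_pos.2 hz0)
  set u : ℝ → ℂ := fun θ => Real.cos θ + Real.sin θ * (w / z) with hu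
  have huc : Continuous u := by fun_prop
  have huim : ∀ θ, (u θ).im = Real.sin θ * (w / z).im := fun θ => by
    simp [hu, -Complex.ofReal_cos, -Complex.ofReal_sin]
  have hu0 : ∀ θ, u θ ≠ 0 := by
    intro θ h0
    have h1 := huim θ
    rw [h0, Complex.zero_im] at h1
    have hs : Real.sin θ = 0 := by
      rcases mul_eq_zero.1 h1.symm with h2 | h2
      · exact h2
      · exact absurd h2 him.ne'
    have h2 : (u θ).re = 0 := by rw [h0, Complex.zero_re]
    simp only [hu, hs] at h2
    have h3 : Real.cos θ = 0 := by simpa [-Complex.ofReal_cos, -Complex.ofReal_sin] using h2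
    have := Real.sin_sq_add_cos_sq θ
    rw [hs, h3] at this
    norm_num at this
  refine ⟨fun θ => Complex.arg z + Complex.arg (u θ), ?_, ?_, ?_⟩
  · refine continuousOn_const.add fun θ hθ => ?_
    have hmaps : MapsTo u (Icc 0 Real.pi) {z : ℂ | 0 ≤ z.im} := fun t ht => by
      change 0 ≤ (u t).im
      rw [huim]
      exact mul_nonneg (Real.sin_nonneg_of_nonneg_of_le_pi ht.1 ht.2) him.le
    have harg : ContinuousWithinAt Complex.arg {z : ℂ | 0 ≤ z.im} (u θ) := by
      by_cases hsl : u θ ∈ Complex.slitPlane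
      · exact (Complex.continuousAt_arg hsl).continuousWithinAt
      · rw [Complex.mem_slitPlane_iff, not_or, not_not, not_lt] at hsl
        refine Complex.continuousWithinAt_arg_of_re_neg_of_im_zero
          (lt_of_le_of_ne hsl.1 fun h0 => hu0 θ (Complex.ext h0 hsl.2)) hsl.2
    exact harg.comp huc.continuousWithinAt hmaps
  · intro θ _
    have e : α (stdLoop θ) = z * u θ := by
      rw [apply_stdLoop, ← hz, ← hw]
      simp only [hu]
      field_simp
    have h2 := Complex.arg_mul_coe_angle hz0 (hu0 θ)
    rw [← e, ← Real.Angle.coe_add, Real.Angle.angle_eq_iff_two_pi_dvd_sub] at h2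
    obtain ⟨k, hk⟩ := h2
    rw [← sub_eq_zero, ← AddCircle.coe_sub, AddCircle.coe_eq_zero_iff]
    refine ⟨2 * k, ?_⟩
    rw [hk]
    simp
    ring
  · simp [hu, hpi]

theorem loopArea_act {n : ℕ} [NeZero n] (g : Matrix (Fin 2) (Fin 2) ℝ) (α : Form n n) :
    loopArea ((cLin g).compAlternatingMap α) = g.det * loopArea α := by
  simp only [loopArea, LinearMap.compAlternatingMap_apply, cLin_apply, Matrix.det_fin_two]
  generalize α ex = z
  generalize α (Function.update ex 0 (ey 0)) = w
  simp
  ring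

theorem actPrim_mem_UOne {n : ℕ} [NeZero n] (hn : Odd n) {g : Matrix (Fin 2) (Fin 2) ℝ}
    (hg : g.det = 1) {Ω : Prim n} (h : Ω ∈ UOne n) : actPrim g Ω ∈ UOne n := by
  obtain ⟨⟨h1, h2⟩, h3⟩ := h
  refine ⟨⟨actPrim_mem_U hg h1, isPositive_of_loopArea_pos ?_⟩, ?_⟩
  · rw [toForm_actPrim, loopArea_act, hg, one_mul]
    exact loopArea_pos_of_isPositive h1 h2
  · rw [toForm_actPrim, wedge_conj_act hn g hg]
    exact h3

/-- The action of `SL(2, ℝ)` on `𝒰₁⁺`, for odd `n`. -/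
def UOne.act {n : ℕ} [NeZero n] (hn : Odd n) (g : Matrix.SpecialLinearGroup (Fin 2) ℝ)
    (Ω : UOne n) : UOne n :=
  ⟨actPrim g.1 Ω.1, actPrim_mem_UOne hn g.2 Ω.2⟩

/-- The action of `SL(2, ℝ)` on the moduli space `ℳ₁(n)`, for odd `n`. -/
def Moduli.act {n : ℕ} [NeZero n] (hn : Odd n) (g : Matrix.SpecialLinearGroup (Fin 2) ℝ) :
    Moduli n → Moduli n :=
  Quotient.map (UOne.act hn g) (by
    rintro Ω Ω' ⟨γ, h⟩
    refine ⟨γ, ?_⟩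
    simp only [UOne.act, toForm_actPrim, h]
    rfl)

/-- The element `diag(e ^ t, e ^ (-t))` of `SL(2, ℝ)`. -/
def diagSL (t : ℝ) : Matrix.SpecialLinearGroup (Fin 2) ℝ :=
  ⟨!![Real.exp t, 0; 0, Real.exp (-t)], by simp [Matrix.det_fin_two, ← Real.exp_add]⟩

end LagForms

end

open MeasureTheory Set
open scoped Pointwise

noncomputable section

namespace LagForms

/-! The infinite mass comes from a function on the moduli space that the diagonal group translates.
Real primitive 3-forms on `ℝ⁶` carry an `Sp(6, ℝ)`-invariant quartic polynomial q: contract two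
copies of α twice with the symplectic bivector to get a quadratic form κ on `ℝ⁶`, then contract κ
with itself. For Ω in `𝒰` one has q(Re Ω) ≠ 0. Indeed, along a pencil of Lagrangians spanned by p e₀
+ q f₀, e₁, e₂ the value of Ω is linear in (p, q); if Re Ω vanished on the whole pencil, Im Ω would
still have a zero there, contradicting Ω ∈ `𝒰`. This non-vanishing supplies the pivots for bringing
Re Ω, in some symplectic frame with dual coordinates pᵢ, qᵢ, to the form a₀ q₀p₁p₂ + a₁ p₀q₁p₂ + a₂
p₀p₁q₂ + b q₀q₁q₂ with all coefficients non-zero, where the quartic equals -96 a₀a₁a₂b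
(`IsNonvanishing.quartic_ne_zero`).

Since diag(eᵗ, e⁻ᵗ) multiplies Re Ω by eᵗ, the function log |q(Re Ω)| / 4 descends to the moduli
space and is translated by t. Its unit level strata then all have the same mass for an invariant
measure, so a non-zero invariant measure is infinite (`measure_univ_eq_top_of_translates`).

It remains to see that `Vol` is invariant and not zero. `SL(2, ℝ)` acts linearly on P and commutes
with scaling and with pullback; its determinant on P is a multiplicative character of 2 × 2
matrices, hence 1 (`det_actLin`). For positivity, σ is non-degenerate, so open sets of P have
positive mass, and the integral symplectic group preserves this mass. Near a multiple of i dz₁ ∧ dz₂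
∧ dz₃ the form κ is uniformly negative definite. An integral matrix that returns a point to this
neighbourhood therefore has bounded entries, so only finitely many return, and every measurable set
of representatives has mass bounded below (`Moduli.vol_univ_ne_zero`). -/

/-! ### Wedge products as sums over shuffles -/

/-- A coset of the block permutations is determined by the image of the left block. Hence the ρ s
lie in distinct cosets, and the count `hcard` forces them to exhaust all cosets; F is constant on
each. -/
theorem sum_perm_eq_sum_reps {p q : ℕ} {ι : Type*} [Fintype ι]
    (ρ : ι → Equiv.Perm (Fin p ⊕ Fin q))
    (hcard : Fintype.card ι * (p.factorial * q.factorial) = (p + q).factorial)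
    (hinj : Function.Injective fun s => Finset.univ.image fun i => ρ s (Sum.inl i))
    (F : Equiv.Perm (Fin p ⊕ Fin q) → ℂ)
    (hF : ∀ σ τ₁ τ₂, F (σ * Equiv.Perm.sumCongr τ₁ τ₂) = F σ) :
    ∑ σ, F σ = ((p.factorial * q.factorial : ℕ) : ℂ) * ∑ s, F (ρ s) := by
  let e : ι × (Equiv.Perm (Fin p) × Equiv.Perm (Fin q)) → Equiv.Perm (Fin p ⊕ Fin q) :=
    fun x => ρ x.1 * Equiv.Perm.sumCongr x.2.1 x.2.2
  have he : Function.Bijective e := by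
    rw [Fintype.bijective_iff_injective_and_card]
    refine ⟨?_, ?_⟩
    · rintro ⟨s, τ₁, τ₂⟩ ⟨s', τ₁', τ₂'⟩ h
      have key : ∀ (s : ι) (τ₁ : Equiv.Perm (Fin p)) (τ₂ : Equiv.Perm (Fin q)),
          (Finset.univ.image fun i => ρ s (Sum.inl i)) =
            Finset.univ.image fun i => e (s, τ₁, τ₂) (Sum.inl i) := by
        intro s τ₁ τ₂
        ext x
        simp only [e, Finset.mem_image, Finset.mem_univ, true_and, Equiv.Perm.mul_apply,
          Equiv.Perm.sumCongr_apply, Sum.map_inl]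
        constructor
        · rintro ⟨i, hi⟩
          exact ⟨τ₁⁻¹ i, by simpa using hi⟩
        · rintro ⟨i, hi⟩
          exact ⟨τ₁ i, hi⟩
      have hs : s = s' := hinj (by
        change (Finset.univ.image fun i => ρ s (Sum.inl i)) =
          Finset.univ.image fun i => ρ s' (Sum.inl i)
        rw [key s τ₁ τ₂, key s' τ₁' τ₂', h])
      subst hs
      have h' : Equiv.Perm.sumCongr τ₁ τ₂ = Equiv.Perm.sumCongr τ₁' τ₂' := mul_left_cancel h
      have := Equiv.Perm.sumCongrHom_injective (a₁ := (τ₁, τ₂)) (a₂ := (τ₁', τ₂')) h'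
      rw [this]
    · rw [Fintype.card_prod, Fintype.card_prod, Fintype.card_perm, Fintype.card_perm,
        Fintype.card_perm, Fintype.card_sum, Fintype.card_fin, Fintype.card_fin, hcard]
  rw [← he.sum_comp F, Fintype.sum_prod_type, Finset.mul_sum]
  refine Finset.sum_congr rfl fun s _ => ?_
  simp only [e, hF, Finset.sum_const, Finset.card_univ, Fintype.card_prod, Fintype.card_perm,
    Fintype.card_fin, nsmul_eq_mul]

/-- Any system of representatives can replace the shuffles, because the sign of a block permutation
cancels against the signs from α and β. This allows representatives built from transpositions, whose
signs are immediate. -/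
theorem wedge_apply_reps {n p q : ℕ} {ι : Type*} [Fintype ι]
    (ρ : ι → Equiv.Perm (Fin p ⊕ Fin q))
    (hcard : Fintype.card ι * (p.factorial * q.factorial) = (p + q).factorial)
    (hinj : Function.Injective fun s => Finset.univ.image fun i => ρ s (Sum.inl i))
    (α : Form n p) (β : Form n q) (v : Fin (p + q) → V n) :
    wedge α β v = ∑ s, ((Equiv.Perm.sign (ρ s) : ℤ) : ℂ) *
      (α (fun i => v (finSumFinEquiv (ρ s (Sum.inl i)))) *
        β (fun i => v (finSumFinEquiv (ρ s (Sum.inr i))))) := by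
  have hc : ((p.factorial * q.factorial : ℕ) : ℂ) ≠ 0 := by
    exact_mod_cast (Nat.mul_pos (Nat.factorial_pos _) (Nat.factorial_pos _)).ne'
  apply mul_left_cancel₀ hc
  rw [wedge_apply]
  refine sum_perm_eq_sum_reps ρ hcard hinj (fun σ => ((Equiv.Perm.sign σ : ℤ) : ℂ) *
      (α (fun i => v (finSumFinEquiv (σ (Sum.inl i)))) *
        β (fun i => v (finSumFinEquiv (σ (Sum.inr i)))))) fun σ τ₁ τ₂ => ?_
  have h1 := α.map_perm (fun i => v (finSumFinEquiv (σ (Sum.inl i)))) τ₁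
  have h2 := β.map_perm (fun i => v (finSumFinEquiv (σ (Sum.inr i)))) τ₂
  simp only [Function.comp_def] at h1 h2
  simp only [Equiv.Perm.mul_apply, Equiv.Perm.sumCongr_apply, Sum.map_inl, Sum.map_inr, h1, h2,
    Equiv.Perm.sign_mul, Equiv.Perm.sign_sumCongr]
  rcases Int.units_eq_one_or (Equiv.Perm.sign τ₁) with h3 | h3 <;>
  rcases Int.units_eq_one_or (Equiv.Perm.sign τ₂) with h4 | h4 <;>
  simp [h3, h4]

/-- Representatives of the partitions of six elements into two blocks of three. -/
def rep33 (s : Fin 2 × Option (Fin 3 × Fin 3)) : Equiv.Perm (Fin 3 ⊕ Fin 3) :=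
  (match s.2 with
    | none => 1
    | some (i, j) => Equiv.swap (Sum.inl i) (Sum.inr j)) *
  (if s.1 = 0 then 1 else Equiv.sumComm (Fin 3) (Fin 3))

theorem rep33_injective :
    Function.Injective fun s => Finset.univ.image fun i => rep33 s (Sum.inl i) := by
  unfold rep33
  decide +kernel

/-- Representatives of the choices of two among five elements. -/
def rep32 : Option (Fin 3 × Fin 2) ⊕ Fin 3 → Equiv.Perm (Fin 3 ⊕ Fin 2)
  | Sum.inl none => 1
  | Sum.inl (some (i, j)) => Equiv.swap (Sum.inl i) (Sum.inr j)
  | Sum.inr i => Equiv.swap (Sum.inl (i + 1)) (Sum.inr 0) * Equiv.swap (Sum.inl (i + 2)) (Sum.inr 1)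

theorem rep32_injective :
    Function.Injective fun s => Finset.univ.image fun i => rep32 s (Sum.inl i) := by
  unfold rep32
  decide +kernel

/-! ### Top degree wedge products in dimension six -/

/-- The twenty splittings form two groups of ten: the identity with nine transpositions, and the
same composed with the exchange of the two blocks, which is odd because three is odd. -/
theorem wedge_stdFrame (α β : Form 3 3) :
    wedge α β (stdFrame 3) =
      (α ex * β ey - ∑ i, ∑ j, α (Function.update ex i (ey j)) * β (Function.update ey j (ex i))) -
      (α ey * β ex -
        ∑ i, ∑ j, α (Function.update ey j (ex i)) * β (Function.update ex i (ey j))) := by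
  have h1 : ∀ i j : Fin 3, (fun k => (Pi.single (Equiv.swap (Sum.inl i) (Sum.inr j) (Sum.inl k)) 1 :
      V 3)) = Function.update ex i (ey j) := by
    intro i j
    funext k
    by_cases hk : k = i
    · subst hk
      simp [ey]
    · rw [Equiv.swap_apply_of_ne_of_ne (by simpa using hk) (by simp)]
      simp [ex, hk]
  have h2 : ∀ i j : Fin 3, (fun k => (Pi.single (Equiv.swap (Sum.inl i) (Sum.inr j) (Sum.inr k)) 1 :
      V 3)) = Function.update ey j (ex i) := by
    intro i j
    funext k
    by_cases hk : k = j
    · subst hk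
      simp [ex]
    · rw [Equiv.swap_apply_of_ne_of_ne (by simp) (by simpa using hk)]
      simp [ey, hk]
  have h3 : (fun k => (Pi.single (Sum.inl k) 1 : V 3)) = ex := rfl
  have h4 : (fun k => (Pi.single (Sum.inr k) 1 : V 3)) = ey := rfl
  rw [wedge_apply_reps rep33 (by decide) rep33_injective, Fintype.sum_prod_type,
    Fin.sum_univ_two, Fintype.sum_option, Fintype.sum_option, Fintype.sum_prod_type,
    Fintype.sum_prod_type]
  simp only [rep33, if_true, mul_one, one_mul, Fin.isValue, one_ne_zero, if_false,
    Equiv.Perm.sign_one, stdFrame, Equiv.symm_apply_apply, Equiv.Perm.one_apply, h3, h4,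
    Equiv.Perm.sign_swap (Sum.inl_ne_inr), h1, h2, Equiv.Perm.sign_mul, sign_sumComm,
    Equiv.Perm.mul_apply, Equiv.sumComm_apply, Sum.swap_inl, Sum.swap_inr]
  norm_num
  ring

theorem omega_apply {n : ℕ} (v : Fin 2 → V n) : omega n v = (omegaFun (v 0) (v 1) : ℂ) := rfl

/-- The minus sign reflects that `Matrix.J` has -1 in its upper right block. -/
theorem omegaFun_single (i j : Fin 3 ⊕ Fin 3) :
    omegaFun (n := 3) (Pi.single i 1) (Pi.single j 1) = -Matrix.J (Fin 3) ℝ i j := by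
  rcases i with i | i <;> rcases j with j | j <;>
    fin_cases i <;> fin_cases j <;> simp [omegaFun, Matrix.J, Pi.single_apply]

theorem ofFn_vec {X : Type*} (f : Fin 3 → X) : f = ![f 0, f 1, f 2] := by
  funext i
  fin_cases i <;> rfl

/-- The ten choices of the pair fed to ω: both of the last two vectors, one of them (six terms,
odd), or none of them (three terms, even). -/
theorem wedge_omega_apply (α : Form 3 3) (v : Fin 5 → V 3) :
    wedge α (omega 3) v =
      α ![v 0, v 1, v 2] * omegaFun (v 3) (v 4)
      - α ![v 3, v 1, v 2] * omegaFun (v 0) (v 4)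
      - α ![v 0, v 3, v 2] * omegaFun (v 1) (v 4)
      - α ![v 0, v 1, v 3] * omegaFun (v 2) (v 4)
      - α ![v 4, v 1, v 2] * omegaFun (v 3) (v 0)
      - α ![v 0, v 4, v 2] * omegaFun (v 3) (v 1)
      - α ![v 0, v 1, v 4] * omegaFun (v 3) (v 2)
      + α ![v 0, v 3, v 4] * omegaFun (v 1) (v 2)
      + α ![v 4, v 1, v 3] * omegaFun (v 2) (v 0)
      + α ![v 3, v 4, v 2] * omegaFun (v 0) (v 1) := by
  rw [wedge_apply_reps rep32 (by decide) rep32_injective, Fintype.sum_sum_type,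
    Fintype.sum_option, Fintype.sum_prod_type]
  have hs : ∀ i : Fin 3, Equiv.Perm.sign (Equiv.swap (Sum.inl (i + 1)) (Sum.inr 0) *
      Equiv.swap (Sum.inl (i + 2)) (Sum.inr 1) : Equiv.Perm (Fin 3 ⊕ Fin 2)) = 1 := by decide
  simp only [omega_apply, rep32, Equiv.Perm.sign_one, Equiv.Perm.sign_swap (Sum.inl_ne_inr), hs]
  simp only [Fin.sum_univ_three, Fin.sum_univ_two]
  rw [show (fun i : Fin 3 => v (finSumFinEquiv ((1 : Equiv.Perm (Fin 3 ⊕ Fin 2)) (Sum.inl i)))) =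
    ![v 0, v 1, v 2] from ofFn_vec _]
  have h : ∀ (σ : Equiv.Perm (Fin 3 ⊕ Fin 2)) (a b c d e : Fin 5),
    finSumFinEquiv (σ (Sum.inl 0)) = a ∧ finSumFinEquiv (σ (Sum.inl 1)) = b ∧
    finSumFinEquiv (σ (Sum.inl 2)) = c ∧ finSumFinEquiv (σ (Sum.inr 0)) = d ∧
    finSumFinEquiv (σ (Sum.inr 1)) = e →
    α (fun i : Fin 3 => v (finSumFinEquiv (σ (Sum.inl i)))) *
      (omegaFun (v (finSumFinEquiv (σ (Sum.inr 0)))) (v (finSumFinEquiv (σ (Sum.inr 1)))) : ℂ) =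
    α ![v a, v b, v c] * (omegaFun (v d) (v e) : ℂ) := by
    rintro σ a b c d e ⟨rfl, rfl, rfl, rfl, rfl⟩
    rw [ofFn_vec (fun i : Fin 3 => v (finSumFinEquiv (σ (Sum.inl i))))]
  rw [h (Equiv.swap (Sum.inl 0) (Sum.inr 0)) 3 1 2 0 4 (by decide),
    h (Equiv.swap (Sum.inl 0) (Sum.inr 1)) 4 1 2 3 0 (by decide),
    h (Equiv.swap (Sum.inl 1) (Sum.inr 0)) 0 3 2 1 4 (by decide),
    h (Equiv.swap (Sum.inl 1) (Sum.inr 1)) 0 4 2 3 1 (by decide),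
    h (Equiv.swap (Sum.inl 2) (Sum.inr 0)) 0 1 3 2 4 (by decide),
    h (Equiv.swap (Sum.inl 2) (Sum.inr 1)) 0 1 4 3 2 (by decide),
    h (Equiv.swap (Sum.inl (0 + 1)) (Sum.inr 0) * Equiv.swap (Sum.inl (0 + 2)) (Sum.inr 1))
      0 3 4 1 2 (by decide),
    h (Equiv.swap (Sum.inl (1 + 1)) (Sum.inr 0) * Equiv.swap (Sum.inl (1 + 2)) (Sum.inr 1))
      4 1 3 2 0 (by decide),
    h (Equiv.swap (Sum.inl (2 + 1)) (Sum.inr 0) * Equiv.swap (Sum.inl (2 + 2)) (Sum.inr 1))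
      3 4 2 0 1 (by decide)]
  have e3 : finSumFinEquiv ((1 : Equiv.Perm (Fin 3 ⊕ Fin 2)) (Sum.inr 0)) = (3 : Fin 5) := rfl
  have e4 : finSumFinEquiv ((1 : Equiv.Perm (Fin 3 ⊕ Fin 2)) (Sum.inr 1)) = (4 : Fin 5) := rfl
  rw [e3, e4]
  push_cast
  ring

/-! ### The value of the volume form on the standard frame -/

/-- Representatives of the choices of two among six elements. -/
def rep42 : Option (Fin 4 × Fin 2) ⊕ {x : Fin 4 × Fin 4 // x.1 < x.2} →
    Equiv.Perm (Fin 4 ⊕ Fin 2)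
  | Sum.inl none => 1
  | Sum.inl (some (i, j)) => Equiv.swap (Sum.inl i) (Sum.inr j)
  | Sum.inr x => Equiv.swap (Sum.inl x.1.1) (Sum.inr 0) * Equiv.swap (Sum.inl x.1.2) (Sum.inr 1)

theorem rep42_injective :
    Function.Injective fun s => Finset.univ.image fun i => rep42 s (Sum.inl i) := by
  unfold rep42
  decide +kernel

/-- Representatives of the choices of two among four elements. -/
def rep22 : Option (Fin 2 × Fin 2) ⊕ Unit → Equiv.Perm (Fin 2 ⊕ Fin 2)
  | Sum.inl none => 1
  | Sum.inl (some (i, j)) => Equiv.swap (Sum.inl i) (Sum.inr j)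
  | Sum.inr _ => Equiv.sumComm (Fin 2) (Fin 2)

theorem rep22_injective :
    Function.Injective fun s => Finset.univ.image fun i => rep22 s (Sum.inl i) := by
  unfold rep22
  decide +kernel

theorem omegaFun_swap {n : ℕ} (v w : V n) : omegaFun v w = -omegaFun w v := by
  rw [omegaFun, omegaFun, ← Finset.sum_neg_distrib]
  exact Finset.sum_congr rfl fun i _ => by ring

theorem omegaPow_one_apply {n : ℕ} (v : Fin 2 → V n) :
    (omegaPow n 1 : Form n 2) v = omegaFun (v 0) (v 1) := by
  change wedge (omegaPow n 0) (omega n) v = _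
  rw [wedge_apply_reps (fun _ : Unit => 1) (by decide) (fun _ _ _ => rfl)]
  simp only [Finset.univ_unique, Finset.sum_const, Finset.card_singleton, one_smul,
    Equiv.Perm.sign_one, Units.val_one, Int.cast_one, one_mul, omega_apply]
  exact one_mul _

/-- Each of the three perfect matchings of four vectors arises from two of the six splittings, so ω²
is twice the Pfaffian of the Gram matrix. -/
theorem omegaPow_two_apply {n : ℕ} (v : Fin 4 → V n) :
    (omegaPow n 2 : Form n 4) v = ((2 * (omegaFun (v 0) (v 1) * omegaFun (v 2) (v 3)
      - omegaFun (v 0) (v 2) * omegaFun (v 1) (v 3)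
      + omegaFun (v 0) (v 3) * omegaFun (v 1) (v 2)) : ℝ) : ℂ) := by
  change wedge (omegaPow n 1) (omega n) v = _
  rw [wedge_apply_reps (q := 2) rep22 (by decide) rep22_injective, Fintype.sum_sum_type,
    Fintype.sum_option, Fintype.sum_prod_type]
  simp only [rep22, Equiv.Perm.sign_one, Equiv.Perm.sign_swap (Sum.inl_ne_inr), omega_apply,
    Fin.sum_univ_two, Finset.univ_unique, Finset.sum_singleton]
  have hs : Equiv.Perm.sign (Equiv.sumComm (Fin 2) (Fin 2) : Equiv.Perm (Fin 2 ⊕ Fin 2)) = 1 := by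
    rw [sign_sumComm]
    rfl
  have h : ∀ (σ : Equiv.Perm (Fin 2 ⊕ Fin 2)) (a b c d : Fin 4),
    finSumFinEquiv (σ (Sum.inl 0)) = a ∧ finSumFinEquiv (σ (Sum.inl 1)) = b ∧
    finSumFinEquiv (σ (Sum.inr 0)) = c ∧ finSumFinEquiv (σ (Sum.inr 1)) = d →
    (omegaPow n 1 : Form n 2) (fun i : Fin 2 => v (finSumFinEquiv (σ (Sum.inl i)))) *
      (omegaFun (v (finSumFinEquiv (σ (Sum.inr 0)))) (v (finSumFinEquiv (σ (Sum.inr 1)))) : ℂ) =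
    (omegaFun (v a) (v b) : ℂ) * (omegaFun (v c) (v d) : ℂ) := by
    rintro σ a b c d ⟨rfl, rfl, rfl, rfl⟩
    rw [omegaPow_one_apply]
  erw [h 1 0 1 2 3 (by decide),
    h (Equiv.swap (Sum.inl 0) (Sum.inr 0)) 2 1 0 3 (by decide),
    h (Equiv.swap (Sum.inl 0) (Sum.inr 1)) 3 1 2 0 (by decide),
    h (Equiv.swap (Sum.inl 1) (Sum.inr 0)) 0 2 1 3 (by decide),
    h (Equiv.swap (Sum.inl 1) (Sum.inr 1)) 0 3 2 1 (by decide),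
    h (Equiv.sumComm (Fin 2) (Fin 2)) 2 3 0 1 (by decide), hs]
  rw [omegaFun_swap (v 2) (v 1), omegaFun_swap (v 2) (v 0), omegaFun_swap (v 3) (v 1)]
  push_cast
  ring

theorem omegaPow_succ (n k : ℕ) : omegaPow n (k + 1) = wedge (omegaPow n k) (omega n) := rfl

theorem volForm_apply (n : ℕ) (v : Fin (n + n) → V n) : volForm n v =
    ((n.factorial : ℂ)⁻¹) * omegaPow n n (fun i => v (finCongr (two_mul n) i)) := rfl

/-- The values of the symplectic form on the standard frame. -/
def stdGram (i j : Fin 6) : ℤ :=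
  if i.1 + 3 = j.1 then 1 else if j.1 + 3 = i.1 then -1 else 0

theorem omegaFun_stdFrame (i j : Fin 6) :
    omegaFun (stdFrame 3 i) (stdFrame 3 j) = stdGram i j := by
  have h : ∀ i j : Fin 6, -Matrix.J (Fin 3) ℤ (finSumFinEquiv.symm i) (finSumFinEquiv.symm j) =
      stdGram i j := by
    decide
  rw [stdFrame, stdFrame, omegaFun_single, ← h, ← Matrix.map_J (Fin 3) (Int.castRingHom ℝ)]
  simp

/-- The value is -3! and not 3!, since reordering x₁x₂x₃y₁y₂y₃ as x₁y₁x₂y₂x₃y₃ is an odd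
permutation. -/
theorem omegaPow_three_stdFrame : (omegaPow 3 3 : Form 3 6) (stdFrame 3) = -6 := by
  have h1 : (omegaPow 3 3 : Form 3 6) = wedge (p := 4) (q := 2) (omegaPow 3 2) (omega 3) :=
    omegaPow_succ 3 2
  rw [h1, wedge_apply_reps (p := 4) (q := 2) rep42 (by decide) rep42_injective]
  -- All Gram entries of the frame are integers, so the sum over the fifteen representatives becomes
  -- an integer identity that can be decided.
  have h : ∀ σ : Equiv.Perm (Fin 4 ⊕ Fin 2),
      ((Equiv.Perm.sign σ : ℤ) : ℂ) *
      ((omegaPow 3 2 : Form 3 4) (fun i => stdFrame 3 (@finSumFinEquiv 4 2 (σ (Sum.inl i)))) *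
      (omega 3 (fun i => stdFrame 3 (@finSumFinEquiv 4 2 (σ (Sum.inr i)))))) =
      (((Equiv.Perm.sign σ : ℤ) *
        (2 * (stdGram (finSumFinEquiv (σ (Sum.inl 0))) (finSumFinEquiv (σ (Sum.inl 1))) *
          stdGram (finSumFinEquiv (σ (Sum.inl 2))) (finSumFinEquiv (σ (Sum.inl 3))) -
        stdGram (finSumFinEquiv (σ (Sum.inl 0))) (finSumFinEquiv (σ (Sum.inl 2))) *
          stdGram (finSumFinEquiv (σ (Sum.inl 1))) (finSumFinEquiv (σ (Sum.inl 3))) +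
        stdGram (finSumFinEquiv (σ (Sum.inl 0))) (finSumFinEquiv (σ (Sum.inl 3))) *
          stdGram (finSumFinEquiv (σ (Sum.inl 1))) (finSumFinEquiv (σ (Sum.inl 2)))) *
        stdGram (finSumFinEquiv (σ (Sum.inr 0))) (finSumFinEquiv (σ (Sum.inr 1)))) : ℤ) : ℂ) := by
    intro σ
    rw [omegaPow_two_apply, omega_apply]
    simp only [omegaFun_stdFrame]
    push_cast
    rfl
  refine (Finset.sum_congr rfl fun s _ => h (rep42 s)).trans ?_
  rw [← Int.cast_sum]
  have h2 : ∑ s, ((Equiv.Perm.sign (rep42 s) : ℤ) *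
        (2 * (stdGram (finSumFinEquiv (rep42 s (Sum.inl 0)))
            (finSumFinEquiv (rep42 s (Sum.inl 1))) *
          stdGram (finSumFinEquiv (rep42 s (Sum.inl 2))) (finSumFinEquiv (rep42 s (Sum.inl 3))) -
        stdGram (finSumFinEquiv (rep42 s (Sum.inl 0))) (finSumFinEquiv (rep42 s (Sum.inl 2))) *
          stdGram (finSumFinEquiv (rep42 s (Sum.inl 1))) (finSumFinEquiv (rep42 s (Sum.inl 3))) +
        stdGram (finSumFinEquiv (rep42 s (Sum.inl 0))) (finSumFinEquiv (rep42 s (Sum.inl 3))) *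
          stdGram (finSumFinEquiv (rep42 s (Sum.inl 1))) (finSumFinEquiv (rep42 s (Sum.inl 2)))) *
        stdGram (finSumFinEquiv (rep42 s (Sum.inr 0))) (finSumFinEquiv (rep42 s (Sum.inr 1)))) : ℤ)
      = -6 := by
    decide +kernel
  rw [h2]
  norm_num

theorem volForm_stdFrame : volForm 3 (stdFrame 3) = -1 := by
  have h : (fun i => stdFrame 3 (finCongr (two_mul 3) i)) = stdFrame 3 := rfl
  rw [volForm_apply]
  erw [h, omegaPow_three_stdFrame]
  norm_num [Nat.factorial]

/-! ### Alternating three-forms as trilinear maps -/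

section Trilinear

variable {M N : Type*} [AddCommGroup M] [Module ℝ M] [AddCommGroup N] [Module ℝ N]

theorem update_vec_zero {X : Type*} (a b c x : X) :
    Function.update ![a, b, c] 0 x = ![x, b, c] := by
  ext i
  fin_cases i <;> rfl

theorem update_vec_one {X : Type*} (a b c x : X) :
    Function.update ![a, b, c] 1 x = ![a, x, c] := by
  ext i
  fin_cases i <;> rfl

theorem update_vec_two {X : Type*} (a b c x : X) :
    Function.update ![a, b, c] 2 x = ![a, b, x] := by
  ext i
  fin_cases i <;> rfl

/-- An alternating form in three variables as a trilinear map. -/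
def tri (α : M [⋀^Fin 3]→ₗ[ℝ] N) : M →ₗ[ℝ] M →ₗ[ℝ] M →ₗ[ℝ] N where
  toFun u := LinearMap.mk₂ ℝ (fun v w => α ![u, v, w])
    (fun v v' w => by simpa only [update_vec_one] using α.map_update_add ![u, v, w] 1 v v')
    (fun c v w => by simpa only [update_vec_one] using α.map_update_smul ![u, v, w] 1 c v)
    (fun v w w' => by simpa only [update_vec_two] using α.map_update_add ![u, v, w] 2 w w')
    (fun c v w => by simpa only [update_vec_two] using α.map_update_smul ![u, v, w] 2 c w)
  map_add' u u' := by
    ext v w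
    change α ![u + u', v, w] = α ![u, v, w] + α ![u', v, w]
    simpa only [update_vec_zero] using α.map_update_add ![u, v, w] 0 u u'
  map_smul' c u := by
    ext v w
    change α ![c • u, v, w] = c • α ![u, v, w]
    simpa only [update_vec_zero] using α.map_update_smul ![u, v, w] 0 c u

theorem tri_apply (α : M [⋀^Fin 3]→ₗ[ℝ] N) (u v w : M) : tri α u v w = α ![u, v, w] := rfl

theorem tri_self₁₂ (α : M [⋀^Fin 3]→ₗ[ℝ] N) (u w : M) : tri α u u w = 0 :=
  α.map_eq_zero_of_eq ![u, u, w] (i := 0) (j := 1) rfl (by decide)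

theorem tri_self₂₃ (α : M [⋀^Fin 3]→ₗ[ℝ] N) (u w : M) : tri α w u u = 0 :=
  α.map_eq_zero_of_eq ![w, u, u] (i := 1) (j := 2) rfl (by decide)

theorem tri_self₁₃ (α : M [⋀^Fin 3]→ₗ[ℝ] N) (u w : M) : tri α u w u = 0 :=
  α.map_eq_zero_of_eq ![u, w, u] (i := 0) (j := 2) rfl (by decide)

theorem tri_swap₁₂ (α : M [⋀^Fin 3]→ₗ[ℝ] N) (u v w : M) : tri α u v w = -tri α v u w := by
  have := tri_self₁₂ α (u + v) w
  simp only [map_add, LinearMap.add_apply, tri_self₁₂, zero_add, add_zero] at this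
  rw [add_comm] at this
  exact eq_neg_of_add_eq_zero_left this

theorem tri_swap₂₃ (α : M [⋀^Fin 3]→ₗ[ℝ] N) (u v w : M) : tri α u v w = -tri α u w v := by
  have := tri_self₂₃ α (v + w) u
  simp only [map_add, LinearMap.add_apply, tri_self₂₃, zero_add, add_zero] at this
  rw [add_comm] at this
  exact eq_neg_of_add_eq_zero_left this

theorem tri_rotate (α : M [⋀^Fin 3]→ₗ[ℝ] N) (u v w : M) : tri α u v w = tri α v w u := by
  rw [tri_swap₁₂, tri_swap₂₃, neg_neg]

end Trilinear

/-! ### Symplectic frames and contraction -/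

/-- The standard symplectic form as a bilinear map. -/
def omegaBilin (n : ℕ) : V n →ₗ[ℝ] V n →ₗ[ℝ] ℝ :=
  LinearMap.mk₂ ℝ omegaFun
    (fun a b c => by
      simp only [omegaFun, ← Finset.sum_add_distrib]
      refine Finset.sum_congr rfl fun j _ => ?_
      simp
      ring)
    (fun r a b => by
      simp only [omegaFun, smul_eq_mul, Finset.mul_sum]
      refine Finset.sum_congr rfl fun j _ => ?_
      simp
      ring)
    (fun a b c => by
      simp only [omegaFun, ← Finset.sum_add_distrib]
      refine Finset.sum_congr rfl fun j _ => ?_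
      simp
      ring)
    (fun r a b => by
      simp only [omegaFun, smul_eq_mul, Finset.mul_sum]
      refine Finset.sum_congr rfl fun j _ => ?_
      simp
      ring)

theorem omegaBilin_apply {n : ℕ} (v w : V n) : omegaBilin n v w = omegaFun v w := rfl

/-- A symplectic frame of `ℝ²ⁿ`. -/
structure IsSympFrame {n : ℕ} (e f : Fin n → V n) : Prop where
  ee : ∀ i j, omegaBilin n (e i) (e j) = 0
  ff : ∀ i j, omegaBilin n (f i) (f j) = 0
  ef : ∀ i j, omegaBilin n (e i) (f j) = if i = j then 1 else 0

theorem IsSympFrame.fe {n : ℕ} {e f : Fin n → V n} (h : IsSympFrame e f) (i j : Fin n) :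
    omegaBilin n (f i) (e j) = if i = j then -1 else 0 := by
  rw [omegaBilin_apply, omegaFun_swap, ← omegaBilin_apply, h.ef]
  by_cases hij : i = j
  · simp [hij]
  · simp [hij, Ne.symm hij]

theorem isSympFrame_std {n : ℕ} : IsSympFrame (ex (n := n)) ey := by
  refine ⟨fun i j => ?_, fun i j => ?_, fun i j => ?_⟩
  · simp [omegaBilin_apply, omegaFun, ex]
  · simp [omegaBilin_apply, omegaFun, ey]
  · simp [omegaBilin_apply, omegaFun, ex, ey, Pi.single_apply, eq_comm]

/-- Swapping the two Lagrangian subspaces of a symplectic frame. -/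
theorem IsSympFrame.swap {n : ℕ} {e f : Fin n → V n} (h : IsSympFrame e f) :
    IsSympFrame f (fun i => -e i) := by
  refine ⟨h.ff, fun i j => by simp [h.ee], fun i j => ?_⟩
  rw [map_neg, h.fe]
  split_ifs <;> simp

theorem IsSympFrame.perm {n : ℕ} {e f : Fin n → V n} (h : IsSympFrame e f)
    (σ : Equiv.Perm (Fin n)) : IsSympFrame (e ∘ σ) (f ∘ σ) :=
  ⟨fun i j => h.ee _ _, fun i j => h.ff _ _, fun i j => by simp [h.ef]⟩

/-- The contraction of a bilinear map with the symplectic bivector, computed in a frame. -/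
def contr {n : ℕ} {N : Type*} [AddCommGroup N] (e f : Fin n → V n) (B : V n → V n → N) : N :=
  ∑ i, (B (e i) (f i) - B (f i) (e i))

theorem omegaBilin_eq_sum {n : ℕ} (v w : V n) :
    omegaBilin n v w = -∑ k, ∑ l, v k * Matrix.J (Fin n) ℝ k l * w l := by
  simp only [omegaBilin_apply, omegaFun, Fintype.sum_sum_type, Matrix.J, Matrix.fromBlocks_apply₁₁,
    Matrix.fromBlocks_apply₁₂, Matrix.fromBlocks_apply₂₁, Matrix.fromBlocks_apply₂₂,
    Matrix.zero_apply, Matrix.neg_apply, Matrix.one_apply]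
  simp [Finset.sum_sub_distrib]
  ring

theorem mem_symplecticGroup_of_gram {n : ℕ} {M : Matrix (Fin n ⊕ Fin n) (Fin n ⊕ Fin n) ℝ}
    (h : ∀ i j, omegaBilin n (fun k => M k i) (fun k => M k j) = -Matrix.J (Fin n) ℝ i j) :
    M ∈ Matrix.symplecticGroup (Fin n) ℝ := by
  rw [SymplecticGroup.mem_iff']
  ext i j
  have := h i j
  rw [omegaBilin_eq_sum, neg_inj] at this
  rw [← this]
  simp only [Matrix.mul_apply, Matrix.transpose_apply, Finset.sum_mul]
  exact Finset.sum_comm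

theorem gram_of_mem_symplecticGroup {n : ℕ} {M : Matrix (Fin n ⊕ Fin n) (Fin n ⊕ Fin n) ℝ}
    (hM : M ∈ Matrix.symplecticGroup (Fin n) ℝ) (i j : Fin n ⊕ Fin n) :
    omegaBilin n (fun k => M k i) (fun k => M k j) = -Matrix.J (Fin n) ℝ i j := by
  rw [SymplecticGroup.mem_iff'] at hM
  rw [omegaBilin_eq_sum, neg_inj, ← congrFun (congrFun hM i) j]
  simp only [Matrix.mul_apply, Matrix.transpose_apply, Finset.sum_mul]
  exact Finset.sum_comm

theorem IsSympFrame.mem_symplecticGroup {n : ℕ} {e f : Fin n → V n} (h : IsSympFrame e f) :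
    (Matrix.of fun k j => Sum.elim e f j k) ∈ Matrix.symplecticGroup (Fin n) ℝ := by
  refine mem_symplecticGroup_of_gram fun i j => ?_
  rcases i with i | i <;> rcases j with j | j
  · exact (h.ee i j).trans (by simp [Matrix.J])
  · exact (h.ef i j).trans (by simp [Matrix.J, Matrix.one_apply])
  · exact (h.fe i j).trans (by simp [Matrix.J, Matrix.one_apply, apply_ite])
  · exact (h.ff i j).trans (by simp [Matrix.J])

/-- The matrix M with columns e, f satisfies MᵀJM = J by the frame relations, hence also MJMᵀ = J.
The second identity says that the bivector Σ eᵢ ∧ fᵢ is the same for all symplectic frames. -/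
theorem IsSympFrame.bivector {n : ℕ} {e f : Fin n → V n} (h : IsSympFrame e f)
    (k l : Fin n ⊕ Fin n) :
    ∑ i, (e i k * f i l - f i k * e i l) = -Matrix.J (Fin n) ℝ k l := by
  have hM := SymplecticGroup.mem_iff.1 h.mem_symplecticGroup
  rw [← hM]
  simp only [Matrix.mul_apply, Matrix.transpose_apply, Fintype.sum_sum_type, Matrix.J,
    Matrix.fromBlocks_apply₁₁, Matrix.fromBlocks_apply₁₂, Matrix.fromBlocks_apply₂₁,
    Matrix.fromBlocks_apply₂₂, Matrix.zero_apply, Matrix.neg_apply, Matrix.one_apply,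
    Matrix.of_apply, Sum.elim_inl, Sum.elim_inr]
  simp [Finset.sum_sub_distrib]
  ring

theorem isLinearMap_eq_sum {n : ℕ} {N : Type*} [AddCommGroup N] [Module ℝ N] {F : V n → N}
    (hF : IsLinearMap ℝ F) (v : V n) : F v = ∑ k, v k • F (Pi.single k 1) := by
  conv_lhs => rw [pi_eq_sum_univ' v]
  exact (map_sum (hF.mk' F) _ _).trans (Finset.sum_congr rfl fun k _ => hF.map_smul _ _)

/-- By bilinearity the contraction sees the frame only through its bivector; this is the source of
all frame independence below. -/
theorem IsSympFrame.contr_eq_sum {n : ℕ} {N : Type*} [AddCommGroup N] [Module ℝ N]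
    {e f : Fin n → V n} (h : IsSympFrame e f) (B : V n → V n → N)
    (h₁ : ∀ w, IsLinearMap ℝ fun v => B v w) (h₂ : ∀ v, IsLinearMap ℝ (B v)) :
    contr e f B = ∑ k, ∑ l, (-Matrix.J (Fin n) ℝ k l) • B (Pi.single k 1) (Pi.single l 1) := by
  have key : ∀ v w, B v w = ∑ k, ∑ l, (v k * w l) • B (Pi.single k 1) (Pi.single l 1) := by
    intro v w
    rw [isLinearMap_eq_sum (h₁ w) v]
    refine Finset.sum_congr rfl fun k _ => ?_
    rw [isLinearMap_eq_sum (h₂ _) w, Finset.smul_sum]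
    exact Finset.sum_congr rfl fun l _ => smul_smul _ _ _
  simp only [contr, key (e _), key (f _), ← Finset.sum_sub_distrib, ← sub_smul]
  rw [Finset.sum_comm]
  refine Finset.sum_congr rfl fun k _ => ?_
  rw [Finset.sum_comm]
  refine Finset.sum_congr rfl fun l _ => ?_
  rw [← Finset.sum_smul, h.bivector]

theorem IsSympFrame.contr_eq {n : ℕ} {N : Type*} [AddCommGroup N] [Module ℝ N]
    {e f : Fin n → V n} (h : IsSympFrame e f) (B : V n → V n → N)
    (h₁ : ∀ w, IsLinearMap ℝ fun v => B v w) (h₂ : ∀ v, IsLinearMap ℝ (B v)) :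
    contr e f B = contr ex ey B := by
  rw [h.contr_eq_sum B h₁ h₂, isSympFrame_std.contr_eq_sum B h₁ h₂]

theorem isLinearMap_contr {n : ℕ} {M N : Type*} [AddCommGroup M] [Module ℝ M] [AddCommGroup N]
    [Module ℝ N] (e f : Fin n → V n) (B : M → V n → V n → N)
    (h : ∀ v w, IsLinearMap ℝ fun x => B x v w) : IsLinearMap ℝ fun x => contr e f (B x) := by
  constructor
  · intro x y
    simp only [contr, (h _ _).map_add, ← Finset.sum_add_distrib]
    exact Finset.sum_congr rfl fun i _ => by abel
  · intro c x
    simp only [contr, (h _ _).map_smul, ← smul_sub, Finset.smul_sum]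

/-! ### The quartic invariant of a real three-form -/

/-- The quadratic covariant of a real three-form, computed in a frame. -/
def kappa {n : ℕ} (e f : Fin n → V n) (α : V n [⋀^Fin 3]→ₗ[ℝ] ℝ) (v w : V n) : ℝ :=
  contr e f fun a a' => contr e f fun b b' => tri α v a b * tri α w a' b'

/-- The quartic invariant of a real three-form, computed in a frame. -/
def quartic {n : ℕ} (e f : Fin n → V n) (α : V n [⋀^Fin 3]→ₗ[ℝ] ℝ) : ℝ :=
  contr e f fun v v' => contr e f fun w w' => kappa e f α v w * kappa e f α v' w'

theorem IsLinearMap.mul_const' {M : Type*} [AddCommGroup M] [Module ℝ M] {F : M → ℝ}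
    (hF : IsLinearMap ℝ F) (c : ℝ) : IsLinearMap ℝ fun x => F x * c :=
  ⟨fun x y => by rw [hF.map_add, add_mul], fun r x => by
    rw [hF.map_smul, smul_eq_mul, smul_eq_mul, mul_assoc]⟩

theorem IsLinearMap.const_mul' {M : Type*} [AddCommGroup M] [Module ℝ M] {F : M → ℝ}
    (hF : IsLinearMap ℝ F) (c : ℝ) : IsLinearMap ℝ fun x => c * F x := by
  simpa only [mul_comm c] using IsLinearMap.mul_const' hF c

theorem isLinearMap_tri₁ {n : ℕ} (α : V n [⋀^Fin 3]→ₗ[ℝ] ℝ) (v w : V n) :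
    IsLinearMap ℝ fun u => tri α u v w :=
  ⟨fun x y => by simp, fun r x => by simp⟩

theorem isLinearMap_tri₂ {n : ℕ} (α : V n [⋀^Fin 3]→ₗ[ℝ] ℝ) (u w : V n) :
    IsLinearMap ℝ fun v => tri α u v w :=
  ⟨fun x y => by simp, fun r x => by simp⟩

theorem isLinearMap_tri₃ {n : ℕ} (α : V n [⋀^Fin 3]→ₗ[ℝ] ℝ) (u v : V n) :
    IsLinearMap ℝ fun w => tri α u v w :=
  ⟨fun x y => by simp, fun r x => by simp⟩

theorem isLinearMap_kappa_left {n : ℕ} (e f : Fin n → V n) (α : V n [⋀^Fin 3]→ₗ[ℝ] ℝ) (w : V n) :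
    IsLinearMap ℝ fun v => kappa e f α v w :=
  isLinearMap_contr e f _ fun _ _ => isLinearMap_contr e f _ fun _ _ =>
    IsLinearMap.mul_const' (isLinearMap_tri₁ α _ _) _

theorem isLinearMap_kappa_right {n : ℕ} (e f : Fin n → V n) (α : V n [⋀^Fin 3]→ₗ[ℝ] ℝ)
    (v : V n) : IsLinearMap ℝ fun w => kappa e f α v w :=
  isLinearMap_contr e f _ fun _ _ => isLinearMap_contr e f _ fun _ _ =>
    IsLinearMap.const_mul' (isLinearMap_tri₁ α _ _) _

/-- The frame is exchanged one contraction at a time, the inner one first, each expression being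
bilinear in the pair contracted. -/
theorem IsSympFrame.kappa_eq {n : ℕ} {e f : Fin n → V n} (h : IsSympFrame e f)
    (α : V n [⋀^Fin 3]→ₗ[ℝ] ℝ) (v w : V n) : kappa e f α v w = kappa ex ey α v w := by
  have h1 : ∀ a a' : V n, (contr e f fun b b' => tri α v a b * tri α w a' b') =
      contr ex ey fun b b' => tri α v a b * tri α w a' b' := fun a a' =>
    h.contr_eq _ (fun _ => IsLinearMap.mul_const' (isLinearMap_tri₃ α _ _) _)
      (fun _ => IsLinearMap.const_mul' (isLinearMap_tri₃ α _ _) _)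
  simp only [kappa, h1]
  exact h.contr_eq _
    (fun _ => isLinearMap_contr _ _ _ fun _ _ =>
      IsLinearMap.mul_const' (isLinearMap_tri₂ α _ _) _)
    (fun _ => isLinearMap_contr _ _ _ fun _ _ =>
      IsLinearMap.const_mul' (isLinearMap_tri₂ α _ _) _)

/-- The quartic invariant does not depend on the symplectic frame. -/
theorem IsSympFrame.quartic_eq {n : ℕ} {e f : Fin n → V n} (h : IsSympFrame e f)
    (α : V n [⋀^Fin 3]→ₗ[ℝ] ℝ) : quartic e f α = quartic ex ey α := by
  have h1 : ∀ v v' : V n, (contr e f fun w w' => kappa ex ey α v w * kappa ex ey α v' w') =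
      contr ex ey fun w w' => kappa ex ey α v w * kappa ex ey α v' w' := fun v v' =>
    h.contr_eq _ (fun _ => IsLinearMap.mul_const' (isLinearMap_kappa_right _ _ α _) _)
      (fun _ => IsLinearMap.const_mul' (isLinearMap_kappa_right _ _ α _) _)
  simp only [quartic, h.kappa_eq, h1]
  exact h.contr_eq _
    (fun _ => isLinearMap_contr _ _ _ fun _ _ =>
      IsLinearMap.mul_const' (isLinearMap_kappa_left _ _ α _) _)
    (fun _ => isLinearMap_contr _ _ _ fun _ _ =>
      IsLinearMap.const_mul' (isLinearMap_kappa_left _ _ α _) _)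

theorem contr_const_mul {n : ℕ} (e f : Fin n → V n) (c : ℝ) (B : V n → V n → ℝ) :
    (contr e f fun v w => c * B v w) = c * contr e f B := by
  simp only [contr, ← mul_sub, Finset.mul_sum]

theorem kappa_smul {n : ℕ} (e f : Fin n → V n) (r : ℝ) (α : V n [⋀^Fin 3]→ₗ[ℝ] ℝ) (v w : V n) :
    kappa e f (r • α) v w = r ^ 2 * kappa e f α v w := by
  simp only [kappa, ← contr_const_mul]
  congr! 5
  simp only [tri_apply, AlternatingMap.smul_apply, smul_eq_mul]
  ring_nf

theorem quartic_smul {n : ℕ} (e f : Fin n → V n) (r : ℝ) (α : V n [⋀^Fin 3]→ₗ[ℝ] ℝ) :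
    quartic e f (r • α) = r ^ 4 * quartic e f α := by
  simp only [quartic, ← contr_const_mul, kappa_smul]
  congr! 4
  ring_nf

/-- The Levi-Civita symbol. -/
def levi (i j k : Fin 3) : ℝ :=
  ((j.1 : ℝ) - i.1) * ((k.1 : ℝ) - i.1) * ((k.1 : ℝ) - j.1) / 2

/-- The hypotheses say that α = a₀ q₀p₁p₂ + a₁ p₀q₁p₂ + a₂ p₀p₁q₂ + b q₀q₁q₂ in the coordinates pᵢ,
qᵢ dual to eᵢ, fᵢ. For such α the quadratic covariant is diagonal. -/
theorem kappa_normalForm {e f : Fin 3 → V 3} {α : V 3 [⋀^Fin 3]→ₗ[ℝ] ℝ} {a : Fin 3 → ℝ}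
    {b : ℝ} (h0 : ∀ i j k, tri α (e i) (e j) (e k) = 0)
    (h1 : ∀ i j k, tri α (f i) (e j) (e k) = a i * levi i j k)
    (h2 : ∀ i j k, tri α (e i) (f j) (f k) = 0)
    (h3 : ∀ i j k, tri α (f i) (f j) (f k) = b * levi i j k) :
    (∀ i j, kappa e f α (e i) (e j) =
      if i = j then -4 * ![a 1 * a 2, a 2 * a 0, a 0 * a 1] i else 0) ∧
    (∀ i j, kappa e f α (f i) (f j) = if i = j then 4 * (a i * b) else 0) ∧
    (∀ i j, kappa e f α (e i) (f j) = 0) ∧ ∀ i j, kappa e f α (f i) (e j) = 0 := by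
  have h1' : ∀ i j k, tri α (e i) (f j) (e k) = -(a j * levi j i k) := fun i j k => by
    rw [tri_swap₁₂, h1]
  have h1'' : ∀ i j k, tri α (e i) (e j) (f k) = a k * levi k i j := fun i j k => by
    rw [tri_rotate, tri_rotate, h1]
  have h2' : ∀ i j k, tri α (f i) (e j) (f k) = 0 := fun i j k => by
    rw [tri_swap₁₂, h2, neg_zero]
  have h2'' : ∀ i j k, tri α (f i) (f j) (e k) = 0 := fun i j k => by
    rw [tri_rotate, tri_rotate, h2]
  refine ⟨fun i j => ?_, fun i j => ?_, fun i j => ?_, fun i j => ?_⟩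
  · simp only [kappa, contr, h0, h2, h1', h1'', Fin.sum_univ_three, levi]
    fin_cases i <;> fin_cases j <;> norm_num <;> ring_nf
  · simp only [kappa, contr, h1, h3, h2', h2'', Fin.sum_univ_three, levi]
    fin_cases i <;> fin_cases j <;> norm_num <;> ring_nf
  · simp only [kappa, contr, h0, h1, h2, h3, h1', h1'', h2', h2'', Fin.sum_univ_three]
    ring_nf
  · simp only [kappa, contr, h0, h1, h2, h3, h1', h1'', h2', h2'', Fin.sum_univ_three]
    ring_nf

/-- Only the products κ(eᵢ, eᵢ) κ(fᵢ, fᵢ) = -16 a₀a₁a₂b survive the contraction; each of the three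
occurs twice. -/
theorem quartic_normalForm {e f : Fin 3 → V 3} {α : V 3 [⋀^Fin 3]→ₗ[ℝ] ℝ} {a : Fin 3 → ℝ}
    {b : ℝ} (h0 : ∀ i j k, tri α (e i) (e j) (e k) = 0)
    (h1 : ∀ i j k, tri α (f i) (e j) (e k) = a i * levi i j k)
    (h2 : ∀ i j k, tri α (e i) (f j) (f k) = 0)
    (h3 : ∀ i j k, tri α (f i) (f j) (f k) = b * levi i j k) :
    quartic e f α = -96 * (a 0 * a 1 * a 2 * b) := by
  obtain ⟨kee, kff, kef, kfe⟩ := kappa_normalForm h0 h1 h2 h3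
  simp only [quartic, contr, kee, kff, kef, kfe, Fin.sum_univ_three]
  simp
  ring

/-! ### Normal forms of the real parts of forms in `𝒰` -/

theorem IsSympFrame.tri_ne_zero {e f : Fin 3 → V 3} (h : IsSympFrame e f) {Ω : Prim 3}
    (hΩ : Ω ∈ U 3) {p q : ℝ} (hpq : p ^ 2 + q ^ 2 ≠ 0) :
    tri (toForm Ω) (p • e 0 + q • f 0) (e 1) (e 2) ≠ 0 := by
  refine apply_ne_zero_of_mem_U hΩ _ ?_ ?_
  · rw [Fintype.linearIndependent_iff]
    intro c hc
    rw [Fin.sum_univ_three] at hc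
    -- Pairing a linear relation with p f₀ - q e₀, f₁, f₂ isolates its coefficients, the first one
    -- with the factor p² + q².
    have h0 := congrArg (fun v => omegaBilin 3 v (p • f 0 - q • e 0)) hc
    have h1 := congrArg (fun v => omegaBilin 3 v (f 1)) hc
    have h2 := congrArg (fun v => omegaBilin 3 v (f 2)) hc
    simp [h.ee, h.ff, h.ef, h.fe] at h0 h1 h2
    have h0' : c 0 = 0 := by
      have : c 0 * (p ^ 2 + q ^ 2) = 0 := by linear_combination h0
      exact (mul_eq_zero.1 this).resolve_right hpq
    intro i
    fin_cases i
    exacts [h0', h1, h2]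
  · intro i j
    rw [← omegaBilin_apply]
    fin_cases i <;> fin_cases j <;> simp [h.ee, h.ff, h.ef, h.fe]
    ring

/-- The real part of a form in `𝒰` does not vanish on a circle of Lagrangian subspaces. -/
def IsNonvanishing (α : V 3 [⋀^Fin 3]→ₗ[ℝ] ℝ) : Prop :=
  ∀ e f : Fin 3 → V 3, IsSympFrame e f → tri α (e 0) (e 1) (e 2) = 0 →
    tri α (f 0) (e 1) (e 2) ≠ 0

/-- The real part of a form. -/
def rePart {n k : ℕ} (α : Form n k) : V n [⋀^Fin k]→ₗ[ℝ] ℝ :=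
  Complex.reLm.compAlternatingMap α

theorem rePart_apply {n k : ℕ} (α : Form n k) (v : Fin k → V n) : rePart α v = (α v).re := rfl

/-- If the real part vanished at both ends of the pencil p e₀ + q f₀, then Ω would be purely
imaginary along the pencil and linear in (p, q), so it would vanish for some (p, q) ≠ 0 and hence on
a Lagrangian subspace. -/
theorem isNonvanishing_rePart {Ω : Prim 3} (hΩ : Ω ∈ U 3) :
    IsNonvanishing (rePart (toForm Ω)) := by
  intro e f h h0 h1
  have key : ∀ p q : ℝ, p ^ 2 + q ^ 2 ≠ 0 →
      p * (tri (toForm Ω) (e 0) (e 1) (e 2)).im + q * (tri (toForm Ω) (f 0) (e 1) (e 2)).im ≠ 0 := by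
    intro p q hpq h2
    refine h.tri_ne_zero hΩ hpq ?_
    rw [tri_apply, rePart_apply, ← tri_apply] at h0 h1
    apply Complex.ext
    · simp [h0, h1]
    · simpa using h2
  by_cases hq : (tri (toForm Ω) (f 0) (e 1) (e 2)).im = 0
  · exact key 0 1 (by norm_num) (by rw [hq]; ring)
  · refine key (tri (toForm Ω) (f 0) (e 1) (e 2)).im (-(tri (toForm Ω) (e 0) (e 1) (e 2)).im) ?_
      (by ring)
    have := sq_nonneg (tri (toForm Ω) (e 0) (e 1) (e 2)).im
    have := pow_pos (abs_pos.2 hq) 2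
    rw [sq_abs] at this
    nlinarith

/-- The contraction of a three-form with the symplectic bivector vanishes. -/
def IsContractionFree {n : ℕ} {N : Type*} [AddCommGroup N] [Module ℝ N]
    (α : V n [⋀^Fin 3]→ₗ[ℝ] N) : Prop :=
  ∀ (e f : Fin n → V n), IsSympFrame e f → ∀ w, ∑ i, tri α (e i) (f i) w = 0

theorem contr_tri {n : ℕ} {N : Type*} [AddCommGroup N] [Module ℝ N]
    (α : V n [⋀^Fin 3]→ₗ[ℝ] N) (e f : Fin n → V n) (w : V n) :
    contr e f (fun u v => tri α u v w) = (2 : ℝ) • ∑ i, tri α (e i) (f i) w := by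
  simp only [contr, tri_swap₁₂ α (f _) (e _), Finset.smul_sum, sub_neg_eq_add, two_smul]

theorem isContractionFree_of_std {n : ℕ} {N : Type*} [AddCommGroup N] [Module ℝ N]
    {α : V n [⋀^Fin 3]→ₗ[ℝ] N}
    (hα : ∀ k, ∑ i, tri α (ex i) (ey i) (Pi.single k 1) = 0) : IsContractionFree α := by
  intro e f h w
  have h1 := h.contr_eq (fun u v => tri α u v w)
    (fun v => ⟨fun x y => by simp, fun r x => by simp⟩)
    (fun v => ⟨fun x y => by simp, fun r x => by simp⟩)
  rw [contr_tri, contr_tri] at h1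
  have h2 : ∑ i, tri α (ex i) (ey i) w = 0 := by
    have hl : IsLinearMap ℝ fun w => ∑ i, tri α (ex i) (ey i) w :=
      ⟨fun x y => by simp [Finset.sum_add_distrib], fun r x => by simp [Finset.smul_sum]⟩
    rw [isLinearMap_eq_sum hl w]
    exact Finset.sum_eq_zero fun k _ => by rw [hα, smul_zero]
  rw [h2, smul_zero, smul_eq_zero] at h1
  exact h1.resolve_left two_ne_zero

theorem omegaFun_ex_ex {n : ℕ} (i j : Fin n) : omegaFun (ex i) (ex j) = 0 :=
  isSympFrame_std.ee i j

theorem omegaFun_ey_ey {n : ℕ} (i j : Fin n) : omegaFun (ey i) (ey j) = 0 :=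
  isSympFrame_std.ff i j

theorem omegaFun_ex_ey {n : ℕ} (i j : Fin n) :
    omegaFun (ex i) (ey j) = if i = j then 1 else 0 :=
  isSympFrame_std.ef i j

theorem omegaFun_ey_ex {n : ℕ} (i j : Fin n) :
    omegaFun (ey i) (ex j) = if i = j then -1 else 0 :=
  isSympFrame_std.fe i j

/-- Evaluate Ω ∧ ω = 0 on eᵢ, fᵢ, w, eⱼ, fⱼ, where w is ω-orthogonal to both planes: the two terms
Ω(eᵢ, fᵢ, w) and Ω(eⱼ, fⱼ, w) remain. For w = eₘ or fₘ the term of index m vanishes by alternation,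
so taking i and j to be the other two indices gives the whole contraction. -/
theorem isContractionFree_toForm (Ω : Prim 3) : IsContractionFree (toForm Ω) := by
  refine isContractionFree_of_std fun k => ?_
  have key : ∀ (i j : Fin 3) (w : V 3), omegaFun (ex i) w = 0 → omegaFun (ey i) w = 0 →
      omegaFun (ex j) w = 0 → omegaFun (ey j) w = 0 → i ≠ j →
      tri (toForm Ω) (ex i) (ey i) w + tri (toForm Ω) (ex j) (ey j) w = 0 := by
    intro i j w h1 h2 h3 h4 hij
    have h := congrArg (fun β => β ![ex i, ey i, w, ex j, ey j])
      (show wedge (toForm Ω) (omega 3) = 0 from Ω.2)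
    simp only [AlternatingMap.zero_apply] at h
    rw [wedge_omega_apply] at h
    have h1' := omegaFun_swap w (ex i)
    have h3' := omegaFun_swap w (ex j)
    have h4' := omegaFun_swap w (ey j)
    rw [h1, neg_zero] at h1'
    rw [h3, neg_zero] at h3'
    rw [h4, neg_zero] at h4'
    simp [omegaFun_ex_ex, omegaFun_ey_ey, omegaFun_ex_ey, hij, hij.symm, h2, h3,
      h1', h4'] at h
    rw [tri_apply, tri_apply]
    exact h
  have hx : ∀ m, ∑ i, tri (toForm Ω) (ex i) (ey i) (ex m) = 0 := by
    intro m
    have hm : ∀ i j, i ≠ m → j ≠ m → i ≠ j →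
        tri (toForm Ω) (ex i) (ey i) (ex m) + tri (toForm Ω) (ex j) (ey j) (ex m) = 0 := by
      intro i j hi hj hij
      apply key _ _ _ _ _ _ _ hij <;>
        simp [omegaFun_ex_ex, omegaFun_ey_ex, hi, hj]
    rw [Fin.sum_univ_three]
    fin_cases m
    · simpa [tri_self₁₃] using hm 1 2 (by decide) (by decide) (by decide)
    · simpa [tri_self₁₃] using hm 0 2 (by decide) (by decide) (by decide)
    · simpa [tri_self₁₃] using hm 0 1 (by decide) (by decide) (by decide)
  have hy : ∀ m, ∑ i, tri (toForm Ω) (ex i) (ey i) (ey m) = 0 := by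
    intro m
    have hm : ∀ i j, i ≠ m → j ≠ m → i ≠ j →
        tri (toForm Ω) (ex i) (ey i) (ey m) + tri (toForm Ω) (ex j) (ey j) (ey m) = 0 := by
      intro i j hi hj hij
      apply key _ _ _ _ _ _ _ hij <;>
        simp [omegaFun_ex_ey, omegaFun_ey_ey, hi, hj]
    rw [Fin.sum_univ_three]
    fin_cases m
    · simpa [tri_self₂₃] using hm 1 2 (by decide) (by decide) (by decide)
    · simpa [tri_self₂₃] using hm 0 2 (by decide) (by decide) (by decide)
    · simpa [tri_self₂₃] using hm 0 1 (by decide) (by decide) (by decide)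
  rcases k with m | m
  · exact hx m
  · exact hy m

theorem isContractionFree_rePart {n : ℕ} {α : Form n 3} (hα : IsContractionFree α) :
    IsContractionFree (rePart α) := by
  intro e f h w
  have := congrArg Complex.re (hα e f h w)
  simpa [tri_apply, rePart_apply] using this

section NormalForm

variable {α : V 3 [⋀^Fin 3]→ₗ[ℝ] ℝ}

theorem exists_frame_tri_eq_zero (α : V 3 [⋀^Fin 3]→ₗ[ℝ] ℝ) :
    ∃ e f, IsSympFrame e f ∧ tri α (e 0) (e 1) (e 2) = 0 := by
  -- Rotating the first frame vector in its symplectic plane, a real linear function on the circle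
  -- has a zero, here in the direction of (t, -s).
  obtain ⟨p, q, hpq, h0⟩ : ∃ p q : ℝ, p ^ 2 + q ^ 2 = 1 ∧
      p * tri α (ex 0) (ex 1) (ex 2) + q * tri α (ey 0) (ex 1) (ex 2) = 0 := by
    set s := tri α (ex 0) (ex 1) (ex 2)
    set t := tri α (ey 0) (ex 1) (ex 2)
    by_cases hst : s ^ 2 + t ^ 2 = 0
    · refine ⟨1, 0, by norm_num, ?_⟩
      have : s ^ 2 = 0 := by nlinarith [sq_nonneg s, sq_nonneg t]
      rw [pow_eq_zero_iff two_ne_zero] at this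
      rw [this]
      ring
    · have hpos : 0 < s ^ 2 + t ^ 2 := lt_of_le_of_ne (by positivity) (Ne.symm hst)
      have hsq := Real.sq_sqrt hpos.le
      have hne : √(s ^ 2 + t ^ 2) ≠ 0 := (Real.sqrt_pos.2 hpos).ne'
      refine ⟨t / √(s ^ 2 + t ^ 2), -s / √(s ^ 2 + t ^ 2), ?_, by ring⟩
      rw [div_pow, div_pow, hsq]
      field_simp
      ring
  have h := isSympFrame_std (n := 3)
  refine ⟨![p • ex 0 + q • ey 0, ex 1, ex 2], ![p • ey 0 - q • ex 0, ey 1, ey 2],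
    ⟨?_, ?_, ?_⟩, ?_⟩
  · intro i j
    fin_cases i <;> fin_cases j <;> simp [h.ee, h.ff, h.ef, h.fe]
    ring
  · intro i j
    fin_cases i <;> fin_cases j <;> simp [h.ee, h.ff, h.ef, h.fe]
    ring
  · intro i j
    fin_cases i <;> fin_cases j <;> simp [h.ee, h.ff, h.ef, h.fe]
    linear_combination hpq
  · simpa using h0

/-- The shear `e 2 ↦ e 2 + c₀ e 0 + c₁ e 1`. -/
theorem IsSympFrame.shear_two {e f : Fin 3 → V 3} (h : IsSympFrame e f) (c₀ c₁ : ℝ) :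
    IsSympFrame ![e 0, e 1, e 2 + c₀ • e 0 + c₁ • e 1] ![f 0 - c₀ • f 2, f 1 - c₁ • f 2, f 2] := by
  refine ⟨fun i j => ?_, fun i j => ?_, fun i j => ?_⟩ <;>
    fin_cases i <;> fin_cases j <;> simp [h.ee, h.ff, h.ef]

/-- The shear `e 1 ↦ e 1 + c e 0`. -/
theorem IsSympFrame.shear_one {e f : Fin 3 → V 3} (h : IsSympFrame e f) (c : ℝ) :
    IsSympFrame ![e 0, e 1 + c • e 0, e 2] ![f 0 - c • f 1, f 1, f 2] := by
  refine ⟨fun i j => ?_, fun i j => ?_, fun i j => ?_⟩ <;>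
    fin_cases i <;> fin_cases j <;> simp [h.ee, h.ff, h.ef]

/-- The shear of `f` by a symmetric matrix. -/
theorem IsSympFrame.shear_symm {e f : Fin 3 → V 3} (h : IsSympFrame e f)
    (t₀ t₁ t₂ s₀ s₁ s₂ : ℝ) :
    IsSympFrame e ![f 0 + t₀ • e 0 + s₂ • e 1 + s₁ • e 2, f 1 + s₂ • e 0 + t₁ • e 1 + s₀ • e 2,
      f 2 + s₁ • e 0 + s₀ • e 1 + t₂ • e 2] := by
  refine ⟨h.ee, fun i j => ?_, fun i j => ?_⟩ <;>
    fin_cases i <;> fin_cases j <;> simp [h.ee, h.ff, h.ef, h.fe]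

theorem IsNonvanishing.tri_one_ne_zero (hα : IsNonvanishing α) {e f : Fin 3 → V 3}
    (h : IsSympFrame e f) (h0 : tri α (e 0) (e 1) (e 2) = 0) : tri α (e 0) (f 1) (e 2) ≠ 0 := by
  have := hα _ _ (h.perm (Equiv.swap 0 1)) (by
    change tri α (e 1) (e 0) (e 2) = 0
    rw [tri_swap₁₂, h0, neg_zero])
  rw [tri_swap₁₂, neg_ne_zero]
  exact this

theorem IsNonvanishing.tri_two_ne_zero (hα : IsNonvanishing α) {e f : Fin 3 → V 3}
    (h : IsSympFrame e f) (h0 : tri α (e 0) (e 1) (e 2) = 0) : tri α (e 0) (e 1) (f 2) ≠ 0 := by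
  have := hα _ _ (h.perm (Equiv.swap 0 2)) (by
    change tri α (e 2) (e 1) (e 0) = 0
    rw [tri_swap₁₂, tri_swap₂₃, tri_swap₁₂, h0]
    simp)
  rw [tri_rotate, tri_rotate, tri_swap₂₃, neg_ne_zero]
  exact this

/-- Consider the matrix of values of α at the frame e with eᵢ replaced by fⱼ. Its diagonal entries
are non-zero in every frame with α(e₀, e₁, e₂) = 0, so they can serve as pivots: two shears clear
the entries below the diagonal. For a contraction-free form the matrix is symmetric, and it is then
diagonal. -/
theorem IsNonvanishing.exists_frame_diagonal (hα : IsNonvanishing α) :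
    ∃ e f, IsSympFrame e f ∧ tri α (e 0) (e 1) (e 2) = 0 ∧ tri α (e 0) (f 0) (e 2) = 0 ∧
      tri α (e 0) (e 1) (f 0) = 0 ∧ tri α (e 0) (e 1) (f 1) = 0 := by
  obtain ⟨e, f, h, h0⟩ := exists_frame_tri_eq_zero α
  obtain ⟨e, f, h, h0, h1, h2⟩ : ∃ e f, IsSympFrame e f ∧ tri α (e 0) (e 1) (e 2) = 0 ∧
      tri α (e 0) (e 1) (f 0) = 0 ∧ tri α (e 0) (e 1) (f 1) = 0 := by
    have h2 := hα.tri_two_ne_zero h h0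
    refine ⟨_, _, h.shear_two (tri α (e 0) (e 1) (f 0) / tri α (e 0) (e 1) (f 2))
      (tri α (e 0) (e 1) (f 1) / tri α (e 0) (e 1) (f 2)), ?_, ?_, ?_⟩
    · simp [h0, tri_self₁₃, tri_self₂₃]
    · simp [h2]
    · simp [h2]
  have h3 := hα.tri_one_ne_zero h h0
  refine ⟨_, _, h.shear_one (tri α (e 0) (f 0) (e 2) / tri α (e 0) (f 1) (e 2)), ?_, ?_, ?_, ?_⟩
  · simp [h0, tri_self₁₂]
  · simp [h3]
  · simp [h1, h2, tri_self₁₂]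
  · simp [h2, tri_self₁₂]

end NormalForm

section NormalForm

variable {α : V 3 [⋀^Fin 3]→ₗ[ℝ] ℝ}

theorem tri_eq_levi (α : V 3 [⋀^Fin 3]→ₗ[ℝ] ℝ) (u : V 3) (e : Fin 3 → V 3) (j k : Fin 3) :
    tri α u (e j) (e k) = tri α u (e 1) (e 2) * levi 0 j k - tri α u (e 0) (e 2) * levi 1 j k +
      tri α u (e 0) (e 1) * levi 2 j k := by
  have h1 := tri_swap₂₃ α u (e 1) (e 0)
  have h2 := tri_swap₂₃ α u (e 2) (e 0)
  have h3 := tri_swap₂₃ α u (e 2) (e 1)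
  fin_cases j <;> fin_cases k <;> simp [levi, tri_self₂₃, h1, h2, h3] <;> norm_num

theorem tri_frame_eq_levi (α : V 3 [⋀^Fin 3]→ₗ[ℝ] ℝ) (e : Fin 3 → V 3) (i j k : Fin 3) :
    tri α (e i) (e j) (e k) = tri α (e 0) (e 1) (e 2) * levi i j k := by
  have h1 := tri_swap₁₂ α (e 1) (e 0) (e 2)
  have h2 : tri α (e 2) (e 0) (e 1) = tri α (e 0) (e 1) (e 2) := tri_rotate α _ _ _
  rw [tri_eq_levi]
  fin_cases i <;> simp [tri_self₁₂, tri_self₁₃, h1, h2]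

/-- The form is brought to the shape required by `quartic_normalForm`. After diagonalization the
values on (f, e, e) are correct; a symmetric shear of f then removes the values on (e, f, f), and
non-vanishing shows that no coefficient of the result is zero. -/
theorem IsNonvanishing.quartic_ne_zero (hα : IsNonvanishing α) (hc : IsContractionFree α) :
    quartic ex ey α ≠ 0 := by
  obtain ⟨e, f, h, h0, h1, h2, h3⟩ := hα.exists_frame_diagonal
  set a : Fin 3 → ℝ := ![tri α (f 0) (e 1) (e 2), tri α (e 0) (f 1) (e 2),
    tri α (e 0) (e 1) (f 2)] with ha
  have a0 : a 0 ≠ 0 := hα e f h h0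
  have a1 : a 1 ≠ 0 := hα.tri_one_ne_zero h h0
  have a2 : a 2 ≠ 0 := hα.tri_two_ne_zero h h0
  have H0 : ∀ i j k, tri α (e i) (e j) (e k) = 0 := fun i j k => by
    rw [tri_frame_eq_levi, h0, zero_mul]
  have H1 : ∀ i j k, tri α (f i) (e j) (e k) = a i * levi i j k := by
    have c0 := hc e f h (e 0)
    have c1 := hc e f h (e 1)
    have c2 := hc e f h (e 2)
    simp only [Fin.sum_univ_three, tri_self₁₃, zero_add, add_zero] at c0 c1 c2
    intro i j k
    rw [tri_eq_levi]
    fin_cases i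
    · have e1 : tri α (f 0) (e 0) (e 2) = 0 := by rw [tri_swap₁₂, h1, neg_zero]
      have e2 : tri α (f 0) (e 0) (e 1) = 0 := by rw [tri_rotate, h2]
      simp [e1, e2, ha]
    · have e1 : tri α (f 1) (e 1) (e 2) = 0 := by
        rw [tri_swap₁₂]
        linear_combination h1 - c2
      have e2 : tri α (f 1) (e 0) (e 1) = 0 := by rw [tri_rotate, h3]
      have e3 : tri α (f 1) (e 0) (e 2) = -tri α (e 0) (f 1) (e 2) := tri_swap₁₂ α _ _ _
      simp [e1, e2, e3, ha]
    · have e1 : tri α (f 2) (e 1) (e 2) = 0 := by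
        linarith [tri_swap₂₃ α (e 0) (f 0) (e 1), tri_rotate α (e 2) (f 2) (e 1)]
      have e2 : tri α (f 2) (e 0) (e 2) = 0 := by
        linarith [tri_rotate α (e 0) (e 1) (f 1), tri_rotate α (e 2) (f 2) (e 0)]
      have e3 : tri α (f 2) (e 0) (e 1) = tri α (e 0) (e 1) (f 2) := tri_rotate α _ _ _
      simp [e1, e2, e3, ha]
  have H1' : ∀ i j k, tri α (e i) (f j) (e k) = -(a j * levi j i k) := fun i j k => by
    rw [tri_swap₁₂, H1]
  have H1'' : ∀ i j k, tri α (e i) (e j) (f k) = a k * levi k i j := fun i j k => by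
    rw [tri_rotate, tri_rotate, H1]
  -- The off-diagonal entries of the symmetric shear remove the values on (eᵢ, fᵢ, fⱼ). With i, j, k
  -- distinct, removing the value on (eᵢ, fⱼ, fₖ) requires tⱼ/aⱼ + tₖ/aₖ = -βᵢ; these three
  -- equations determine the diagonal entries chosen below.
  set β₀ := tri α (e 0) (f 1) (f 2) / (a 1 * a 2) with hβ₀
  set β₁ := -tri α (e 1) (f 0) (f 2) / (a 0 * a 2) with hβ₁
  set β₂ := tri α (e 2) (f 0) (f 1) / (a 0 * a 1) with hβ₂
  have h' := h.shear_symm (a 0 * (β₀ - β₁ - β₂) / 2) (a 1 * (β₁ - β₀ - β₂) / 2)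
    (a 2 * (β₂ - β₀ - β₁) / 2) (tri α (e 1) (f 0) (f 1) / a 0) (tri α (e 0) (f 0) (f 1) / a 1)
    (-tri α (e 0) (f 0) (f 2) / a 2)
  set f' : Fin 3 → V 3 := ![_, _, _] with hf'
  have K1 : ∀ i j k, tri α (f' i) (e j) (e k) = a i * levi i j k := by
    intro i j k
    rw [← H1]
    fin_cases i <;> simp [hf', H0]
  have c0 := hc e f' h' (f' 0)
  have c1 := hc e f' h' (f' 1)
  have c2 := hc e f' h' (f' 2)
  simp only [Fin.sum_univ_three, tri_self₂₃, zero_add, add_zero] at c0 c1 c2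
  have s0 := tri_self₂₃ α (f 0)
  have s1 := tri_self₂₃ α (f 1)
  have s2 := tri_self₂₃ α (f 2)
  have K012 : tri α (e 0) (f' 1) (f' 2) = 0 := by
    simp [hf', H0, H1', H1'', levi]
    norm_num
    rw [hβ₀, hβ₁, hβ₂]
    field_simp
    ring
  have K102 : tri α (e 1) (f' 0) (f' 2) = 0 := by
    simp [hf', H0, H1', H1'', levi]
    norm_num
    rw [hβ₀, hβ₁, hβ₂]
    field_simp
    ring
  have K201 : tri α (e 2) (f' 0) (f' 1) = 0 := by
    simp [hf', H0, H1', H1'', levi]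
    norm_num
    rw [hβ₀, hβ₁, hβ₂]
    field_simp
    ring
  have K001 : tri α (e 0) (f' 0) (f' 1) = 0 := by
    simp [hf', H0, H1', H1'', levi]
    norm_num
    field_simp
    ring
  have K002 : tri α (e 0) (f' 0) (f' 2) = 0 := by
    simp [hf', H0, H1', H1'', levi]
    norm_num
    field_simp
    ring
  have K101 : tri α (e 1) (f' 0) (f' 1) = 0 := by
    simp [hf', H0, H1', H1'', levi]
    norm_num
    field_simp
    ring
  -- The remaining three values are not controlled by further parameters; they vanish because the
  -- contraction does.
  have K112 : tri α (e 1) (f' 1) (f' 2) = 0 := by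
    linarith [tri_swap₂₃ α (e 0) (f' 0) (f' 2)]
  have K202 : tri α (e 2) (f' 0) (f' 2) = 0 := by
    linarith [tri_swap₂₃ α (e 1) (f' 1) (f' 0), tri_swap₂₃ α (e 2) (f' 2) (f' 0)]
  have K212 : tri α (e 2) (f' 1) (f' 2) = 0 := by
    linarith [tri_swap₂₃ α (e 2) (f' 2) (f' 1)]
  have K2 : ∀ i j k, tri α (e i) (f' j) (f' k) = 0 := by
    intro i j k
    rw [tri_eq_levi]
    fin_cases i <;> simp [K012, K102, K201, K001, K002, K101, K112, K202, K212]
  rw [← h'.quartic_eq, quartic_normalForm H0 K1 K2 (tri_frame_eq_levi α f')]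
  -- If b were zero, the exchanged frame (f', -e) would violate non-vanishing, since α also vanishes
  -- on (e₀, f'₁, f'₂).
  have hb : tri α (f' 0) (f' 1) (f' 2) ≠ 0 := by
    intro hb
    refine hα _ _ h'.swap hb ?_
    simp [K012]
  simp [a0, a1, a2, hb]

end NormalForm

/-! ### Measures invariant under the diagonal group -/

/-- A non-zero measure invariant under a map that translates some real function is infinite. -/
theorem measure_univ_eq_top_of_translates {X : Type*} [MeasurableSpace X] {μ : Measure X}
    {T : X → X} (hT : MeasurePreserving T μ μ) {G : X → ℝ} (hG : Measurable G)
    (h : ∀ x, G (T x) = G x + 1) (hμ : μ ≠ 0) : μ univ = ⊤ := by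
  -- The unit strata of G partition the space, and the preimage of each one under T is the preceding
  -- one. They have equal mass, and an infinite sum of a non-zero constant is infinite.
  set E : ℤ → Set X := fun k => {x | ⌊G x⌋ = k} with hE
  have hm : ∀ k, MeasurableSet (E k) := fun k =>
    (Int.measurable_floor.comp hG) (measurableSet_singleton k)
  have hstep : ∀ k, μ (E (k + 1)) = μ (E k) := by
    intro k
    rw [← hT.measure_preimage (hm (k + 1)).nullMeasurableSet]
    congr 1
    ext x
    simp [hE, h]
  have hconst : ∀ k, μ (E k) = μ (E 0) := by
    intro k
    induction k using Int.induction_on with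
    | zero => rfl
    | succ i hi => rw [hstep, hi]
    | pred i hi => rw [← hi, ← hstep, sub_add_cancel]
  have hU : (⋃ k, E k) = univ := eq_univ_of_forall fun x => mem_iUnion.2 ⟨_, rfl⟩
  have hsum : μ univ = ∑' _ : ℤ, μ (E 0) := by
    rw [← hU, measure_iUnion _ hm]
    · exact tsum_congr hconst
    · intro i j hij
      exact disjoint_left.2 fun x hi hj => hij (hi.symm.trans hj)
  rw [hsum]
  refine ENNReal.tsum_const_eq_top_of_ne_zero fun h0 => hμ ?_
  rw [h0, tsum_zero] at hsum
  exact Measure.measure_univ_eq_zero.1 hsum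

/-! ### The quartic invariant as a function on the moduli space -/

theorem omegaBilin_spLin {n : ℕ} (g : Matrix.symplecticGroup (Fin n) ℤ) (i j : Fin n ⊕ Fin n) :
    omegaBilin n (spLin g (Pi.single i 1)) (spLin g (Pi.single j 1)) =
      omegaBilin n (Pi.single i 1) (Pi.single j 1) := by
  have hmem : g.1.map (Int.cast : ℤ → ℝ) ∈ Matrix.symplecticGroup (Fin n) ℝ :=
    by simpa using SymplecticGroup.map_mem (f := Int.castRingHom ℝ) (A := g.1) g.2
  have h1 := gram_of_mem_symplecticGroup hmem i j
  have h2 := gram_of_mem_symplecticGroup (one_mem (Matrix.symplecticGroup (Fin n) ℝ)) i j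
  have h3 : ∀ j : Fin n ⊕ Fin n, (fun k => (1 : Matrix (Fin n ⊕ Fin n) (Fin n ⊕ Fin n) ℝ) k j) =
      Pi.single j 1 := by
    intro j
    ext k
    simp [Matrix.one_apply, Pi.single_apply]
  have h4 : ∀ j : Fin n ⊕ Fin n, (fun k => g.1.map (Int.cast : ℤ → ℝ) k j) =
      spLin g (Pi.single j 1) := by
    intro j
    rw [spLin, Matrix.toLin'_apply, Matrix.mulVec_single_one]
    rfl
  rw [h3, h3] at h2
  rw [h4, h4] at h1
  rw [h1, h2]

theorem isSympFrame_spLin {n : ℕ} (g : Matrix.symplecticGroup (Fin n) ℤ) :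
    IsSympFrame (fun i => spLin g (ex i)) (fun i => spLin g (ey i)) :=
  ⟨fun i j => (omegaBilin_spLin g _ _).trans (isSympFrame_std.ee i j),
    fun i j => (omegaBilin_spLin g _ _).trans (isSympFrame_std.ff i j),
    fun i j => (omegaBilin_spLin g _ _).trans (isSympFrame_std.ef i j)⟩

theorem tri_compLinearMap {M M' N : Type*} [AddCommGroup M] [Module ℝ M] [AddCommGroup M']
    [Module ℝ M'] [AddCommGroup N] [Module ℝ N] (α : M [⋀^Fin 3]→ₗ[ℝ] N) (L : M' →ₗ[ℝ] M)
    (u v w : M') : tri (α.compLinearMap L) u v w = tri α (L u) (L v) (L w) := by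
  rw [tri_apply, tri_apply, AlternatingMap.compLinearMap_apply]
  congr 1
  ext i : 1
  fin_cases i <;> rfl

/-- Pulling the form back by g amounts to computing its quartic in the frame moved by g, which is
again symplectic. -/
theorem quartic_compLinearMap_spLin {n : ℕ} (α : V n [⋀^Fin 3]→ₗ[ℝ] ℝ)
    (g : Matrix.symplecticGroup (Fin n) ℤ) :
    quartic ex ey (α.compLinearMap (spLin g)) = quartic ex ey α := by
  rw [← (isSympFrame_spLin g).quartic_eq α]
  simp only [quartic, kappa, contr, tri_compLinearMap]

/-- The quartic invariant of the real part, as a function on the moduli space. -/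
def Moduli.quartic : Moduli 3 → ℝ :=
  Quotient.lift (fun Ω : UOne 3 => LagForms.quartic ex ey (rePart (toForm Ω.1))) (by
    rintro Ω Ω' ⟨g, h⟩
    rw [h]
    exact (quartic_compLinearMap_spLin _ g).symm)

theorem Moduli.quartic_ne_zero (y : Moduli 3) : Moduli.quartic y ≠ 0 := by
  induction y using Quotient.inductionOn with
  | h Ω =>
    exact (isNonvanishing_rePart Ω.2.1.1).quartic_ne_zero
      (isContractionFree_rePart (isContractionFree_toForm Ω.1))

theorem continuous_toForm_apply {n : ℕ} (v : Fin n → V n) :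
    Continuous fun Ω : Prim n => toForm Ω v :=
  (continuous_eval_const v : Continuous fun φ : V n [⋀^Fin n]→L[ℝ] ℂ => φ v).comp
    continuous_subtype_val

theorem Moduli.continuous_quartic : Continuous Moduli.quartic := by
  refine Continuous.quotient_lift ?_ _
  have h : ∀ u v w : V 3, Continuous fun Ω : UOne 3 => tri (rePart (toForm Ω.1)) u v w :=
    fun u v w => Complex.continuous_re.comp
      ((continuous_toForm_apply ![u, v, w]).comp continuous_subtype_val)
  simp only [LagForms.quartic, kappa, contr]
  fun_prop

/-- The diagonal element multiplies the real part by eᵗ, and the quartic is homogeneous of degree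
four. -/
theorem Moduli.quartic_act_diagSL (t : ℝ) (y : Moduli 3) :
    Moduli.quartic (Moduli.act (by decide) (diagSL t) y) = Real.exp t ^ 4 * Moduli.quartic y := by
  induction y using Quotient.inductionOn with
  | h Ω =>
    change LagForms.quartic ex ey (rePart (toForm (actPrim (diagSL t).1 Ω.1))) =
      _ * LagForms.quartic ex ey (rePart (toForm Ω.1))
    rw [← quartic_smul]
    congr 1
    ext v
    rw [rePart_apply, toForm_actPrim, LinearMap.compAlternatingMap_apply, cLin_apply]
    simp [diagSL, rePart_apply]

theorem Moduli.measure_univ_eq_top {μ : Measure (Moduli 3)}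
    (h : MeasurePreserving (Moduli.act (n := 3) (by decide) (diagSL 1)) μ μ) (hμ : μ ≠ 0) :
    μ univ = ⊤ := by
  refine measure_univ_eq_top_of_translates h (G := fun y => Real.log |Moduli.quartic y| / 4)
    ?_ (fun y => ?_) hμ
  · exact (Real.measurable_log.comp (Moduli.continuous_quartic.abs.measurable)).div_const 4
  · rw [Moduli.quartic_act_diagSL, abs_mul, Real.log_mul (by positivity)
      (abs_ne_zero.2 (Moduli.quartic_ne_zero y)), abs_of_pos (by positivity), Real.log_pow,
      Real.log_exp]
    push_cast
    ring

/-! ### Topology of `𝒰` and of the hypersurface `𝒰₁⁺` -/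

/-- Orthonormal frames of Lagrangian subspaces. -/
def lagFrames (n : ℕ) : Set (Fin n → V n) :=
  {v | (∀ i j, v i ⬝ᵥ v j = if i = j then 1 else 0) ∧ ∀ i j, omegaFun (v i) (v j) = 0}

theorem isCompact_lagFrames (n : ℕ) : IsCompact (lagFrames n) := by
  have hcl : IsClosed (lagFrames n) := by
    refine IsClosed.inter (s₁ := {v : Fin n → V n | ∀ i j, v i ⬝ᵥ v j = if i = j then 1 else 0})
      (s₂ := {v : Fin n → V n | ∀ i j, omegaFun (v i) (v j) = 0}) ?_ ?_
    · simp only [ofPred_forall]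
      refine isClosed_iInter fun i => isClosed_iInter fun j => isClosed_eq ?_ continuous_const
      simp only [dotProduct]
      fun_prop
    · simp only [ofPred_forall]
      refine isClosed_iInter fun i => isClosed_iInter fun j => isClosed_eq ?_ continuous_const
      simp only [omegaFun]
      fun_prop
  refine Metric.isCompact_of_isClosed_isBounded hcl
    ((Metric.isBounded_closedBall (x := 0) (r := 1)).subset fun v hv => ?_)
  rw [mem_closedBall_zero_iff, pi_norm_le_iff_of_nonneg zero_le_one]
  intro i
  rw [pi_norm_le_iff_of_nonneg zero_le_one]
  intro k
  rw [Real.norm_eq_abs, ← sq_le_one_iff_abs_le_one]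
  have h := hv.1 i i
  rw [if_pos rfl, dotProduct] at h
  rw [← h, sq]
  exact Finset.single_le_sum (f := fun k => v i k * v i k) (fun k _ => mul_self_nonneg _)
    (Finset.mem_univ k)

theorem linearIndependent_of_dotProduct {ι κ : Type*} [Fintype ι] [Fintype κ] [DecidableEq ι]
    {v : ι → κ → ℝ} (hv : ∀ i j, v i ⬝ᵥ v j = if i = j then 1 else 0) :
    LinearIndependent ℝ v := by
  rw [Fintype.linearIndependent_iff]
  intro c hc j
  have h := congrArg (fun w => w ⬝ᵥ v j) hc
  simpa [sum_dotProduct, hv] using h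

theorem exists_mem_lagFrames {n : ℕ} {L : Submodule ℝ (V n)} (hL : IsLagrangian L) :
    ∃ v ∈ lagFrames n, ∀ i, v i ∈ L := by
  -- The function space `V n` carries the sup norm, so the orthonormal basis is taken in the
  -- Euclidean model and transported back.
  let e := (WithLp.linearEquiv 2 ℝ (V n)).symm
  let L' : Submodule ℝ (EuclideanSpace ℝ (Fin n ⊕ Fin n)) := L.map e.toLinearMap
  have hd : Module.finrank ℝ L' = n :=
    (LinearEquiv.finrank_eq (e.submoduleMap L)).symm.trans hL.1
  let b := (stdOrthonormalBasis ℝ L').reindex (finCongr hd)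
  have hmem : ∀ i, e.symm (b i : EuclideanSpace ℝ (Fin n ⊕ Fin n)) ∈ L := by
    intro i
    obtain ⟨x, hx, hx'⟩ := (b i).2
    rw [← hx']
    simpa using hx
  refine ⟨fun i => e.symm (b i : EuclideanSpace ℝ (Fin n ⊕ Fin n)), ⟨fun i j => ?_,
    fun i j => hL.2 _ (hmem i) _ (hmem j)⟩, hmem⟩
  have h := orthonormal_iff_ite.1 b.orthonormal i j
  rw [← h, Submodule.coe_inner, EuclideanSpace.inner_eq_star_dotProduct, dotProduct_comm]
  rfl

theorem mem_U_iff {n : ℕ} (Ω : Prim n) : Ω ∈ U n ↔ ∀ v ∈ lagFrames n, Ω.1 v ≠ 0 := by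
  refine ⟨fun h v hv => apply_ne_zero_of_mem_U h v (linearIndependent_of_dotProduct hv.1) hv.2,
    fun h L hL h0 => ?_⟩
  obtain ⟨v, hv, hvL⟩ := exists_mem_lagFrames hL
  exact h v hv (congrArg (fun f => f fun i => (⟨v i, hvL i⟩ : L)) h0)

/-- Non-vanishing on all Lagrangians can be tested on the compact set of orthonormal Lagrangian
frames, and evaluation is jointly continuous. -/
theorem isOpen_U (n : ℕ) : IsOpen (U n) := by
  rw [isOpen_iff_eventually]
  intro Ω hΩ
  simp only [mem_U_iff] at hΩ ⊢
  refine (isCompact_lagFrames n).eventually_forall_of_forall_eventually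
    (P := fun (Ω : Prim n) v => Ω.1 v ≠ 0) fun v hv => ?_
  have hc : Continuous fun z : Prim n × (Fin n → V n) => z.1.1 z.2 :=
    (continuous_subtype_val.comp continuous_fst).eval continuous_snd
  exact hc.continuousAt.eventually_ne (hΩ v hv)

theorem continuous_loopArea {n : ℕ} [NeZero n] :
    Continuous fun Ω : Prim n => loopArea (toForm Ω) :=
  Complex.continuous_im.comp ((Complex.continuous_conj.comp (continuous_toForm_apply _)).mul
    (continuous_toForm_apply _))

/-- The winding condition becomes a strict polynomial inequality, which makes its openness and its
behaviour under scaling evident. -/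
theorem mem_UPlus_iff {n : ℕ} [NeZero n] (Ω : Prim n) :
    Ω ∈ UPlus n ↔ Ω ∈ U n ∧ 0 < loopArea (toForm Ω) :=
  ⟨fun h => ⟨h.1, loopArea_pos_of_isPositive h.1 h.2⟩,
    fun h => ⟨h.1, isPositive_of_loopArea_pos h.2⟩⟩

theorem isOpen_UPlus (n : ℕ) [NeZero n] : IsOpen (UPlus n) := by
  have : UPlus n = U n ∩ {Ω | 0 < loopArea (toForm Ω)} := ext fun Ω => mem_UPlus_iff Ω
  rw [this]
  exact (isOpen_U n).inter (isOpen_lt continuous_const continuous_loopArea)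

/-- A form of top degree is determined by its value on the standard frame. -/
theorem form_ext_of_stdFrame {n : ℕ} {α β : Form n (n + n)}
    (h : α (stdFrame n) = β (stdFrame n)) : α = β := by
  let b : Module.Basis (Fin (n + n)) ℝ (V n) := (Pi.basisFun ℝ _).reindex finSumFinEquiv
  have hb : ∀ i, b i = stdFrame n i := fun i => by simp [b, stdFrame]
  refine b.ext_alternating fun w hw => ?_
  let σ : Equiv.Perm (Fin (n + n)) := Equiv.ofBijective w (Finite.injective_iff_bijective.1 hw)
  have h1 := α.map_perm (stdFrame n) σ
  have h2 := β.map_perm (stdFrame n) σ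
  have h3 : (fun i => b (w i)) = stdFrame n ∘ σ := funext fun i => hb _
  rw [h3, h1, h2, h]

/-- The ratio of `(-1) ^ (n (n - 1) / 2) (i / 2) ^ n Ω ∧ conj Ω` and `ω ^ n / n!` for `n = 3`. -/
def normRatio (Ω : Prim 3) : ℝ :=
  (toForm Ω ex * (starRingEnd ℂ) (toForm Ω ey) -
    ∑ i, ∑ j, toForm Ω (Function.update ex i (ey j)) *
      (starRingEnd ℂ) (toForm Ω (Function.update ey j (ex i)))).im / 4

/-- When β is the conjugate of α, the second half of `wedge_stdFrame` is the conjugate of the first,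
so the difference is twice an imaginary part. -/
theorem wedge_conj_stdFrame (Ω : Prim 3) :
    wedge (toForm Ω) (conjForm (toForm Ω)) (stdFrame 3) = 8 * normRatio Ω * Complex.I := by
  have h : ∀ v : Fin 3 → V 3, conjForm (toForm Ω) v = (starRingEnd ℂ) (toForm Ω v) := fun v => rfl
  set z := toForm Ω ex * (starRingEnd ℂ) (toForm Ω ey) -
    ∑ i, ∑ j, toForm Ω (Function.update ex i (ey j)) *
      (starRingEnd ℂ) (toForm Ω (Function.update ey j (ex i))) with hz
  have h1 : wedge (toForm Ω) (conjForm (toForm Ω)) (stdFrame 3) = z - (starRingEnd ℂ) z := by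
    rw [wedge_stdFrame, hz]
    simp only [h, map_sub, map_mul, map_sum, Complex.conj_conj, mul_comm]
  rw [h1, Complex.sub_conj, normRatio, ← hz]
  push_cast
  ring

theorem mem_UOne_iff (Ω : Prim 3) : Ω ∈ UOne 3 ↔ Ω ∈ UPlus 3 ∧ normRatio Ω = 1 := by
  refine and_congr_right fun _ => ?_
  -- The prefactor (-1)³(i/2)³ = i/8 turns 8 N i into -N, which matches the value -1 of the volume
  -- form on the frame.
  have hc : ((-1 : ℂ) ^ (3 * (3 - 1) / 2) * (Complex.I / 2) ^ 3) *
      wedge (toForm Ω) (conjForm (toForm Ω)) (stdFrame 3) = -(normRatio Ω : ℂ) := by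
    rw [wedge_conj_stdFrame]
    norm_num
    linear_combination (normRatio Ω : ℂ) * (Complex.I ^ 2 - 1) * Complex.I_sq
  constructor
  · intro h
    have h1 := congrArg (fun β => β (stdFrame 3)) h
    simp only [AlternatingMap.smul_apply, smul_eq_mul, volForm_stdFrame] at h1
    rw [hc, neg_inj] at h1
    exact_mod_cast h1.symm
  · intro h
    apply form_ext_of_stdFrame
    rw [AlternatingMap.smul_apply, smul_eq_mul, volForm_stdFrame, hc, h, Complex.ofReal_one]

theorem continuous_normRatio : Continuous normRatio := by
  have h : ∀ v w : Fin 3 → V 3, Continuous fun Ω : Prim 3 =>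
      toForm Ω v * (starRingEnd ℂ) (toForm Ω w) := fun v w =>
    (continuous_toForm_apply v).mul (Complex.continuous_conj.comp (continuous_toForm_apply w))
  refine (Complex.continuous_im.comp ((h _ _).sub ?_)).div_const 4
  exact continuous_finsetSum _ fun i _ => continuous_finsetSum _ fun j _ => h _ _

theorem normRatio_smul (r : ℝ) (Ω : Prim 3) : normRatio (r • Ω) = r ^ 2 * normRatio Ω := by
  have h : ∀ v : Fin 3 → V 3, toForm (r • Ω) v = r * toForm Ω v := fun v =>
    Complex.real_smul ..
  have h1 : ∀ z w : ℂ, (r * z) * ((r : ℂ) * w) = ((r ^ 2 : ℝ) : ℂ) * (z * w) := by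
    intro z w
    push_cast
    ring
  simp only [normRatio, h, map_mul, Complex.conj_ofReal, h1, ← Finset.mul_sum, ← mul_sub,
    Complex.im_ofReal_mul, mul_div_assoc]

theorem measurableSet_UOne : MeasurableSet (UOne 3) := by
  have : UOne 3 = UPlus 3 ∩ normRatio ⁻¹' {1} := ext fun Ω => mem_UOne_iff Ω
  rw [this]
  exact (isOpen_UPlus 3).measurableSet.inter
    (continuous_normRatio.measurable (measurableSet_singleton 1))

/-- The parametrization of the cone over `𝒰₁⁺`. -/
def coneMap (p : Ioo (0 : ℝ) 1 × UOne 3) : Prim 3 := (p.1 : ℝ) • (p.2 : Prim 3)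

/-- The radius is recovered from the norm ratio, which is homogeneous of degree two and equals 1 on
the hypersurface. -/
theorem injective_coneMap : Function.Injective coneMap := by
  rintro ⟨⟨r, hr⟩, ⟨Ω, hΩ⟩⟩ ⟨⟨s, hs⟩, ⟨Ω', hΩ'⟩⟩ h
  change r • Ω = s • Ω' at h
  have h1 := congrArg normRatio h
  rw [normRatio_smul, normRatio_smul, ((mem_UOne_iff Ω).1 hΩ).2, ((mem_UOne_iff Ω').1 hΩ').2,
    mul_one, mul_one, sq_eq_sq₀ hr.1.le hs.1.le] at h1
  subst h1
  have : Ω = Ω' := smul_right_injective _ hr.1.ne' h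
  subst this
  rfl

/-- An injective Borel map between standard Borel spaces has Borel images (Lusin–Souslin). This is
needed because `Measure.comap` is zero by default for maps without measurable images. -/
theorem measurableEmbedding_coneMap : MeasurableEmbedding coneMap := by
  have := measurableSet_UOne.standardBorel
  have := (measurableSet_Ioo (a := (0 : ℝ)) (b := 1)).standardBorel
  have hc : Continuous coneMap :=
    (continuous_subtype_val.comp continuous_fst).smul (continuous_subtype_val.comp continuous_snd)
  exact hc.measurable.measurableEmbedding injective_coneMap

theorem muOne_apply {A : Set (UOne 3)} (hA : MeasurableSet A) :
    muOne 3 A = Module.finrank ℝ (Prim 3) *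
      liouvilleMeasure (symp 3) (coneMap '' (Prod.snd ⁻¹' A)) := by
  rw [muOne, coneMeasure, Measure.smul_apply, Measure.map_apply measurable_snd hA, smul_eq_mul]
  congr 1
  exact measurableEmbedding_coneMap.comap_apply _ _

/-! ### Invariance of the volume -/

/-- A monoid homomorphism on real `2 × 2` matrices is trivial on matrices of determinant one. -/
theorem monoidHom_eq_one_of_det_eq_one (χ : Matrix (Fin 2) (Fin 2) ℝ →* ℝ)
    {g : Matrix (Fin 2) (Fin 2) ℝ} (hg : g.det = 1) : χ g = 1 := by
  have hu : ∀ c : ℝ, χ !![1, c; 0, 1] = 1 := by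
    intro c
    have h1 : χ !![2, 0; 0, 1] * χ !![1 / 2, 0; 0, 1] = 1 := by
      rw [← map_mul χ, ← map_one χ]
      congr 1
      ext i j
      fin_cases i <;> fin_cases j <;> simp
    -- Conjugation by diag(2, 1) squares a unipotent matrix. The target is commutative, so χ takes a
    -- value equal to its own square.
    have h2 : χ !![2, 0; 0, 1] * χ !![1, c; 0, 1] * χ !![1 / 2, 0; 0, 1] =
        χ !![1, c; 0, 1] * χ !![1, c; 0, 1] := by
      rw [← map_mul χ, ← map_mul χ, ← map_mul χ]
      congr 1
      ext i j
      fin_cases i <;> fin_cases j <;> simp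
      ring
    have h3 : χ !![1, c; 0, 1] * χ !![1, -c; 0, 1] = 1 := by
      rw [← map_mul χ, ← map_one χ]
      congr 1
      ext i j
      fin_cases i <;> fin_cases j <;> simp
    have h4 : χ !![1, c; 0, 1] ≠ 0 := left_ne_zero_of_mul_eq_one h3
    apply mul_left_cancel₀ h4
    linear_combination -h2 + χ !![1, c; 0, 1] * h1
  have hl : ∀ c : ℝ, χ !![1, 0; c, 1] = 1 := by
    intro c
    have h1 : χ !![0, 1; -1, 0] * χ !![0, -1; 1, 0] = 1 := by
      rw [← map_mul χ, ← map_one χ]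
      congr 1
      ext i j
      fin_cases i <;> fin_cases j <;> simp
    have h2 : χ !![1, 0; c, 1] = χ !![0, 1; -1, 0] * χ !![1, -c; 0, 1] * χ !![0, -1; 1, 0] := by
      rw [← map_mul χ, ← map_mul χ]
      congr 1
      ext i j
      fin_cases i <;> fin_cases j <;> simp
    rw [h2, hu, mul_one, h1]
  -- A matrix of determinant one with non-zero lower left entry is a product upper · lower · upper
  -- of unipotents. If that entry is zero, multiplying by a lower unipotent makes it non-zero.
  have key : ∀ g : Matrix (Fin 2) (Fin 2) ℝ, g.det = 1 → g 1 0 ≠ 0 → χ g = 1 := by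
    intro g hg hc
    have h1 : g = !![1, (g 0 0 - 1) / g 1 0; 0, 1] * !![1, 0; g 1 0, 1] *
        !![1, (g 1 1 - 1) / g 1 0; 0, 1] := by
      rw [Matrix.det_fin_two] at hg
      ext i j
      fin_cases i <;> fin_cases j <;> simp <;> field_simp
      · ring
      · linear_combination -hg
      · ring
    rw [h1, map_mul, map_mul, hu, hu, hl]
    norm_num
  by_cases hc : g 1 0 = 0
  · have h1 : χ (!![1, 0; 1, 1] * g) = 1 := by
      apply key
      · rw [Matrix.det_mul, hg]
        simp
      · rw [Matrix.det_fin_two, hc] at hg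
        simp only [Matrix.mul_apply, Fin.sum_univ_two]
        simp [hc]
        rintro h0
        simp [h0] at hg
    rwa [map_mul, hl, one_mul] at h1
  · exact key g hg hc

theorem cLin_one : cLin 1 = LinearMap.id := Matrix.toLin_one _

theorem cLin_mul (g h : Matrix (Fin 2) (Fin 2) ℝ) : cLin (g * h) = cLin g ∘ₗ cLin h :=
  Matrix.toLin_mul _ _ _ g h

/-- The action of a real `2 × 2` matrix on the space of primitive forms, as a linear map. -/
def actLin {n : ℕ} (g : Matrix (Fin 2) (Fin 2) ℝ) : Prim n →ₗ[ℝ] Prim n where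
  toFun := actPrim g
  map_add' Ω Ω' := by
    apply Subtype.ext
    ext v
    exact map_add (cLin g) _ _
  map_smul' r Ω := by
    apply Subtype.ext
    ext v
    exact map_smul (cLin g) _ _

theorem actLin_one {n : ℕ} : actLin (n := n) 1 = LinearMap.id := by
  apply LinearMap.ext
  intro Ω
  apply Subtype.ext
  ext v
  change cLin 1 (Ω.1 v) = Ω.1 v
  rw [cLin_one]
  rfl

theorem actLin_mul {n : ℕ} (g h : Matrix (Fin 2) (Fin 2) ℝ) :
    actLin (n := n) (g * h) = actLin g ∘ₗ actLin h := by
  apply LinearMap.ext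
  intro Ω
  apply Subtype.ext
  ext v
  change cLin (g * h) (Ω.1 v) = cLin g (cLin h (Ω.1 v))
  rw [cLin_mul]
  rfl

theorem actLin_inv_apply {n : ℕ} (g : Matrix.SpecialLinearGroup (Fin 2) ℝ) (Ω : Prim n) :
    actLin (g⁻¹).1 (actLin g.1 Ω) = Ω := by
  rw [← LinearMap.comp_apply, ← actLin_mul]
  change actLin (g⁻¹ * g).1 Ω = Ω
  rw [inv_mul_cancel, Matrix.SpecialLinearGroup.coe_one, actLin_one, LinearMap.id_apply]

/-- The determinant of the action on P is a multiplicative character of 2 × 2 matrices, so it is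
trivial on determinant one, without any computation of the dimension of P. -/
theorem det_actLin {n : ℕ} {g : Matrix (Fin 2) (Fin 2) ℝ} (hg : g.det = 1) :
    LinearMap.det (A := ℝ) (M := Prim n) (actLin g) = 1 :=
  monoidHom_eq_one_of_det_eq_one
    { toFun := fun g => LinearMap.det (A := ℝ) (M := Prim n) (actLin g)
      map_one' := by rw [actLin_one, LinearMap.det_id]
      map_mul' := fun g h => by rw [actLin_mul, LinearMap.det_comp] } hg

theorem liouvilleMeasure_image {E : Type*} [NormedAddCommGroup E] [NormedSpace ℝ E]
    [Module.Finite ℝ E] [MeasurableSpace E] [BorelSpace E] (σ : E → E → ℝ) (T : E →ₗ[ℝ] E)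
    (s : Set E) : liouvilleMeasure σ (T '' s) =
      ENNReal.ofReal |LinearMap.det T| * liouvilleMeasure σ s := by
  rw [liouvilleMeasure, Measure.smul_apply, Measure.smul_apply, Measure.addHaar_image_linearMap,
    smul_eq_mul, smul_eq_mul, mul_left_comm]

theorem UOne.act_inv_act {n : ℕ} [NeZero n] (hn : Odd n) (g : Matrix.SpecialLinearGroup (Fin 2) ℝ)
    (Ω : UOne n) : UOne.act hn g⁻¹ (UOne.act hn g Ω) = Ω :=
  Subtype.ext (actLin_inv_apply g Ω.1)

theorem UOne.continuous_act {n : ℕ} [NeZero n] (hn : Odd n)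
    (g : Matrix.SpecialLinearGroup (Fin 2) ℝ) : Continuous (UOne.act hn g) :=
  ((LinearMap.continuous_of_finiteDimensional (E := Prim n) (F' := Prim n) (actLin g.1)).comp
    continuous_subtype_val).subtype_mk _

theorem Moduli.continuous_act {n : ℕ} [NeZero n] (hn : Odd n)
    (g : Matrix.SpecialLinearGroup (Fin 2) ℝ) : Continuous (Moduli.act hn g) :=
  (continuous_quotient_mk'.comp (UOne.continuous_act hn g)).quotient_lift _

theorem Moduli.act_mk {n : ℕ} [NeZero n] (hn : Odd n) (g : Matrix.SpecialLinearGroup (Fin 2) ℝ)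
    (Ω : UOne n) : Moduli.act hn g (Moduli.mk Ω) = Moduli.mk (UOne.act hn g Ω) := rfl

theorem Moduli.act_inv_act {n : ℕ} [NeZero n] (hn : Odd n)
    (g : Matrix.SpecialLinearGroup (Fin 2) ℝ) (y : Moduli n) :
    Moduli.act hn g⁻¹ (Moduli.act hn g y) = y := by
  induction y using Quotient.inductionOn with
  | h Ω => exact congrArg Moduli.mk (UOne.act_inv_act hn g Ω)

theorem odd_three : Odd 3 := by decide

/-- The action commutes with scaling, so it carries the cone over the preimage of A linearly onto
the cone over A. -/
theorem muOne_preimage_act (g : Matrix.SpecialLinearGroup (Fin 2) ℝ) {A : Set (UOne 3)}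
    (hA : MeasurableSet A) : muOne 3 (UOne.act odd_three g ⁻¹' A) = muOne 3 A := by
  rw [muOne_apply hA, muOne_apply ((UOne.continuous_act odd_three g).measurable hA)]
  have h : coneMap '' (Prod.snd ⁻¹' A) =
      actLin g.1 '' (coneMap '' (Prod.snd ⁻¹' (UOne.act odd_three g ⁻¹' A))) := by
    ext Ω
    constructor
    · rintro ⟨⟨r, Ω₀⟩, h0, rfl⟩
      refine ⟨_, ⟨(r, UOne.act odd_three g⁻¹ Ω₀), ?_, rfl⟩, ?_⟩
      · change UOne.act odd_three g (UOne.act odd_three g⁻¹ Ω₀) ∈ A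
        have := UOne.act_inv_act odd_three g⁻¹ Ω₀
        rw [inv_inv] at this
        rwa [this]
      · change actLin g.1 ((r : ℝ) • actLin (g⁻¹).1 Ω₀.1) = (r : ℝ) • Ω₀.1
        have := actLin_inv_apply g⁻¹ Ω₀.1
        rw [inv_inv] at this
        rw [map_smul, this]
    · rintro ⟨_, ⟨⟨r, Ω₀⟩, h0, rfl⟩, rfl⟩
      refine ⟨(r, UOne.act odd_three g Ω₀), h0, ?_⟩
      exact (map_smul (actLin g.1) (r : ℝ) Ω₀.1).symm
  rw [h, liouvilleMeasure_image, det_actLin g.2, abs_one, ENNReal.ofReal_one, one_mul]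

/-- If F represents the points of B, then its preimage under T represents those of S⁻¹ B and has the
same mass. -/
theorem quotientMeasure_preimage_le {X Y : Type*} [MeasurableSpace X] [MeasurableSpace Y]
    {π : X → Y} (hπ : Measurable π) {m : Measure X} {T : X → X} {S : Y → Y} (hT : Measurable T)
    (hS : Measurable S) (hm : ∀ F, MeasurableSet F → m (T ⁻¹' F) = m F)
    (hTS : ∀ x y, π x = S y → ∃ x', T x' = x ∧ π x' = y) {B : Set Y} (hB : MeasurableSet B) :
    quotientMeasure π hπ m (S ⁻¹' B) ≤ quotientMeasure π hπ m B := by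
  rw [quotientMeasure, toMeasure_apply _ _ hB, toMeasure_apply _ _ (hS hB)]
  refine le_iInf₂ fun F hF => le_iInf fun hBF => ?_
  rw [← hm F hF]
  refine (iInf₂_le (T ⁻¹' F) (hT hF)).trans (iInf_le _ ?_)
  intro y hy
  obtain ⟨x, hx, hxy⟩ := hBF hy
  obtain ⟨x', rfl, rfl⟩ := hTS x y hxy
  exact ⟨x', hx, rfl⟩

theorem Moduli.vol_preimage_act_le (g : Matrix.SpecialLinearGroup (Fin 2) ℝ) {B : Set (Moduli 3)}
    (hB : MeasurableSet B) :
    Moduli.vol 3 (Moduli.act odd_three g ⁻¹' B) ≤ Moduli.vol 3 B := by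
  refine quotientMeasure_preimage_le _ (UOne.continuous_act odd_three g).measurable
    (Moduli.continuous_act odd_three g).measurable (fun F hF => muOne_preimage_act g hF)
    (fun Ω y h => ⟨UOne.act odd_three g⁻¹ Ω, ?_, ?_⟩) hB
  · have := UOne.act_inv_act odd_three g⁻¹ Ω
    rwa [inv_inv] at this
  · rw [← Moduli.act_mk, h, Moduli.act_inv_act]

theorem Moduli.measurePreserving_act (g : Matrix.SpecialLinearGroup (Fin 2) ℝ) :
    MeasurePreserving (Moduli.act odd_three g) (Moduli.vol 3) (Moduli.vol 3) := by
  have hm := (Moduli.continuous_act odd_three g).measurable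
  refine ⟨hm, Measure.ext fun B hB => ?_⟩
  rw [Measure.map_apply hm hB]
  refine le_antisymm (Moduli.vol_preimage_act_le g hB) ?_
  -- The inequality for g⁻¹, applied to the preimage of B, is the reverse inequality for g.
  have h := Moduli.vol_preimage_act_le g⁻¹ (hm hB)
  rw [← preimage_comp] at h
  have h1 : Moduli.act odd_three g ∘ Moduli.act odd_three g⁻¹ = id := by
    funext y
    have := Moduli.act_inv_act odd_three g⁻¹ y
    rwa [inv_inv] at this
  rwa [h1, preimage_id] at h

/-! ### Pullback by integral symplectic matrices -/

theorem omegaFun_spLin {n : ℕ} (g : Matrix.symplecticGroup (Fin n) ℤ) (v w : V n) :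
    omegaFun (spLin g v) (spLin g w) = omegaFun v w := by
  have h : (omegaBilin n).compl₁₂ (spLin g) (spLin g) = omegaBilin n := by
    refine LinearMap.ext_basis (Pi.basisFun ℝ _) (Pi.basisFun ℝ _) fun i j => ?_
    rw [LinearMap.compl₁₂_apply, Pi.basisFun_apply, Pi.basisFun_apply]
    exact omegaBilin_spLin g i j
  exact LinearMap.congr_fun₂ h v w

theorem omega_compLinearMap_spLin {n : ℕ} (g : Matrix.symplecticGroup (Fin n) ℤ) :
    (omega n).compLinearMap (spLin g) = omega n := by
  ext v
  exact congrArg Complex.ofReal (omegaFun_spLin g (v 0) (v 1))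

theorem wedge_compLinearMap {n p q : ℕ} (α : Form n p) (β : Form n q) (L : V n →ₗ[ℝ] V n) :
    wedge (α.compLinearMap L) (β.compLinearMap L) = (wedge α β).compLinearMap L := by
  ext v
  have hc : ((p.factorial * q.factorial : ℕ) : ℂ) ≠ 0 := by
    exact_mod_cast (Nat.mul_pos (Nat.factorial_pos _) (Nat.factorial_pos _)).ne'
  apply mul_left_cancel₀ hc
  rw [AlternatingMap.compLinearMap_apply, wedge_apply, wedge_apply]
  rfl

/-- Pullback of primitive forms by an integral symplectic matrix. -/
def pullPrim {n : ℕ} (g : Matrix.symplecticGroup (Fin n) ℤ) : Prim n →ₗ[ℝ] Prim n where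
  toFun Ω := ⟨Ω.1.compContinuousLinearMap (LinearMap.toContinuousLinearMap (spLin g)), by
    change wedge ((toForm Ω).compLinearMap (spLin g)) (omega n) = 0
    rw [← omega_compLinearMap_spLin g, wedge_compLinearMap,
      show wedge (toForm Ω) (omega n) = 0 from Ω.2]
    rfl⟩
  map_add' _ _ := rfl
  map_smul' _ _ := rfl

theorem toForm_pullPrim {n : ℕ} (g : Matrix.symplecticGroup (Fin n) ℤ) (Ω : Prim n) :
    toForm (pullPrim g Ω) = (toForm Ω).compLinearMap (spLin g) := rfl

theorem toForm_injective {n : ℕ} : Function.Injective (toForm (n := n)) := by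
  intro Ω Ω' h
  apply Subtype.ext
  exact ContinuousAlternatingMap.toAlternatingMap_injective h

theorem countable_symplecticGroup (n : ℕ) : Countable (Matrix.symplecticGroup (Fin n) ℤ) := by
  have : Countable (Matrix (Fin n ⊕ Fin n) (Fin n ⊕ Fin n) ℤ) :=
    inferInstanceAs (Countable (Fin n ⊕ Fin n → Fin n ⊕ Fin n → ℤ))
  exact Subtype.countable

theorem pullPrim_mul_apply {n : ℕ} (g h : Matrix.symplecticGroup (Fin n) ℤ) (Ω : Prim n) :
    pullPrim (g * h) Ω = pullPrim h (pullPrim g Ω) := by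
  apply toForm_injective
  rw [toForm_pullPrim, toForm_pullPrim, toForm_pullPrim, spLin_mul,
    AlternatingMap.compLinearMap_assoc]

theorem omegaPow_compLinearMap_spLin {n : ℕ} (g : Matrix.symplecticGroup (Fin n) ℤ) (k : ℕ) :
    (omegaPow n k).compLinearMap (spLin g) = omegaPow n k := by
  induction k with
  | zero => rfl
  | succ k ih =>
    rw [omegaPow_succ, ← wedge_compLinearMap, ih, omega_compLinearMap_spLin]

theorem volForm_compLinearMap_spLin {n : ℕ} (g : Matrix.symplecticGroup (Fin n) ℤ) :
    (volForm n).compLinearMap (spLin g) = volForm n := by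
  ext v
  rw [AlternatingMap.compLinearMap_apply, volForm_apply, volForm_apply]
  congr 1
  exact congrArg (fun β => β fun i => v (finCongr (two_mul n) i))
    (omegaPow_compLinearMap_spLin g n)

/-- Forms of top degree are multiples of ωⁿ / n!, which symplectic maps preserve. -/
theorem compLinearMap_spLin_stdFrame {n : ℕ} (hn : volForm n (stdFrame n) ≠ 0)
    (g : Matrix.symplecticGroup (Fin n) ℤ) (η : Form n (n + n)) :
    η.compLinearMap (spLin g) (stdFrame n) = η (stdFrame n) := by
  have h : η = (η (stdFrame n) / volForm n (stdFrame n)) • volForm n := by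
    refine form_ext_of_stdFrame ?_
    rw [AlternatingMap.smul_apply, smul_eq_mul, div_mul_cancel₀ _ hn]
  generalize η (stdFrame n) / volForm n (stdFrame n) = c at h
  have h1 : (c • volForm n).compLinearMap (spLin g) = c • (volForm n).compLinearMap (spLin g) :=
    rfl
  rw [h, h1, volForm_compLinearMap_spLin]

theorem wedge_compLinearMap_spLin_stdFrame {n : ℕ} (hn : volForm n (stdFrame n) ≠ 0)
    (g : Matrix.symplecticGroup (Fin n) ℤ) (α β : Form n n) :
    wedge (α.compLinearMap (spLin g)) (β.compLinearMap (spLin g)) (stdFrame n) =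
      wedge α β (stdFrame n) := by
  rw [wedge_compLinearMap, compLinearMap_spLin_stdFrame hn]

theorem volForm_stdFrame_ne_zero : volForm 3 (stdFrame 3) ≠ 0 := by
  rw [volForm_stdFrame]
  norm_num

theorem symp_pullPrim {n : ℕ} (hn : volForm n (stdFrame n) ≠ 0)
    (g : Matrix.symplecticGroup (Fin n) ℤ) (Ω Ω' : Prim n) :
    symp n (pullPrim g Ω) (pullPrim g Ω') = symp n Ω Ω' := by
  rw [symp, toForm_pullPrim, toForm_pullPrim, wedge_compLinearMap_spLin_stdFrame hn]
  rfl

theorem wedge_conj_pullPrim {n : ℕ} (hn : volForm n (stdFrame n) ≠ 0)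
    (g : Matrix.symplecticGroup (Fin n) ℤ) (Ω : Prim n) :
    wedge (toForm (pullPrim g Ω)) (conjForm (toForm (pullPrim g Ω))) (stdFrame n) =
      wedge (toForm Ω) (conjForm (toForm Ω)) (stdFrame n) :=
  wedge_compLinearMap_spLin_stdFrame hn g (toForm Ω) (conjForm (toForm Ω))

theorem normRatio_pullPrim (g : Matrix.symplecticGroup (Fin 3) ℤ) (Ω : Prim 3) :
    normRatio (pullPrim g Ω) = normRatio Ω := by
  have h := wedge_conj_pullPrim volForm_stdFrame_ne_zero g Ω
  rw [wedge_conj_stdFrame, wedge_conj_stdFrame] at h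
  have h2 := congrArg Complex.im h
  simpa using h2

/-! ### Non-degeneracy of the symplectic form on primitive forms -/

theorem wedge_add_right {n p q : ℕ} (α : Form n p) (β β' : Form n q) :
    wedge α (β + β') = wedge α β + wedge α β' := by
  ext v
  simp only [wedge, ← AlternatingMap.domCoprod'_apply, TensorProduct.tmul_add, map_add]
  simp

theorem wedge_smul_right {n p q : ℕ} (c : ℝ) (α : Form n p) (β : Form n q) :
    wedge α (c • β) = c • wedge α β := by
  ext v
  simp only [wedge, ← AlternatingMap.domCoprod'_apply, TensorProduct.tmul_smul, map_smul]
  simp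

theorem symp_eq (Ω Ω' : Prim 3) :
    symp 3 Ω Ω' = -(wedge (toForm Ω) (toForm Ω') (stdFrame 3)).im := by
  rw [symp, volForm_stdFrame, div_neg, div_one, Complex.neg_im]

/-- The symplectic form on primitive forms as a bilinear map. -/
def sympBilin (n : ℕ) : Prim n →ₗ[ℝ] Prim n →ₗ[ℝ] ℝ :=
  LinearMap.mk₂ ℝ (symp n)
    (fun Ω₁ Ω₂ Ω' => by
      have : toForm (Ω₁ + Ω₂) = toForm Ω₁ + toForm Ω₂ := rfl
      simp only [symp, this, wedge_add_left, AlternatingMap.add_apply, add_div, Complex.add_im])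
    (fun c Ω Ω' => by
      have : toForm (c • Ω) = c • toForm Ω := rfl
      simp only [symp, this, wedge_smul_left, AlternatingMap.smul_apply, smul_div_assoc,
        Complex.smul_im])
    (fun Ω Ω₁ Ω₂ => by
      have : toForm (Ω₁ + Ω₂) = toForm Ω₁ + toForm Ω₂ := rfl
      simp only [symp, this, wedge_add_right, AlternatingMap.add_apply, add_div, Complex.add_im])
    (fun c Ω Ω' => by
      have : toForm (c • Ω') = c • toForm Ω' := rfl
      simp only [symp, this, wedge_smul_right, AlternatingMap.smul_apply, smul_div_assoc,
        Complex.smul_im])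

theorem update_fin_three {M : Type*} (e : Fin 3 → M) (v : M) :
    Function.update e 0 v = ![v, e 1, e 2] ∧ Function.update e 1 v = ![e 0, v, e 2] ∧
      Function.update e 2 v = ![e 0, e 1, v] := by
  refine ⟨?_, ?_, ?_⟩ <;> ext i <;> fin_cases i <;> rfl

section Symmetric

variable {N : Type*} [AddCommGroup N] [Module ℝ N] {α : V 3 [⋀^Fin 3]→ₗ[ℝ] N}

/-- For i, j, k distinct, the contraction against eₖ is, up to sign, the difference of the (i, j)
and (j, i) entries. -/
theorem IsContractionFree.update_symm (hα : IsContractionFree α) {e f : Fin 3 → V 3}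
    (h : IsSympFrame e f) (i j : Fin 3) :
    α (Function.update e i (f j)) = α (Function.update e j (f i)) := by
  have h0 := hα e f h (e 0)
  have h1 := hα e f h (e 1)
  have h2 := hα e f h (e 2)
  simp only [Fin.sum_univ_three, tri_self₁₃, zero_add, add_zero] at h0 h1 h2
  have e01 : α (Function.update e 0 (f 1)) = α (Function.update e 1 (f 0)) := by
    rw [(update_fin_three e _).1, (update_fin_three e _).2.1, ← tri_apply, ← tri_apply, tri_swap₁₂,
      eq_comm]
    exact eq_neg_of_add_eq_zero_left h2
  have e02 : α (Function.update e 0 (f 2)) = α (Function.update e 2 (f 0)) := by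
    rw [(update_fin_three e _).1, (update_fin_three e _).2.2, ← tri_apply, ← tri_apply,
      tri_swap₂₃ α (e 0), ← tri_rotate α (e 2)]
    exact eq_neg_of_add_eq_zero_right h1
  have e12 : α (Function.update e 1 (f 2)) = α (Function.update e 2 (f 1)) := by
    rw [(update_fin_three e _).2.1, (update_fin_three e _).2.2, ← tri_apply, ← tri_apply,
      tri_rotate α (e 0) (e 1), tri_swap₂₃ α (e 0), tri_rotate α (e 0)]
    exact (eq_neg_of_add_eq_zero_left h0).symm
  fin_cases i <;> fin_cases j <;> simp [e01, e02, e12]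

theorem tri_eq_zero_of_pairs {u : V 3} {e : Fin 3 → V 3} (h : ∀ i, α (Function.update e i u) = 0)
    (j k : Fin 3) : tri α u (e j) (e k) = 0 := by
  have h0 := h 0
  have h1 := h 1
  have h2 := h 2
  rw [(update_fin_three e _).1, ← tri_apply] at h0
  rw [(update_fin_three e _).2.1, ← tri_apply, tri_swap₁₂, neg_eq_zero] at h1
  rw [(update_fin_three e _).2.2, ← tri_apply, tri_rotate, tri_rotate] at h2
  have h0' := tri_swap₂₃ α u (e 2) (e 1)
  have h1' := tri_swap₂₃ α u (e 2) (e 0)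
  have h2' := tri_swap₂₃ α u (e 1) (e 0)
  fin_cases j <;> fin_cases k <;> simp [h0, h1, h2, h0', h1', h2', tri_self₂₃]

theorem tri_eq_zero_of_frame {e : Fin 3 → V 3} (h : α e = 0) (i j k : Fin 3) :
    tri α (e i) (e j) (e k) = 0 := by
  refine tri_eq_zero_of_pairs (fun l => ?_) j k
  by_cases hl : l = i
  · rw [hl, Function.update_eq_self, h]
  · exact α.map_update_self e hl

theorem eq_zero_of_tri (h : ∀ i j k, tri α (Pi.single i 1) (Pi.single j 1) (Pi.single k 1) = 0) :
    α = 0 := by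
  refine (Pi.basisFun ℝ _).ext_alternating fun w _ => ?_
  have : (fun i => Pi.basisFun ℝ (Fin 3 ⊕ Fin 3) (w i)) =
      ![Pi.single (w 0) 1, Pi.single (w 1) 1, Pi.single (w 2) 1] := by
    ext i : 1
    fin_cases i <;> simp
  rw [this, ← tri_apply, h, AlternatingMap.zero_apply]

theorem eq_zero_of_std (h0 : α ex = 0) (h1 : ∀ i j, α (Function.update ex i (ey j)) = 0)
    (h2 : ∀ i j, α (Function.update ey i (ex j)) = 0) (h3 : α ey = 0) : α = 0 := by
  have t0 := tri_eq_zero_of_frame h0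
  have t1 : ∀ i j k, tri α (ey i) (ex j) (ex k) = 0 := fun i =>
    tri_eq_zero_of_pairs fun l => h1 l i
  have t2 : ∀ i j k, tri α (ex i) (ey j) (ey k) = 0 := fun i =>
    tri_eq_zero_of_pairs fun l => h2 l i
  have t3 := tri_eq_zero_of_frame h3
  have t1' : ∀ i j k, tri α (ex i) (ey j) (ex k) = 0 := fun i j k => by
    rw [tri_swap₁₂, t1, neg_zero]
  have t1'' : ∀ i j k, tri α (ex i) (ex j) (ey k) = 0 := fun i j k => by
    rw [tri_rotate, tri_rotate, t1]
  have t2' : ∀ i j k, tri α (ey i) (ex j) (ey k) = 0 := fun i j k => by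
    rw [tri_swap₁₂, t2, neg_zero]
  have t2'' : ∀ i j k, tri α (ey i) (ey j) (ex k) = 0 := fun i j k => by
    rw [tri_rotate, tri_rotate, t2]
  refine eq_zero_of_tri fun i j k => ?_
  rcases i with i | i <;> rcases j with j | j <;> rcases k with k | k
  exacts [t0 i j k, t1'' i j k, t1' i j k, t2 i j k, t1 i j k, t2' i j k, t2'' i j k, t3 i j k]

end Symmetric

theorem spLin_symJ_ex {n : ℕ} (i : Fin n) :
    spLin (SymplecticGroup.symJ (Fin n) ℤ) (ex i) = ey i := by
  rw [spLin, Matrix.toLin'_apply, ex, Matrix.mulVec_single_one, SymplecticGroup.coe_J]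
  ext (k | k) <;> simp [Matrix.J, ey, Matrix.col, Matrix.one_apply, Pi.single_apply]

theorem spLin_symJ_ey {n : ℕ} (i : Fin n) :
    spLin (SymplecticGroup.symJ (Fin n) ℤ) (ey i) = -ex i := by
  rw [spLin, Matrix.toLin'_apply, ey, Matrix.mulVec_single_one, SymplecticGroup.coe_J]
  ext (k | k) <;> simp [Matrix.J, ex, Matrix.col, Matrix.one_apply, Pi.single_apply]

/-- The witness is the pullback of Ω by the complex structure J, composed with the exchange c of
real and imaginary parts. Since Im (c(z) z) = |z|², the pairing is minus a sum of squares of all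
values of Ω on the frames involved, and these values determine Ω. -/
theorem exists_symp_ne_zero {Ω : Prim 3} (hΩ : Ω ≠ 0) : ∃ Ω' : Prim 3, symp 3 Ω' Ω ≠ 0 := by
  set α := toForm Ω with hα
  set c := cLin !![0, 1; 1, 0] with hc
  have hcz : ∀ z, (c z * z).im = Complex.normSq z := by
    intro z
    rw [hc, cLin_apply, Complex.normSq_apply]
    simp
    ring
  set Ω' := actPrim !![0, 1; 1, 0] (pullPrim (SymplecticGroup.symJ (Fin 3) ℤ) Ω) with hΩ'
  have happ : ∀ v, toForm Ω' v = c (α fun i => spLin (SymplecticGroup.symJ (Fin 3) ℤ) (v i)) :=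
    fun v => rfl
  have hneg : ∀ (s : Fin 3 → ℝ) (v : Fin 3 → V 3), α (fun i => s i • v i) = (∏ i, s i) • α v :=
    fun s v => α.toMultilinearMap.map_smul_univ s v
  have v0 : toForm Ω' ex = c (α ey) := by
    rw [happ]
    simp only [spLin_symJ_ex]
  have v3 : toForm Ω' ey = -c (α ex) := by
    rw [happ, ← map_neg]
    simp only [spLin_symJ_ey]
    congr 1
    have h := hneg (fun _ => -1) ex
    simp only [neg_one_smul, Fin.prod_univ_three] at h
    rw [h]
    simp
  have hA := (isContractionFree_toForm Ω).update_symm isSympFrame_std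
  have hB : ∀ i j, α (Function.update ey i (-ex j)) = -α (Function.update ey j (ex i)) := by
    intro i j
    rw [(isContractionFree_toForm Ω).update_symm isSympFrame_std.swap i j, ← neg_one_smul ℝ,
      AlternatingMap.map_update_smul, neg_one_smul]
  have v1 : ∀ i j, toForm Ω' (Function.update ex i (ey j)) =
      -c (α (Function.update ey j (ex i))) := by
    intro i j
    rw [happ, ← map_neg, ← hB]
    congr 2
    funext k
    by_cases hk : k = i
    · subst hk
      simp [spLin_symJ_ey]
    · simp [hk, spLin_symJ_ex]
  have v2 : ∀ i j, toForm Ω' (Function.update ey j (ex i)) =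
      c (α (Function.update ex i (ey j))) := by
    intro i j
    rw [happ, hA i j]
    congr 1
    have h1 := hneg (fun k => if k = j then 1 else -1) (Function.update ex j (ey i))
    have h2 : ∏ k : Fin 3, (if k = j then (1 : ℝ) else -1) = 1 := by
      rw [Fin.prod_univ_three]
      fin_cases j <;> simp
    rw [h2, one_smul] at h1
    rw [← h1]
    congr 1
    funext k
    by_cases hk : k = j
    · subst hk
      simp [spLin_symJ_ex]
    · simp [hk, spLin_symJ_ey]
  refine ⟨Ω', fun h => hΩ (toForm_injective ?_)⟩
  rw [symp_eq, neg_eq_zero, wedge_stdFrame, v0, v3] at h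
  simp only [v1, v2, neg_mul, Finset.sum_neg_distrib, sub_neg_eq_add, Complex.sub_im,
    Complex.add_im, Complex.neg_im, Complex.im_sum, hcz, ← hα] at h
  have n1 : 0 ≤ ∑ i : Fin 3, ∑ j : Fin 3,
      Complex.normSq (α (Function.update ey j (ex i))) :=
    Finset.sum_nonneg fun i _ => Finset.sum_nonneg fun j _ => Complex.normSq_nonneg _
  have n2 : 0 ≤ ∑ i : Fin 3, ∑ j : Fin 3,
      Complex.normSq (α (Function.update ex i (ey j))) :=
    Finset.sum_nonneg fun i _ => Finset.sum_nonneg fun j _ => Complex.normSq_nonneg _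
  have n0 := Complex.normSq_nonneg (α ex)
  have n3 := Complex.normSq_nonneg (α ey)
  have z : ∀ F : Fin 3 → Fin 3 → ℂ, ∑ i, ∑ j, Complex.normSq (F i j) = 0 → ∀ i j, F i j = 0 := by
    intro F hF i j
    rw [Finset.sum_eq_zero_iff_of_nonneg fun i _ =>
      Finset.sum_nonneg fun j _ => Complex.normSq_nonneg _] at hF
    have := hF i (Finset.mem_univ i)
    rw [Finset.sum_eq_zero_iff_of_nonneg fun j _ => Complex.normSq_nonneg _] at this
    exact Complex.normSq_eq_zero.1 (this j (Finset.mem_univ j))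
  exact eq_zero_of_std (Complex.normSq_eq_zero.1 (by linarith))
    (z (fun i j => α (Function.update ex i (ey j))) (by linarith))
    (fun i j => z (fun i j => α (Function.update ey j (ex i))) (by linarith) j i)
    (Complex.normSq_eq_zero.1 (by linarith))

section Nondegenerate

variable {E : Type*} [NormedAddCommGroup E] [NormedSpace ℝ E]
  {B : E →ₗ[ℝ] E →ₗ[ℝ] ℝ}

theorem det_toMatrix₂_ne_zero (hB : ∀ x, x ≠ 0 → ∃ y, B y x ≠ 0) {ι : Type*} [Fintype ι]
    [DecidableEq ι] (b : Module.Basis ι ℝ E) : (LinearMap.toMatrix₂ b b B).det ≠ 0 := by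
  intro h
  obtain ⟨c, hc, hc'⟩ := Matrix.exists_mulVec_eq_zero_iff.2 h
  have h0 : ∑ j, c j • b j ≠ 0 := fun h0 =>
    hc (funext (Fintype.linearIndependent_iff.1 b.linearIndependent c h0))
  obtain ⟨y, hy⟩ := hB _ h0
  apply hy
  have h1 : B.flip (∑ j, c j • b j) = 0 := by
    refine b.ext fun i => ?_
    rw [LinearMap.flip_apply, map_sum, LinearMap.zero_apply]
    have := congrFun hc' i
    simp only [Matrix.mulVec, dotProduct, LinearMap.toMatrix₂_apply, Pi.zero_apply] at this
    rw [← this]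
    refine Finset.sum_congr rfl fun j _ => ?_
    rw [map_smul, smul_eq_mul, mul_comm]
  rw [← LinearMap.flip_apply, h1, LinearMap.zero_apply]

/-- Taking determinants in TᵗBT = B gives (det T)² = 1, as the Gram determinant of B is non-zero. -/
theorem abs_det_eq_one_of_isometry [Module.Finite ℝ E] (hB : ∀ x, x ≠ 0 → ∃ y, B y x ≠ 0)
    {T : E →ₗ[ℝ] E} (hT : ∀ x y, B (T x) (T y) = B x y) : |LinearMap.det T| = 1 := by
  set b := Module.finBasis ℝ E
  have h : B.compl₁₂ T T = B := by
    ext x y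
    exact hT x y
  have h1 := congrArg Matrix.det (LinearMap.toMatrix₂_compl₁₂ b b b b B T T)
  rw [h, Matrix.det_mul, Matrix.det_mul, Matrix.det_transpose, LinearMap.det_toMatrix, mul_comm,
    ← mul_assoc] at h1
  have h2 : LinearMap.det T * LinearMap.det T = 1 := by
    apply mul_right_cancel₀ (det_toMatrix₂_ne_zero hB b)
    rw [one_mul]
    exact h1.symm
  rcases mul_self_eq_one_iff.1 h2 with h3 | h3 <;> simp [h3]

theorem liouvilleMeasure_pos_of_isOpen [Module.Finite ℝ E] [MeasurableSpace E] [BorelSpace E]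
    {σ : E → E → ℝ} (hσ : ∀ x y, B x y = σ x y) (hB : ∀ x, x ≠ 0 → ∃ y, σ y x ≠ 0)
    {W : Set E} (hW : IsOpen W) (hne : W.Nonempty) : 0 < liouvilleMeasure σ W := by
  have h0 := det_toMatrix₂_ne_zero (B := B) (fun x hx => by simpa only [hσ] using hB x hx)
    (Module.finBasis ℝ E)
  have h1 : (Matrix.of fun i j => σ (Module.finBasis ℝ E i) (Module.finBasis ℝ E j)) =
      LinearMap.toMatrix₂ (Module.finBasis ℝ E) (Module.finBasis ℝ E) B := by
    ext i j
    rw [LinearMap.toMatrix₂_apply, Matrix.of_apply, hσ]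
  rw [liouvilleMeasure, h1, Measure.smul_apply, smul_eq_mul]
  refine ENNReal.mul_pos ?_ (hW.measure_pos _ hne).ne'
  rw [Ne, ENNReal.ofReal_eq_zero, not_le]
  exact Real.sqrt_pos.2 (abs_pos.2 h0)

end Nondegenerate

theorem abs_det_pullPrim_of_nondegenerate {n : ℕ} (hn : volForm n (stdFrame n) ≠ 0)
    (h : ∀ Ω : Prim n, Ω ≠ 0 → ∃ Ω' : Prim n, symp n Ω' Ω ≠ 0)
    (g : Matrix.symplecticGroup (Fin n) ℤ) :
    |LinearMap.det (A := ℝ) (M := Prim n) (pullPrim g)| = 1 :=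
  abs_det_eq_one_of_isometry (E := Prim n) (B := sympBilin n) h (symp_pullPrim hn g)

theorem liouvilleMeasure_symp_pos_of_nondegenerate {n : ℕ}
    (h : ∀ Ω : Prim n, Ω ≠ 0 → ∃ Ω' : Prim n, symp n Ω' Ω ≠ 0) {W : Set (Prim n)}
    (hW : IsOpen W) (hne : W.Nonempty) : 0 < liouvilleMeasure (symp n) W := by
  have hs : ∀ Ω Ω', sympBilin n Ω Ω' = symp n Ω Ω' := fun _ _ => rfl
  exact liouvilleMeasure_pos_of_isOpen (E := Prim n) (B := sympBilin n) hs h hW hne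

theorem abs_det_pullPrim (g : Matrix.symplecticGroup (Fin 3) ℤ) :
    |LinearMap.det (A := ℝ) (M := Prim 3) (pullPrim g)| = 1 :=
  abs_det_pullPrim_of_nondegenerate volForm_stdFrame_ne_zero (fun _ => exists_symp_ne_zero) g

theorem liouvilleMeasure_symp_pos {W : Set (Prim 3)} (hW : IsOpen W) (hne : W.Nonempty) :
    0 < liouvilleMeasure (symp 3) W :=
  liouvilleMeasure_symp_pos_of_nondegenerate (fun _ => exists_symp_ne_zero) hW hne

/-! ### The form `i dz₁ ∧ dz₂ ∧ dz₃` -/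

/-- The complex coordinates `z = x + i y` of a vector. -/
def cvec : V 3 →ₗ[ℝ] (Fin 3 → ℂ) where
  toFun v i := v (Sum.inl i) + v (Sum.inr i) * Complex.I
  map_add' v w := by
    ext i
    simp only [Pi.add_apply]
    push_cast
    ring
  map_smul' r v := by
    ext i
    simp only [Pi.smul_apply, smul_eq_mul, Complex.real_smul, RingHom.id_apply]
    push_cast
    ring

theorem cvec_apply (v : V 3) (i : Fin 3) :
    cvec v i = v (Sum.inl i) + v (Sum.inr i) * Complex.I := rfl

theorem cvec_ex (i : Fin 3) : cvec (ex i) = Pi.single i 1 := by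
  ext j
  simp [cvec_apply, ex, Pi.single_apply, apply_ite Complex.ofReal]

theorem cvec_ey (i : Fin 3) : cvec (ey i) = Complex.I • cvec (ex i) := by
  ext j
  simp [cvec_apply, ex, ey, Pi.single_apply, apply_ite Complex.ofReal]

/-- The complex determinant as a real alternating form. -/
def complexDet : (Fin 3 → ℂ) [⋀^Fin 3]→ₗ[ℝ] ℂ :=
  { (Matrix.detRowAlternating (R := ℂ) (n := Fin 3)).toMultilinearMap.restrictScalars ℝ with
    map_eq_zero_of_eq' := fun v _ _ h hij =>
      (Matrix.detRowAlternating (R := ℂ) (n := Fin 3)).map_eq_zero_of_eq v h hij }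

/-- The form `i dz₁ ∧ dz₂ ∧ dz₃`. -/
def baseForm : Form 3 3 := (Complex.I • complexDet).compLinearMap cvec

theorem baseForm_apply (v : Fin 3 → V 3) :
    baseForm v = Complex.I * (Matrix.of fun i => cvec (v i)).det := rfl

theorem ofReal_omegaFun (v w : V 3) : (omegaFun v w : ℂ) =
    Complex.I / 2 * ∑ i, (cvec v i * (starRingEnd ℂ) (cvec w i) -
      (starRingEnd ℂ) (cvec v i) * cvec w i) := by
  rw [omegaFun, Complex.ofReal_sum, Finset.mul_sum]
  refine Finset.sum_congr rfl fun i _ => ?_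
  simp only [cvec_apply, map_add, map_mul, Complex.conj_ofReal, Complex.conj_I]
  push_cast
  linear_combination (v (Sum.inl i) * w (Sum.inr i) - v (Sum.inr i) * w (Sum.inl i) : ℂ) *
    Complex.I_sq

/-- Since ω is of type (1, 1), the product would be of type (4, 1), and there are no such forms on
`ℂ³`. -/
theorem wedge_baseForm_omega : wedge baseForm (omega 3) = 0 := by
  ext v
  rw [wedge_omega_apply]
  simp only [ofReal_omegaFun, baseForm_apply, Matrix.det_fin_three, Matrix.of_apply,
    Fin.sum_univ_three, Matrix.cons_val, AlternatingMap.zero_apply]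
  ring

/-- The form `i dz₁ ∧ dz₂ ∧ dz₃` as a primitive form. -/
def basePoint : Prim 3 :=
  ⟨{ baseForm with
      cont := by
        change Continuous fun v : Fin 3 → V 3 =>
          Complex.I * (Matrix.of fun i => cvec (v i)).det
        refine continuous_const.mul (Continuous.matrix_det ?_)
        refine continuous_pi fun i => continuous_pi fun j => ?_
        change Continuous fun v : Fin 3 → V 3 =>
          ((v i (Sum.inl j) : ℝ) : ℂ) + (v i (Sum.inr j) : ℝ) * Complex.I
        fun_prop }, wedge_baseForm_omega⟩

theorem toForm_basePoint : toForm basePoint = baseForm := rfl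

theorem basePoint_mem_U : basePoint ∈ U 3 := by
  rw [mem_U_iff]
  intro v hv h0
  change baseForm v = 0 at h0
  rw [baseForm_apply, mul_eq_zero] at h0
  -- An orthonormal Lagrangian frame is a unitary matrix: the Hermitian product has real part the
  -- dot product and imaginary part -ω, so the complex determinant cannot vanish.
  have hM : (Matrix.of fun i => cvec (v i)) * (Matrix.of fun i => cvec (v i)).conjTranspose = 1 := by
    ext i j
    rw [Matrix.mul_apply, Matrix.one_apply]
    have h1 := hv.1 i j
    have h2 := hv.2 i j
    rw [dotProduct, Fintype.sum_sum_type] at h1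
    rw [omegaFun] at h2
    apply Complex.ext
    · simp only [Matrix.conjTranspose_apply, Matrix.of_apply, cvec_apply, Complex.re_sum]
      trans (if i = j then (1 : ℝ) else 0)
      · rw [← h1, ← Finset.sum_add_distrib]
        refine Finset.sum_congr rfl fun k _ => ?_
        simp
      · split_ifs <;> simp
    · simp only [Matrix.conjTranspose_apply, Matrix.of_apply, cvec_apply, Complex.im_sum]
      trans (0 : ℝ)
      · rw [← neg_zero, ← h2, ← Finset.sum_neg_distrib]
        refine Finset.sum_congr rfl fun k _ => ?_
        simp
        ring
      · split_ifs <;> simp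
  have := congrArg Matrix.det hM
  rw [Matrix.det_mul, h0.resolve_left Complex.I_ne_zero, zero_mul, Matrix.det_one] at this
  exact zero_ne_one this

theorem baseForm_ex : baseForm ex = Complex.I := by
  have : (Matrix.of fun i : Fin 3 => cvec (ex i)) = 1 := by
    ext i j
    rw [Matrix.of_apply, cvec_ex, Matrix.one_apply, Pi.single_apply]
    simp [eq_comm]
  rw [baseForm_apply, this, Matrix.det_one, mul_one]

theorem baseForm_ey : baseForm ey = 1 := by
  have : (Matrix.of fun i : Fin 3 => cvec (ey i)) =
      Complex.I • (1 : Matrix (Fin 3) (Fin 3) ℂ) := by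
    ext i j
    rw [Matrix.of_apply, cvec_ey, cvec_ex, Matrix.smul_apply, Matrix.one_apply, Pi.smul_apply,
      Pi.single_apply]
    simp [eq_comm]
  rw [baseForm_apply, this, Matrix.det_smul, Matrix.det_one, mul_one, Fintype.card_fin, ← pow_succ',
    Complex.I_pow_four]

theorem baseForm_update_smul (e : Fin 3 → V 3) {u u' : V 3} {c : ℂ} (h : cvec u = c • cvec u')
    (i : Fin 3) :
    baseForm (Function.update e i u) = c * baseForm (Function.update e i u') := by
  have h1 : ∀ w, (Matrix.of fun j => cvec (Function.update e i w j)) =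
      Matrix.updateRow (Matrix.of fun j => cvec (e j)) i (cvec w) := by
    intro w
    ext j k
    by_cases hj : j = i
    · subst hj
      simp
    · simp [hj]
  rw [baseForm_apply, baseForm_apply, h1, h1, h, Matrix.det_updateRow_smul]
  ring

theorem baseForm_update_ex (i j : Fin 3) :
    baseForm (Function.update ex i (ey j)) = if i = j then -1 else 0 := by
  rw [baseForm_update_smul ex (cvec_ey j)]
  split_ifs with h
  · rw [h, Function.update_eq_self, baseForm_ex, Complex.I_mul_I]
  · rw [baseForm.map_update_self ex h, mul_zero]

theorem baseForm_update_ey (i j : Fin 3) :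
    baseForm (Function.update ey i (ex j)) = if i = j then -Complex.I else 0 := by
  have hc : cvec (ex j) = (-Complex.I) • cvec (ey j) := by
    rw [cvec_ey, smul_smul, neg_mul, Complex.I_mul_I, neg_neg, one_smul]
  rw [baseForm_update_smul ey hc]
  split_ifs with h
  · rw [h, Function.update_eq_self, baseForm_ey, mul_one]
  · rw [baseForm.map_update_self ey h, mul_zero]

theorem basePoint_mem_UPlus : basePoint ∈ UPlus 3 := by
  refine (mem_UPlus_iff _).2 ⟨basePoint_mem_U, ?_⟩
  rw [loopArea, toForm_basePoint, baseForm_ex, baseForm_update_ex]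
  simp

theorem normRatio_basePoint : normRatio basePoint = 1 := by
  rw [normRatio, toForm_basePoint, baseForm_ex, baseForm_ey]
  simp only [baseForm_update_ex, baseForm_update_ey, Fin.sum_univ_three]
  simp
  norm_num

/-- The quadratic covariant of the real part of a primitive form. -/
def kappaRe (Ω : Prim 3) (v w : V 3) : ℝ := kappa ex ey (rePart (toForm Ω)) v w

/-- The factor i in the base form puts its real part into the normal form for the standard frame,
with all aᵢ = -1 and b = 1; the covariant is then -4 times the identity. -/
theorem kappaRe_basePoint (i j : Fin 3 ⊕ Fin 3) :
    kappaRe basePoint (Pi.single i 1) (Pi.single j 1) = if i = j then -4 else 0 := by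
  set α := rePart (toForm basePoint) with hα
  have v0 : α ex = 0 := by rw [hα, rePart_apply, toForm_basePoint, baseForm_ex, Complex.I_re]
  have v3 : α ey = 1 := by rw [hα, rePart_apply, toForm_basePoint, baseForm_ey, Complex.one_re]
  have v1 : ∀ i j, α (Function.update ex i (ey j)) = if i = j then -1 else 0 := fun i j => by
    rw [hα, rePart_apply, toForm_basePoint, baseForm_update_ex, apply_ite Complex.re]
    simp
  have v2 : ∀ i j, α (Function.update ey i (ex j)) = 0 := fun i j => by
    rw [hα, rePart_apply, toForm_basePoint, baseForm_update_ey, apply_ite Complex.re]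
    simp
  have h1 : ∀ i j k, tri α (ey i) (ex j) (ex k) = (-1) * levi i j k := by
    intro i j k
    have e0 := v1 0 i
    have e1 := v1 1 i
    have e2 := v1 2 i
    rw [(update_fin_three _ _).1, ← tri_apply] at e0
    rw [(update_fin_three _ _).2.1, ← tri_apply, tri_swap₁₂] at e1
    rw [(update_fin_three _ _).2.2, ← tri_apply, tri_rotate, tri_rotate] at e2
    rw [tri_eq_levi, e0, e2, neg_eq_iff_eq_neg.1 e1]
    fin_cases i <;> simp
  have h3 : ∀ i j k, tri α (ey i) (ey j) (ey k) = 1 * levi i j k := by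
    intro i j k
    rw [tri_frame_eq_levi, tri_apply, ← v3]
    congr 2
    ext i : 1
    fin_cases i <;> rfl
  obtain ⟨kee, kff, kef, kfe⟩ := kappa_normalForm (a := fun _ => -1) (tri_eq_zero_of_frame v0) h1
    (fun i => tri_eq_zero_of_pairs fun l => v2 l i) h3
  rcases i with i | i <;> rcases j with j | j
  · refine (kee i j).trans ?_
    simp only [Sum.inl.injEq]
    fin_cases i <;> simp
  · exact (kef i j).trans (by simp)
  · exact (kfe i j).trans (by simp)
  · refine (kff i j).trans ?_
    simp only [Sum.inr.injEq]
    simp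

/-! ### The total mass of the moduli space is not zero -/

/-- Unfold W along the translates of C: its mass is at most the integral over C of the number of g
with T g x ∈ W. Any two such g differ by an element of S, so that number is at most the cardinality
of S. -/
theorem measure_le_card_mul_of_subset_iUnion {X G : Type*} [MeasurableSpace X] [Group G]
    [Countable G] {T : G → X → X} {μ : Measure X} (hm : ∀ g, Measurable (T g))
    (hμ : ∀ g s, μ (T g '' s) = μ s) {W C : Set X} (hW : MeasurableSet W)
    (hWC : W ⊆ ⋃ g, T g '' C) (S : Finset G)
    (hS : ∀ x g h, T g x ∈ W → T h x ∈ W → g⁻¹ * h ∈ S) : μ W ≤ S.card * μ C := by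
  classical
  have hle : ∀ x, ∑' g, ((T g ⁻¹' W).indicator (fun _ => (1 : ENNReal)) x) ≤ S.card := by
    intro x
    by_cases hx : ∃ g, T g x ∈ W
    · obtain ⟨g, hg⟩ := hx
      have h0 : ∀ h ∉ S.image (g * ·), (T h ⁻¹' W).indicator (fun _ => (1 : ENNReal)) x = 0 := by
        intro h hh
        refine indicator_of_notMem (fun hx => hh ?_) _
        exact Finset.mem_image.2 ⟨g⁻¹ * h, hS x g h hg hx, mul_inv_cancel_left g h⟩
      rw [tsum_eq_sum h0]
      calc _ ≤ ∑ _h ∈ S.image (g * ·), (1 : ENNReal) :=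
            Finset.sum_le_sum fun h _ => indicator_le_self' (fun _ _ => zero_le_one) x
        _ ≤ S.card := by
            rw [Finset.sum_const, nsmul_one]
            exact_mod_cast Finset.card_image_le
    · have h0 : ∀ h, (T h ⁻¹' W).indicator (fun _ => (1 : ENNReal)) x = 0 := fun h =>
        indicator_of_notMem (s := T h ⁻¹' W) (fun hh => hx ⟨h, hh⟩) _
      simp [h0]
  calc μ W ≤ μ (⋃ g, T g '' (T g ⁻¹' W ∩ C)) := by
        refine measure_mono fun x hx => ?_
        obtain ⟨g, y, hy, rfl⟩ := mem_iUnion.1 (hWC hx)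
        exact mem_iUnion.2 ⟨g, y, ⟨hx, hy⟩, rfl⟩
    _ ≤ ∑' g, μ (T g '' (T g ⁻¹' W ∩ C)) := measure_iUnion_le _
    _ = ∑' g, ∫⁻ x in C, (T g ⁻¹' W).indicator (fun _ => (1 : ENNReal)) x ∂μ := by
        refine tsum_congr fun g => ?_
        rw [hμ, lintegral_indicator_const (hm g hW), one_mul, Measure.restrict_apply (hm g hW)]
    _ = ∫⁻ x in C, ∑' g, (T g ⁻¹' W).indicator (fun _ => (1 : ENNReal)) x ∂μ :=
        (lintegral_tsum fun g =>
          (measurable_const.indicator (hm g hW)).aemeasurable).symm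
    _ ≤ ∫⁻ _ in C, (S.card : ENNReal) ∂μ := lintegral_mono hle
    _ = S.card * μ C := by rw [setLIntegral_const]

theorem le_quotientMeasure_univ {X Y : Type*} [MeasurableSpace X] [MeasurableSpace Y] {π : X → Y}
    (hπ : Measurable π) {m : Measure X} {c : ENNReal}
    (h : ∀ F, MeasurableSet F → univ ⊆ π '' F → c ≤ m F) : c ≤ quotientMeasure π hπ m univ := by
  rw [quotientMeasure, toMeasure_apply _ _ MeasurableSet.univ]
  exact le_iInf₂ fun F hF => le_iInf fun hBF => h F hF hBF

/-! ### Finiteness of returns near the base point -/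

theorem kappaRe_smul (r : ℝ) (Ω : Prim 3) (v w : V 3) :
    kappaRe (r • Ω) v w = r ^ 2 * kappaRe Ω v w := by
  rw [kappaRe, kappaRe, ← kappa_smul]
  congr 1
  ext v
  exact Complex.smul_re ..

theorem kappaRe_pullPrim (g : Matrix.symplecticGroup (Fin 3) ℤ) (Ω : Prim 3) (v w : V 3) :
    kappaRe (pullPrim g Ω) v w = kappaRe Ω (spLin g v) (spLin g w) := by
  have h : rePart (toForm (pullPrim g Ω)) = (rePart (toForm Ω)).compLinearMap (spLin g) := rfl
  rw [kappaRe, kappaRe, ← (isSympFrame_spLin g).kappa_eq (rePart (toForm Ω)), h]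
  simp only [kappa, contr, tri_compLinearMap]

theorem continuous_kappaRe (v w : V 3) : Continuous fun Ω : Prim 3 => kappaRe Ω v w := by
  have h : ∀ u v w, Continuous fun Ω : Prim 3 => tri (rePart (toForm Ω)) u v w := fun u v w =>
    Complex.continuous_re.comp (continuous_toForm_apply ![u, v, w])
  simp only [kappaRe, kappa, contr]
  fun_prop

theorem kappaRe_self_eq_sum (Ω : Prim 3) (w : V 3) : kappaRe Ω w w =
    ∑ i, ∑ j, w i * w j * kappaRe Ω (Pi.single i 1) (Pi.single j 1) := by
  have h1 := isLinearMap_eq_sum (isLinearMap_kappa_left ex ey (rePart (toForm Ω)) w) w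
  refine h1.trans (Finset.sum_congr rfl fun i _ => ?_)
  have h2 := isLinearMap_eq_sum
    (isLinearMap_kappa_right ex ey (rePart (toForm Ω)) (Pi.single i 1)) w
  rw [h2, Finset.smul_sum]
  refine Finset.sum_congr rfl fun j _ => ?_
  rw [smul_smul]
  rfl

/-- A neighbourhood of a multiple of the base point on which the quadratic covariant is
uniformly definite. -/
def definiteSet : Set (Prim 3) :=
  {Ω | Ω ∈ UPlus 3 ∧ normRatio Ω ∈ Ioo 0 1 ∧ ∀ i j,
    |kappaRe Ω (Pi.single i 1) (Pi.single j 1) + if i = j then 4 * normRatio Ω else 0| <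
      normRatio Ω / 6}

theorem isOpen_definiteSet : IsOpen definiteSet := by
  have h : definiteSet = UPlus 3 ∩ (normRatio ⁻¹' Ioo 0 1 ∩ ⋂ i, ⋂ j,
      {Ω | |kappaRe Ω (Pi.single i 1) (Pi.single j 1) + if i = j then 4 * normRatio Ω else 0| <
        normRatio Ω / 6}) := by
    ext Ω
    simp only [definiteSet, mem_ofPred_eq, mem_inter_iff, mem_preimage, mem_iInter]
  rw [h]
  refine (isOpen_UPlus 3).inter ((isOpen_Ioo.preimage continuous_normRatio).inter
    (isOpen_iInter_of_finite fun i => isOpen_iInter_of_finite fun j => ?_))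
  refine isOpen_lt ?_ (continuous_normRatio.div_const 6)
  refine ((continuous_kappaRe _ _).add ?_).abs
  split_ifs
  · exact continuous_const.mul continuous_normRatio
  · exact continuous_const

theorem smul_mem_UPlus {r : ℝ} (hr : r ≠ 0) {Ω : Prim 3} (h : Ω ∈ UPlus 3) : r • Ω ∈ UPlus 3 := by
  rw [mem_UPlus_iff] at h ⊢
  have hv : ∀ v : Fin 3 → V 3, toForm (r • Ω) v = r * toForm Ω v := fun v => Complex.real_smul ..
  refine ⟨(mem_U_iff _).2 fun v hv' => ?_, ?_⟩
  · exact (hv v).trans_ne (mul_ne_zero (Complex.ofReal_ne_zero.2 hr) ((mem_U_iff _).1 h.1 v hv'))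
  · have h1 : loopArea (toForm (r • Ω)) = r ^ 2 * loopArea (toForm Ω) := by
      rw [loopArea, loopArea, hv, hv, map_mul, Complex.conj_ofReal, ← Complex.im_ofReal_mul]
      congr 1
      push_cast
      ring
    rw [h1]
    exact mul_pos (by positivity) h.2

theorem nonempty_definiteSet : definiteSet.Nonempty := by
  -- The base point has norm ratio 1; halving it gives 1/4, inside the open interval.
  refine ⟨(2⁻¹ : ℝ) • basePoint, smul_mem_UPlus (by norm_num) basePoint_mem_UPlus, ?_, ?_⟩
  · rw [normRatio_smul, normRatio_basePoint]
    constructor <;> norm_num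
  · intro i j
    rw [kappaRe_smul, kappaRe_basePoint, normRatio_smul, normRatio_basePoint]
    split_ifs <;> norm_num

/-- Write κ as -4N times the identity plus an error with entries below N/6. By Cauchy–Schwarz in six
variables the error contributes at most N |w|². -/
theorem sum_sq_le_of_mem_definiteSet {Ω : Prim 3} (h : Ω ∈ definiteSet) (w : V 3) :
    3 * normRatio Ω * ∑ i, w i ^ 2 ≤ -kappaRe Ω w w := by
  obtain ⟨-, hN, hK⟩ := h
  set N := normRatio Ω
  have h1 : ∀ i j, w i * w j * kappaRe Ω (Pi.single i 1) (Pi.single j 1) ≤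
      |w i| * |w j| * (N / 6) - if i = j then 4 * N * w i ^ 2 else 0 := by
    intro i j
    have h2 : w i * w j * (kappaRe Ω (Pi.single i 1) (Pi.single j 1) +
        if i = j then 4 * N else 0) ≤ |w i| * |w j| * (N / 6) := by
      refine (le_abs_self _).trans ?_
      rw [abs_mul, abs_mul]
      gcongr
      exact (hK i j).le
    split_ifs at h2 ⊢ with hij
    · subst hij
      linarith
    · linarith
  have h2 : kappaRe Ω w w ≤ (∑ i, |w i|) ^ 2 * (N / 6) - 4 * N * ∑ i, w i ^ 2 := by
    rw [kappaRe_self_eq_sum]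
    refine (Finset.sum_le_sum fun i _ => Finset.sum_le_sum fun j _ => h1 i j).trans_eq ?_
    simp only [Finset.sum_sub_distrib, Finset.sum_ite_eq, Finset.mem_univ, if_true, sq (∑ i, |w i|),
      Finset.sum_mul, Finset.mul_sum]
    congr 1
    refine Finset.sum_congr rfl fun i _ => Finset.sum_congr rfl fun j _ => ?_
    rw [mul_comm |w i|]
  have h3 : (∑ i, |w i|) ^ 2 ≤ 6 * ∑ i, w i ^ 2 := by
    have := sq_sum_le_card_mul_sum_sq (s := Finset.univ) (f := fun i => |w i|)
    simpa only [sq_abs, Finset.card_univ, Fintype.card_sum, Fintype.card_fin, Nat.reduceAdd,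
      Nat.cast_ofNat] using this
  have h4 := mul_le_mul_of_nonneg_right h3 (show 0 ≤ N / 6 by linarith [hN.1])
  linarith

/-- The integral symplectic matrices with entries in `{-1, 0, 1}`. -/
def smallMatrices : Set (Matrix.symplecticGroup (Fin 3) ℤ) :=
  {g | ∀ i j, g.1 i j ∈ Icc (-1) 1}

theorem finite_smallMatrices : smallMatrices.Finite := by
  have h : {M : Matrix (Fin 3 ⊕ Fin 3) (Fin 3 ⊕ Fin 3) ℤ | ∀ i j, M i j ∈ Icc (-1 : ℤ) 1}.Finite :=
    Set.Finite.pi' fun i => Set.Finite.pi' fun j => finite_Icc _ _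
  exact h.preimage Subtype.val_injective.injOn

/-- The value of -κ on the j-th column of g is at least 3N times its squared length. It is also the
j-th diagonal value of -κ for the pulled back form, which is below (4 + 1/6) N as pullback preserves
N. So the squared length is less than 2, and the integral entries are at most 1 in absolute value.
-/
theorem mem_smallMatrices {g : Matrix.symplecticGroup (Fin 3) ℤ} {Ω : Prim 3}
    (h : Ω ∈ definiteSet) (h' : pullPrim g Ω ∈ definiteSet) : g ∈ smallMatrices := by
  intro i j
  have h1 := sum_sq_le_of_mem_definiteSet h (spLin g (Pi.single j 1))
  have h2 := h'.2.2 j j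
  rw [kappaRe_pullPrim, normRatio_pullPrim, if_pos rfl, abs_lt] at h2
  have hN := h.2.1.1
  have h3 : ∀ k, spLin g (Pi.single j 1) k = (g.1 k j : ℝ) := fun k => by
    rw [spLin, Matrix.toLin'_apply, Matrix.mulVec_single_one]
    rfl
  simp only [h3] at h1
  have h4 : ((g.1 i j : ℝ)) ^ 2 ≤ ∑ k, (g.1 k j : ℝ) ^ 2 :=
    Finset.single_le_sum (f := fun k => (g.1 k j : ℝ) ^ 2) (fun k _ => sq_nonneg _)
      (Finset.mem_univ i)
  have h5 : ((g.1 i j : ℝ)) ^ 2 < 2 := by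
    by_contra hcon
    have := mul_le_mul_of_nonneg_left ((not_lt.1 hcon).trans h4)
      (show 0 ≤ 3 * normRatio Ω by linarith)
    linarith [h2.1]
  have h6 : (g.1 i j) ^ 2 < 2 := by exact_mod_cast h5
  constructor <;> nlinarith

theorem measurable_pullPrim (g : Matrix.symplecticGroup (Fin 3) ℤ) : Measurable (pullPrim g) :=
  (LinearMap.continuous_of_finiteDimensional (E := Prim 3) (F' := Prim 3)
    (pullPrim g)).measurable

theorem definiteSet_subset_iUnion {F : Set (UOne 3)} (hF : univ ⊆ Moduli.mk '' F) :
    definiteSet ⊆ ⋃ g, pullPrim g '' (coneMap '' (Prod.snd ⁻¹' F)) := by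
  intro Ω hΩ
  have hN := hΩ.2.1
  -- The ray through Ω meets the hypersurface at Ω / r, because the norm ratio is quadratic; r < 1
  -- puts Ω in the cone.
  set r := √(normRatio Ω) with hr
  have hr0 : 0 < r := Real.sqrt_pos.2 hN.1
  have hr1 : r < 1 := by
    rw [hr, Real.sqrt_lt' one_pos, one_pow]
    exact hN.2
  have h1 : r⁻¹ • Ω ∈ UOne 3 := by
    rw [mem_UOne_iff]
    refine ⟨smul_mem_UPlus (inv_ne_zero hr0.ne') hΩ.1, ?_⟩
    rw [normRatio_smul, inv_pow, hr, Real.sq_sqrt hN.1.le, inv_mul_cancel₀ hN.1.ne']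
  obtain ⟨Ω', hΩ', h2⟩ := hF (mem_univ (Moduli.mk ⟨r⁻¹ • Ω, h1⟩))
  obtain ⟨g, hg⟩ := Quotient.exact h2
  refine mem_iUnion.2 ⟨g, _, ⟨(⟨r, hr0, hr1⟩, Ω'), hΩ', rfl⟩, ?_⟩
  have h3 : r⁻¹ • Ω = pullPrim g Ω'.1 := toForm_injective hg
  change pullPrim g (r • Ω'.1) = Ω
  rw [map_smul, ← h3, smul_smul, mul_inv_cancel₀ hr0.ne', one_smul]

theorem one_le_finrank {E : Type*} [NormedAddCommGroup E] [NormedSpace ℝ E] [Module.Finite ℝ E]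
    {x : E} (hx : x ≠ 0) : 1 ≤ Module.finrank ℝ E := by
  have : Nontrivial E := ⟨x, 0, hx⟩
  exact Module.finrank_pos

theorem liouvilleMeasure_image_pullPrim (g : Matrix.symplecticGroup (Fin 3) ℤ)
    (s : Set (Prim 3)) :
    liouvilleMeasure (symp 3) (pullPrim g '' s) = liouvilleMeasure (symp 3) s := by
  rw [liouvilleMeasure_image, abs_det_pullPrim, ENNReal.ofReal_one, one_mul]

theorem liouvilleMeasure_definiteSet_le {F : Set (UOne 3)} (hF : MeasurableSet F)
    (hF' : univ ⊆ Moduli.mk '' F) : liouvilleMeasure (symp 3) definiteSet ≤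
      finite_smallMatrices.toFinset.card * muOne 3 F := by
  have := countable_symplecticGroup 3
  refine (measure_le_card_mul_of_subset_iUnion measurable_pullPrim
    liouvilleMeasure_image_pullPrim isOpen_definiteSet.measurableSet
    (definiteSet_subset_iUnion hF') finite_smallMatrices.toFinset ?_).trans ?_
  · intro Ω g h hg hh
    rw [Set.Finite.mem_toFinset]
    refine mem_smallMatrices hg ?_
    rwa [← pullPrim_mul_apply, mul_inv_cancel_left]
  · gcongr
    rw [muOne_apply hF]
    -- The cone measure is `dim P` times the mass of the cone, so for this bound it is enough that P
    -- is not zero.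
    have h1 : basePoint ≠ 0 := fun h0 => by
      have h2 := baseForm_ey
      rw [← toForm_basePoint, h0] at h2
      exact zero_ne_one h2
    have h3 : (1 : ENNReal) ≤ Module.finrank ℝ (Prim 3) := by
      exact_mod_cast one_le_finrank (E := Prim 3) h1
    exact le_mul_of_one_le_left' h3

/-- Every measurable set of representatives has mass at least that of the definite neighbourhood
divided by the number of small matrices, and the neighbourhood is open and non-empty. -/
theorem Moduli.vol_univ_ne_zero : Moduli.vol 3 univ ≠ 0 := by
  have h : liouvilleMeasure (symp 3) definiteSet / finite_smallMatrices.toFinset.card ≤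
      Moduli.vol 3 univ :=
    le_quotientMeasure_univ Moduli.continuous_mk.measurable fun F hF hF' =>
      ENNReal.div_le_of_le_mul' (liouvilleMeasure_definiteSet_le hF hF')
  have h0 := ENNReal.div_pos
    (liouvilleMeasure_symp_pos isOpen_definiteSet nonempty_definiteSet).ne'
    (ENNReal.natCast_ne_top finite_smallMatrices.toFinset.card)
  exact (h0.trans_le h).ne'

end LagForms

end

/-- The natural measure on `ℳ₁(3) = 𝒰₁⁺(ℝ⁶) / Sp(6, ℤ)` is `SL(2, ℝ)`-invariant and has infinite
total mass; in fact every non-zero Borel measure on `ℳ₁(3)` which is invariant under the diagonal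
subgroup `{diag(e ^ t, e ^ (-t))}` of `SL(2, ℝ)` has infinite total mass. -/
theorem mainTheorem1 :
    (∀ g : Matrix.SpecialLinearGroup (Fin 2) ℝ,
      MeasurePreserving (LagForms.Moduli.act (n := 3) (by decide) g)
        (LagForms.Moduli.vol 3) (LagForms.Moduli.vol 3)) ∧
    LagForms.Moduli.vol 3 univ = ⊤ ∧
    ∀ μ : Measure (LagForms.Moduli 3),
      (∀ t : ℝ, MeasurePreserving
        (LagForms.Moduli.act (n := 3) (by decide) (LagForms.diagSL t)) μ μ) →
      μ ≠ 0 → μ univ = ⊤ := by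
  exact ⟨LagForms.Moduli.measurePreserving_act,
    LagForms.Moduli.measure_univ_eq_top
      (LagForms.Moduli.measurePreserving_act (LagForms.diagSL 1))
      fun h => LagForms.Moduli.vol_univ_ne_zero (by rw [h]; rfl),
    fun _ h hμ => LagForms.Moduli.measure_univ_eq_top (h 1) hμ⟩
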